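/- **Setting.** Let $g(x,y)=x_0y_0-x_1y_1-\dots-x_4y_4$ on $\mathbb R^5$, let $dS=\{x: g(x,x)=-1\}$, and let $SO_0(4,1)$ be the proper orthochronous Lorentz group. A point of $dS$ is written $(\tan\tau,\omega/\cos\tau)$ with conformal time $\tau\in(-\pi/2,\pi/2)$ and $\omega\in S^3$. For $0<\alpha\le\pi/2$ the Robertson–Walker space-time with embedding parameter $\alpha$ is identified with its conformal image $RW=\{x\in dS:|\tau|<\alpha\}$. The de Sitter wedges are the sets $W=\lambda\{x_1>|x_0|\}\cap dS$, $\lambda\in SO_0(4,1)$, with edge $E=\lambda\{x_0=x_1=0\}\cap dS$. Let $\Phi:dS\to RW$, $(\tau,\omega)\mapsto(\arcsin(\sin\alpha\sin\tau),\omega)$, and let $\Xi(W)$ be the connected component of the causal complement of $\Phi(E)$ in $RW$ which meets $W$; the sets $\Xi(W)$ are the Robertson–Walker wedges. A covariant de Sitter theory consists of von Neumann algebras $\mathcal R(W)$ on a complex Hilbert space, indexed by the de Sitter wedges, a unit vector $\Omega$, and a strongly continuous unitary representation $U$ of $SO_0(4,1)$ with $U(\lambda)\mathcal R(W)U(\lambda)^{-1}=\mathcal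 R(\lambda W)$ and $U(\lambda)\Omega=\Omega$. It has the geodesic KMS property if for each wedge $W$, with $\alpha^W_t$ the adjoint action of the boost group which leaves $W$ invariant and induces a future directed timelike flow on $W$, there is $\beta>0$ such that for all $A,B\in\mathcal R(W)$ there is a continuous function $F$ on $\{0\le\operatorname{Im}z\le\beta\}$, analytic in the interior, with $F(t)=\langle\Omega,A\alpha^W_t(B)\Omega\rangle$ and $F(t+i\beta)=\langle\Omega,\alpha^W_t(B)A\Omega\rangle$ for all $t\in\mathbb R$. The transplanted net is $\mathcal R_{RW}(\Xi(W))=\mathcal R(W)$, with state vector $\Omega$. Let $t\mapsto x_t$, $t\in\mathbb R$, be a worldline in $RW$: an inextendible $C^2$ curve with future directed timelike velocity $\dot x_t$ (with any such parametrization by $\mathbb R$). Put $a_t=d^2x_t/ds^2\in\mathbb R^5$, where $s=s(t)$ is the de Sitter proper time, $M_t=g(\dot x_t,\cdot)\,a_t-g(a_t,\cdot)\,\dot x_t$, let $\lambda_t=T\exp\int_0^tM_s\,ds$, i.e. $\dot\lambda_t=M_t\lambda_t$ and $\lambda_0=1$, and put $\alpha_{t,s}=\mathrm{Ad}\,U(\lambda_t\lambda_s^{-1})$.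 Let $H_s$ be the self-adjoint generator of $t\mapsto U(\exp(tM_s))=e^{itH_s}$. **Theorem.** Assume that the de Sitter theory has the geodesic KMS property. 1. For each $s\in\mathbb R$ there is a unique de Sitter wedge $W_s$ which is left invariant by the boosts $\exp(tM_s)$, $t\in\mathbb R$, and on which they induce a future directed timelike flow. 2. For each $s\in\mathbb R$, the state is quasi-passive for $\alpha_{t,s}$ on $\mathcal R_{RW}(\Xi(W_s))$: let $V$ be a unitary in this algebra for which the derivative of $t\mapsto\alpha_{t,s}(V)$ at $t=s$ exists as a bounded operator in the weak operator topology. Then $V\Omega$ is in the domain of $H_s$, and $$-i\,\frac{d}{dt}\langle\Omega,V^*\alpha_{t,s}(V)\Omega\rangle\Big|_{t=s}=\langle\Omega,V^*H_sV\Omega\rangle\ \ge\ 0 .$$ Likewise, if $V$ is a unitary in this algebra for which $t\mapsto\mathrm{Ad}\,U(\exp(tM_s))(V)$ is differentiable at $t=0$ in this sense, then $V\Omega$ is in the domain of $H_s$ and $\langle\Omega,V^*H_sV\Omega\rangle\ge0$. 3. For all $s\in\mathbb R$, $x_s\in W_s$. There is exactly one $t_0$ at which the worldline meets the hypersurface $\tau=0$,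 and there is an open interval $I\ni t_0$ such that $x_s\in\Xi(W_s)$ for all $s\in I$. If $\alpha=\pi/2$, then $x_s\in\Xi(W_s)$ for all $s\in\mathbb R$. -/

import Mathlib

open Matrix Filter Topology

noncomputable section

namespace DSRW

/-! ### Five-dimensional Minkowski space and de Sitter space -/

/-- Ambient five-dimensional space, with coordinates `x 0, …, x 4`; `x 0` is the time. -/
abbrev M5 : Type := Fin 5 → ℝ

/-- Gram matrix of the Minkowski form, of signature (+,-,-,-,-). -/
def eta : Matrix (Fin 5) (Fin 5) ℝ := Matrix.diagonal ![1, -1, -1, -1, -1]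

/-- The Minkowski form. -/
def gm (x y : M5) : ℝ := x ⬝ᵥ (eta *ᵥ y)

theorem gm_apply (x y : M5) :
    gm x y = x 0 * y 0 - x 1 * y 1 - x 2 * y 2 - x 3 * y 3 - x 4 * y 4 := by
  simp [gm, eta, dotProduct, Fin.sum_univ_succ, Matrix.mulVec_diagonal]
  ring

/-- De Sitter space as the unit one-sheeted hyperboloid. -/
def dS : Set M5 := {x | gm x x = -1}

/-- A timelike vector pointing to the future. -/
def FutureTimelike (v : M5) : Prop := 0 < gm v v ∧ 0 < v 0

/-! ### The proper orthochronous de Sitter group and its one-parameter subgroups -/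

theorem gm_mulVec (A : Matrix (Fin 5) (Fin 5) ℝ) (h : Aᵀ * eta * A = eta) (x y : M5) :
    gm (A *ᵥ x) (A *ᵥ y) = gm x y := by
  unfold gm
  rw [Matrix.mulVec_mulVec, ← Matrix.vecMul_transpose, ← Matrix.dotProduct_mulVec,
    Matrix.mulVec_mulVec, ← Matrix.mul_assoc, h]

/-- `SO₀(4,1)`: the real matrices of determinant one which preserve the Minkowski form and
map future timelike vectors to future timelike vectors. -/
def SO0 : Subgroup (Matrix.SpecialLinearGroup (Fin 5) ℝ) where
  carrier := {g | g.1ᵀ * eta * g.1 = eta ∧ ∀ v, FutureTimelike v → FutureTimelike (g.1 *ᵥ v)}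
  one_mem' := by simp
  mul_mem' := by
    rintro a b ⟨ha, ha'⟩ ⟨hb, hb'⟩
    refine ⟨?_, fun v hv => ?_⟩
    · rw [Matrix.SpecialLinearGroup.coe_mul, Matrix.transpose_mul]
      calc b.1ᵀ * a.1ᵀ * eta * (a.1 * b.1) = b.1ᵀ * (a.1ᵀ * eta * a.1) * b.1 := by
            simp only [Matrix.mul_assoc]
        _ = eta := by rw [ha, hb]
    · rw [Matrix.SpecialLinearGroup.coe_mul, ← Matrix.mulVec_mulVec]
      exact ha' _ (hb' _ hv)
  inv_mem' := by
    rintro a ⟨ha, ha'⟩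
    have h1 : a.1 * (a⁻¹).1 = 1 := by
      rw [← Matrix.SpecialLinearGroup.coe_mul]; simp
    have h2 : (a⁻¹).1ᵀ * a.1ᵀ = 1 := by
      rw [← Matrix.transpose_mul, h1, Matrix.transpose_one]
    have h3 : (a⁻¹).1ᵀ * eta * (a⁻¹).1 = eta := by
      calc (a⁻¹).1ᵀ * eta * (a⁻¹).1
          = (a⁻¹).1ᵀ * (a.1ᵀ * eta * a.1) * (a⁻¹).1 := by rw [ha]
        _ = ((a⁻¹).1ᵀ * a.1ᵀ) * eta * (a.1 * (a⁻¹).1) := by simp only [Matrix.mul_assoc]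
        _ = eta := by rw [h1, h2]; simp
    refine ⟨h3, fun v hv => ?_⟩
    have h4 : a.1 *ᵥ ((a⁻¹).1 *ᵥ v) = v := by rw [Matrix.mulVec_mulVec, h1, Matrix.one_mulVec]
    set w := (a⁻¹).1 *ᵥ v with hw
    have h5 : gm w w = gm v v := gm_mulVec _ h3 v v
    have h6 : 0 < gm w w := h5 ▸ hv.1
    refine ⟨h6, ?_⟩
    rcases lt_trichotomy (w 0) 0 with h | h | h
    · have h7 : FutureTimelike (-w) := by
        refine ⟨?_, by simpa using h⟩
        rw [gm_apply] at h6 ⊢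
        simpa using h6
      have h8 := (ha' _ h7).2
      rw [Matrix.mulVec_neg, h4] at h8
      have h9 := hv.2
      simp only [Pi.neg_apply] at h8
      linarith
    · rw [gm_apply, h] at h6
      nlinarith [sq_nonneg (w 1), sq_nonneg (w 2), sq_nonneg (w 3), sq_nonneg (w 4)]
    · exact h

/-- The linear action of the de Sitter group on the ambient space. -/
def act (g : SO0) (x : M5) : M5 := g.1.1 *ᵥ x

theorem act_mul (g h : SO0) (x : M5) : act (g * h) x = act g (act h x) := by
  simp [act, Matrix.mulVec_mulVec]

theorem act_mem_dS (g : SO0) (x : M5) : act g x ∈ dS ↔ x ∈ dS := by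
  simp only [dS, Set.mem_ofPred_eq, act, gm_mulVec _ g.2.1]

/-- The Lie algebra `so(4,1)`: matrices which are skew-adjoint for the Minkowski form. -/
def IsSkew (M : Matrix (Fin 5) (Fin 5) ℝ) : Prop := Mᵀ * eta = -(eta * M)

theorem eta_mul_eta : eta * eta = 1 := by
  rw [eta, Matrix.diagonal_mul_diagonal, ← Matrix.diagonal_one]
  congr 1
  funext i
  fin_cases i <;> simp

theorem IsSkew.smul {M : Matrix (Fin 5) (Fin 5) ℝ} (h : IsSkew M) (t : ℝ) :
    IsSkew (t • M) := by
  unfold IsSkew at *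
  rw [Matrix.transpose_smul, Matrix.smul_mul, h, Matrix.mul_smul, smul_neg]

theorem IsSkew.exp_preserves {M : Matrix (Fin 5) (Fin 5) ℝ} (h : IsSkew M) :
    (NormedSpace.exp M)ᵀ * eta * NormedSpace.exp M = eta := by
  have hu : IsUnit eta := IsUnit.of_mul_eq_one eta eta_mul_eta
  have hi : eta⁻¹ = eta := Matrix.inv_eq_left_inv eta_mul_eta
  have h1 : Mᵀ = eta * (-M) * eta⁻¹ := by
    rw [hi, Matrix.mul_neg, ← h, Matrix.mul_assoc, eta_mul_eta, Matrix.mul_one]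
  have h2 : IsUnit (NormedSpace.exp M) := Matrix.isUnit_exp M
  have h3 : (NormedSpace.exp M)⁻¹ * NormedSpace.exp M = 1 :=
    Matrix.nonsing_inv_mul _ ((Matrix.isUnit_iff_isUnit_det _).1 h2)
  rw [← Matrix.exp_transpose, h1, Matrix.exp_conj _ _ hu, Matrix.exp_neg, hi]
  calc eta * (NormedSpace.exp M)⁻¹ * eta * eta * NormedSpace.exp M
      = eta * ((NormedSpace.exp M)⁻¹ * (eta * eta) * NormedSpace.exp M) := by
        simp only [Matrix.mul_assoc]
    _ = eta := by rw [eta_mul_eta, Matrix.mul_one, h3, Matrix.mul_one]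

theorem IsSkew.det_exp {M : Matrix (Fin 5) (Fin 5) ℝ} (h : IsSkew M) :
    (NormedSpace.exp M).det = 1 := by
  have key : ∀ N : Matrix (Fin 5) (Fin 5) ℝ, IsSkew N →
      (NormedSpace.exp N).det ^ 2 = 1 := by
    intro N hN
    have h1 := congrArg Matrix.det hN.exp_preserves
    have h2 : eta.det * eta.det = 1 := by rw [← Matrix.det_mul, eta_mul_eta, Matrix.det_one]
    rw [Matrix.det_mul, Matrix.det_mul, Matrix.det_transpose] at h1
    have h3 : eta.det ≠ 0 := by
      intro h0
      rw [h0] at h2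
      simp at h2
    apply mul_right_cancel₀ h3
    linarith
  have h2 : NormedSpace.exp M = NormedSpace.exp ((1 / 2 : ℝ) • M) ^ 2 := by
    rw [← Matrix.exp_nsmul, ← Nat.cast_smul_eq_nsmul ℝ, smul_smul]
    norm_num
  rw [h2, Matrix.det_pow]
  exact key _ (h.smul _)

section
attribute [local instance] Matrix.linftyOpNormedRing Matrix.linftyOpNormedAlgebra

theorem continuous_exp_smul_mulVec (M : Matrix (Fin 5) (Fin 5) ℝ) (v : M5) :
    Continuous fun t : ℝ => (NormedSpace.exp (t • M) *ᵥ v) 0 := by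
  have h : Continuous fun t : ℝ => NormedSpace.exp (t • M) :=
    continuous_iff_continuousAt.2 fun t => (hasDerivAt_exp_smul_const M t).continuousAt
  have h2 : ∀ A : ℝ → Matrix (Fin 5) (Fin 5) ℝ, Continuous A →
      Continuous fun t => (A t *ᵥ v) 0 := fun A hA =>
    (continuous_apply 0).comp (hA.matrix_mulVec continuous_const)
  exact h2 _ h

end

theorem IsSkew.exp_future {M : Matrix (Fin 5) (Fin 5) ℝ} (h : IsSkew M) (v : M5)
    (hv : FutureTimelike v) : FutureTimelike (NormedSpace.exp M *ᵥ v) := by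
  have h1 : ∀ t : ℝ, 0 < gm (NormedSpace.exp (t • M) *ᵥ v) (NormedSpace.exp (t • M) *ᵥ v) := by
    intro t
    rw [gm_mulVec _ (h.smul t).exp_preserves]
    exact hv.1
  have h2 : ∀ t : ℝ, (NormedSpace.exp (t • M) *ᵥ v) 0 ≠ 0 := by
    intro t h0
    have h3 := h1 t
    rw [gm_apply, h0] at h3
    nlinarith [sq_nonneg ((NormedSpace.exp (t • M) *ᵥ v) 1),
      sq_nonneg ((NormedSpace.exp (t • M) *ᵥ v) 2),
      sq_nonneg ((NormedSpace.exp (t • M) *ᵥ v) 3),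
      sq_nonneg ((NormedSpace.exp (t • M) *ᵥ v) 4)]
  refine ⟨by simpa using h1 1, ?_⟩
  by_contra hneg
  have hc := (continuous_exp_smul_mulVec M v).continuousOn (s := Set.Icc 0 1)
  have h0 : (0 : ℝ) ∈ Set.Icc ((NormedSpace.exp ((1 : ℝ) • M) *ᵥ v) 0)
      ((NormedSpace.exp ((0 : ℝ) • M) *ᵥ v) 0) := by
    refine ⟨by simpa using hneg, ?_⟩
    simpa using hv.2.le
  obtain ⟨t, -, ht⟩ := intermediate_value_Icc' zero_le_one hc h0
  exact h2 t ht

/-- The one-parameter subgroup `t ↦ exp (t M)` of the de Sitter group generated by an element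
`M` of its Lie algebra. -/
def oneParam (M : Matrix (Fin 5) (Fin 5) ℝ) (hM : IsSkew M) (t : ℝ) : SO0 :=
  ⟨⟨NormedSpace.exp (t • M), (hM.smul t).det_exp⟩, (hM.smul t).exp_preserves,
    (hM.smul t).exp_future⟩

/-! ### De Sitter wedges -/

/-- The standard wedge of the ambient space. -/
def stdWedge : Set M5 := {x | |x 0| < x 1}

/-- The edge of the standard wedge. -/
def stdEdge : Set M5 := {x | x 0 = 0 ∧ x 1 = 0}

/-- The set of de Sitter wedges: the intersections with de Sitter space of the images of the
standard wedge under the proper orthochronous group. -/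
def DSWedge : Type := {W : Set M5 // ∃ g : SO0, W = (act g '' stdWedge) ∩ dS}

/-- The action of the de Sitter group on wedges. -/
def DSWedge.translate (g : SO0) (W : DSWedge) : DSWedge :=
  ⟨act g '' W.1, by
    obtain ⟨W, h, rfl⟩ := W
    refine ⟨g * h, ?_⟩
    ext y
    constructor
    · rintro ⟨_, ⟨⟨z, hz, rfl⟩, hd⟩, rfl⟩
      exact ⟨⟨z, hz, act_mul g h z⟩, (act_mem_dS g _).2 hd⟩
    · rintro ⟨⟨z, hz, rfl⟩, hd⟩
      rw [act_mul] at hd ⊢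
      exact ⟨_, ⟨⟨z, hz, rfl⟩, (act_mem_dS g _).1 hd⟩, rfl⟩⟩

/-- The edge of a de Sitter wedge. -/
def DSWedge.edge (W : DSWedge) : Set M5 :=
  {y | ∃ g : SO0, W.1 = (act g '' stdWedge) ∩ dS ∧ y ∈ (act g '' stdEdge) ∩ dS}

/-- The one-parameter group `exp (t M)` leaves the wedge `W` invariant and its flow is timelike
and future directed on `W` (`y ↦ M y` is the vector field that generates it). -/
def InducesFutureFlow (M : Matrix (Fin 5) (Fin 5) ℝ) (hM : IsSkew M) (W : DSWedge) : Prop :=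
  (∀ t : ℝ, act (oneParam M hM t) '' W.1 = W.1) ∧ ∀ y ∈ W.1, FutureTimelike (M *ᵥ y)

/-! ### Robertson-Walker space-time as a subset of de Sitter space, and its wedges -/

/-- The conformal time `τ ∈ (-π/2, π/2)` of a point of de Sitter space. A point with conformal
time `τ` and direction `ω ∈ S³` is `(tan τ, ω / cos τ)` in the ambient space. -/
def tau (x : M5) : ℝ := Real.arctan (x 0)

/-- The Robertson-Walker space-time with embedding parameter `α`, identified with its conformal
image in de Sitter space. -/
def RW (α : ℝ) : Set M5 := {x | x ∈ dS ∧ |tau x| < α}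

/-- The rescaling `f` of the conformal time. -/
def fTime (α τ : ℝ) : ℝ := Real.arcsin (Real.sin α * Real.sin τ)

/-- The map `Φ` from de Sitter space onto the Robertson-Walker space-time: it replaces the
conformal time `τ` by `f τ` and keeps the direction `ω = cos τ • (x 1, …, x 4)`. -/
def Phi (α : ℝ) (x : M5) : M5 := fun i =>
  if i = 0 then Real.tan (fTime α (tau x))
  else Real.cos (tau x) * x i / Real.cos (fTime α (tau x))

/-- The causal complement in the Robertson-Walker space-time. Points `x ≠ y` of de Sitter space
are not connected by a causal curve if and only if their difference is spacelike in the ambient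
space, and on `RW α` the causal relation is the one of de Sitter space. -/
def causalCompl (α : ℝ) (S : Set M5) : Set M5 :=
  {y | y ∈ RW α ∧ ∀ x ∈ S, gm (y - x) (y - x) < 0}

/-- `Ξ W`: the connected component of the causal complement of `Φ (edge W)` in the
Robertson-Walker space-time which meets `W`. -/
def Xi (α : ℝ) (W : DSWedge) : Set M5 :=
  {y | ∃ z ∈ W.1 ∩ causalCompl α (Phi α '' W.edge),
    y ∈ connectedComponentIn (causalCompl α (Phi α '' W.edge)) z}

/-- The family of Robertson-Walker wedges: the image of the family of de Sitter wedges
under `Ξ`. -/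
def RWWedge (α : ℝ) : Type := Set.range (Xi α)

/-! ### Worldlines and the associated curve in the de Sitter group -/

/-- A worldline: an inextendible future directed timelike curve of class `C²` in the
Robertson-Walker space-time, with an arbitrary regular parameter running through `ℝ`. -/
structure IsWorldline (α : ℝ) (x : ℝ → M5) : Prop where
  mem : ∀ t, x t ∈ RW α
  contDiff : ContDiff ℝ 2 x
  future : ∀ t, FutureTimelike (deriv x t)
  no_future_end : ∀ p ∈ RW α, ¬ Tendsto x atTop (𝓝 p)
  no_past_end : ∀ p ∈ RW α, ¬ Tendsto x atBot (𝓝 p)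

/-- The derivative of `v` along the curve `x` with respect to the de Sitter proper time `s`
of `x`, where `ds / dt = g(ẋ, ẋ) ^ (1/2)`. -/
def properDeriv (x v : ℝ → M5) (t : ℝ) : M5 :=
  (Real.sqrt (gm (deriv x t) (deriv x t)))⁻¹ • deriv v t

/-- The acceleration in the ambient space: the second derivative with respect to the
de Sitter proper time. -/
def accel (x : ℝ → M5) : ℝ → M5 := properDeriv x (properDeriv x x)

/-- The linear map `g(u, ·) a - g(a, ·) u`. -/
def boostMat (u a : M5) : Matrix (Fin 5) (Fin 5) ℝ :=
  Matrix.vecMulVec a (eta *ᵥ u) - Matrix.vecMulVec u (eta *ᵥ a)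

theorem boostMat_mulVec (u a y : M5) : boostMat u a *ᵥ y = gm u y • a - gm a y • u := by
  ext i
  fin_cases i <;>
  simp [boostMat, Matrix.mulVec, dotProduct, Matrix.vecMulVec, gm_apply, eta,
    Fin.sum_univ_succ, Matrix.diagonal_apply] <;> ring

theorem boostMat_skew (u a : M5) : IsSkew (boostMat u a) := by
  unfold IsSkew
  ext i j
  fin_cases i <;> fin_cases j <;>
  simp [boostMat, Matrix.vecMulVec, eta, Matrix.mulVec_diagonal] <;> ring

/-- The generator `M_t = g(ẋ_t, ·) a_t - g(a_t, ·) ẋ_t`. -/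
def gen (x : ℝ → M5) (t : ℝ) : Matrix (Fin 5) (Fin 5) ℝ := boostMat (deriv x t) (accel x t)

theorem gen_skew (x : ℝ → M5) (t : ℝ) : IsSkew (gen x t) := boostMat_skew _ _

/-- The curve `lam` in the de Sitter group is the time-ordered exponential `T exp ∫₀ᵗ M_s ds`:
the solution of `d/dt lam = M lam` with initial value one. -/
def IsTimeOrderedExp (M : ℝ → Matrix (Fin 5) (Fin 5) ℝ) (lam : ℝ → SO0) : Prop :=
  lam 0 = 1 ∧ ∀ t i j, HasDerivAt (fun r => (lam r).1.1 i j) ((M t * (lam t).1.1) i j) t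

/-! ### One-parameter unitary groups and derivations -/

section Operators

variable {H : Type*} [NormedAddCommGroup H] [InnerProductSpace ℂ H] [CompleteSpace H]

/-- The self-adjoint generator `K` of a one-parameter unitary group `V t = exp (i t K)`: its
domain consists of the vectors `ψ` for which `t ↦ V t ψ` is differentiable (in norm) at zero,
and `K ψ = -i d/dt V t ψ` at zero. -/
def stoneGen (V : ℝ → H →L[ℂ] H) : H →ₗ.[ℂ] H where
  domain :=
    { carrier := {ψ | DifferentiableAt ℝ (fun t => V t ψ) 0}
      zero_mem' := by simp
      add_mem' := by
        intro a b ha hb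
        have h := DifferentiableAt.add (𝕜 := ℝ) ha hb
        have e : (fun t => V t (a + b)) = (fun t => V t a) + fun t => V t b := by
          funext t
          exact map_add _ _ _
        change DifferentiableAt ℝ (fun t => V t (a + b)) 0
        rw [e]
        exact h
      smul_mem' := by
        intro c a ha
        have h := DifferentiableAt.const_smul (𝕜 := ℝ) ha c
        have e : (fun t => V t (c • a)) = c • fun t => V t a := by
          funext t
          exact map_smul _ _ _
        change DifferentiableAt ℝ (fun t => V t (c • a)) 0
        rw [e]
        exact h }
  toFun :=
    { toFun := fun ψ => -Complex.I • deriv (fun t => V t ψ.1) 0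
      map_add' := by
        rintro ⟨a, ha⟩ ⟨b, hb⟩
        have h := deriv_add (𝕜 := ℝ) ha hb
        have e : (fun t => V t (a + b)) = (fun t => V t a) + fun t => V t b := by
          funext t
          exact map_add _ _ _
        change -Complex.I • deriv (fun t => V t (a + b)) 0 = _
        rw [e, h, smul_add]
      map_smul' := by
        rintro c ⟨a, ha⟩
        have h := deriv_const_smul (𝕜 := ℝ) c ha
        have e : (fun t => V t (c • a)) = c • fun t => V t a := by
          funext t
          exact map_smul _ _ _
        change -Complex.I • deriv (fun t => V t (c • a)) 0 = _
        rw [e, h, smul_comm]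
        rfl }

/-- The family `r ↦ β r` of maps on bounded operators, which represents a dynamics, can be
differentiated on `A` at the time `s`: `(β r A - β s A) / (r - s)` converges to a bounded
operator in the weak operator topology as `r → s`. -/
def InDerivationDomain (β : ℝ → (H →L[ℂ] H) → (H →L[ℂ] H)) (s : ℝ) (A : H →L[ℂ] H) : Prop :=
  ∃ D : H →L[ℂ] H, ∀ φ ψ : H,
    HasDerivAt (fun r => inner ℂ φ (β r A ψ)) (inner ℂ φ (D ψ)) s

end Operators

/-! ### De Sitter theories, the geodesic KMS property, transplantation -/

/-- A covariant de Sitter theory on the Hilbert space `H`: a net `R` of von Neumann algebras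
indexed by wedges, a unit vector `Ω`, and a strongly continuous unitary representation `U` of
the proper orthochronous de Sitter group which acts covariantly on the net and leaves `Ω`
invariant. -/
structure DSTheory (H : Type*) [NormedAddCommGroup H] [InnerProductSpace ℂ H]
    [CompleteSpace H] where
  R : DSWedge → VonNeumannAlgebra H
  Ω : H
  U : SO0 →* unitary (H →L[ℂ] H)
  norm_Ω : ‖Ω‖ = 1
  continuous_U : ∀ ψ : H, Continuous fun g => (U g : H →L[ℂ] H) ψ
  covariant : ∀ (g : SO0) (W : DSWedge) (A : H →L[ℂ] H),
    A ∈ R W ↔ (U g : H →L[ℂ] H) * A * star (U g : H →L[ℂ] H) ∈ R (W.translate g)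
  invariant : ∀ g : SO0, (U g : H →L[ℂ] H) Ω = Ω

namespace DSTheory

variable {H : Type*} [NormedAddCommGroup H] [InnerProductSpace ℂ H] [CompleteSpace H]
  (T : DSTheory H)

/-- The automorphism `Ad U(g)`. -/
def Ad (g : SO0) (A : H →L[ℂ] H) : H →L[ℂ] H :=
  (T.U g : H →L[ℂ] H) * A * star (T.U g : H →L[ℂ] H)

/-- The geodesic KMS property: for every wedge `W`, the state given by `Ω` on `R W` satisfies
the KMS condition, at some inverse temperature `β > 0`, for the automorphism group induced by
the boosts which leave `W` invariant and are future directed on `W`. (The generators `M` of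
these boosts are the positive multiples of a single one.) -/
def GeodesicKMS : Prop :=
  ∀ (W : DSWedge) (M : Matrix (Fin 5) (Fin 5) ℝ) (hM : IsSkew M), InducesFutureFlow M hM W →
    ∃ β : ℝ, 0 < β ∧ ∀ A ∈ T.R W, ∀ B ∈ T.R W, ∃ F : ℂ → ℂ,
      ContinuousOn F {z | 0 ≤ z.im ∧ z.im ≤ β} ∧
      DifferentiableOn ℂ F {z | 0 < z.im ∧ z.im < β} ∧
      ∀ t : ℝ,
        F t = inner ℂ T.Ω ((A * T.Ad (oneParam M hM t) B) T.Ω) ∧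
        F (t + β * Complex.I) = inner ℂ T.Ω ((T.Ad (oneParam M hM t) B * A) T.Ω)

/-- The transplanted net on the Robertson-Walker space-time: the algebra of `Ξ W` is `R W`. -/
def rwNet (α : ℝ) (V : RWWedge α) : VonNeumannAlgebra H := T.R (Set.rangeSplitting (Xi α) V)

/-- The propagator family `α_{t,s} = Ad U(lam_t lam_s⁻¹)`. -/
def propagator (lam : ℝ → SO0) (t s : ℝ) (A : H →L[ℂ] H) : H →L[ℂ] H :=
  T.Ad (lam t * (lam s)⁻¹) A

/-- The self-adjoint generator of the unitary group `t ↦ U(exp (t M))`. -/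
def hamiltonian (M : Matrix (Fin 5) (Fin 5) ℝ) (hM : IsSkew M) : H →ₗ.[ℂ] H :=
  stoneGen fun t => (T.U (oneParam M hM t) : H →L[ℂ] H)

end DSTheory

end DSRW

end

open Matrix Filter Topology

noncomputable section

namespace DSRW

/-! ### Holomorphic functions on a strip with prescribed boundary values -/

section Strip

open Complex Set

/-! The proof has an analytic half and a geometric half, which meet in the generator `gen x s`.

Analysis. Let `A` be a unitary in the algebra of a wedge and put `ψ = A Ω`. The KMS function of the
pair `star A`, `A` is `⟨ψ, U_t ψ⟩` on the real axis and `⟨U_t ψ', ψ'⟩` with `ψ' = star A Ω` on the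
upper line. Both vectors are unit vectors, so the function has modulus at most one on the boundary,
hence on the strip, once it is known to be bounded. It equals 1 at zero, with derivative `i E`
there. If `E` were negative, moving up the imaginary axis would push the modulus above one; this is
`nonneg_of_strip`. Boundedness is not part of the KMS condition assumed here;
`exists_bound_of_strip` obtains it from the closed graph theorem and translation covariance. The
differentiability hypothesis on `A` is weak and concerns a general curve in the group.
`tendsto_pow_exp` recovers the one-parameter group from powers of such a curve,
`DSTheory.hasDerivAt_weak_oneParam` transfers weak differentiability of orbits, and
`hasDerivAt_of_weak` upgrades it to norm differentiability, so that `A Ω` is in the domain of the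
generator. `DSTheory.quasiPassive` combines all this.

Geometry. A wedge is given by an orthonormal pair `(e, f)` that is unique only up to boosts of its
plane. The normal form `(n, m)`, with `n 0 = 0` and `m 0 = 1`, removes the ambiguity, and
`IsNormal.eq_of_subset` shows that an inclusion of wedges forces equality of normal forms. For a
worldline, velocity and ambient acceleration are orthogonal and the latter is always spacelike; they
span the plane of `W_s`, which is exactly the set of points of de Sitter space where the vector
field of `gen x s` is future timelike. Existence and uniqueness of `W_s` follow. Up to positive
rescaling of points, `Φ` multiplies the time coordinate by `sin α`, so `Ξ` replaces the spatial part
of `m` by `sin α` times itself (`IsFrame.Xi_wedge`). Hence `Ξ` is injective and the transplanted net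
is well defined; at `τ = 0` the rescaling only enlarges the wedge condition, which then persists
nearby by continuity, and for `α = π/2` nothing is rescaled. -/

/-- A holomorphic function on a square which is continuous up to the boundary and vanishes on the
lower side vanishes at the center. -/
theorem eq_zero_of_square {F : ℂ → ℂ} {z₀ : ℂ} {h : ℝ} (hh : 0 < h)
    (hc : ContinuousOn F {z | |z.re - z₀.re| ≤ h ∧ |z.im - z₀.im| ≤ h})
    (hd : DifferentiableOn ℂ F {z | |z.re - z₀.re| < h ∧ |z.im - z₀.im| < h})
    (h0 : ∀ z : ℂ, |z.re - z₀.re| ≤ h → z.im = z₀.im - h → F z = 0) : F z₀ = 0 := by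
  set U : Set ℂ := Ioo (-h) h ×ℂ Ioo (-h) h with hU
  have hUc : closure U = Icc (-h) h ×ℂ Icc (-h) h := by
    rw [hU, closure_reProdIm, closure_Ioo (by linarith)]
  have hUo : IsOpen U := isOpen_Ioo.reProdIm isOpen_Ioo
  have hUb : Bornology.IsBounded U := (Metric.isBounded_Ioo _ _).reProdIm (Metric.isBounded_Ioo _ _)
  have cont : ∀ c : ℂ, c = 1 ∨ c = I ∨ c = -1 ∨ c = -I →
      DiffContOnCl ℂ (fun ζ => F (z₀ + c * ζ)) U := by
    intro c hcc
    constructor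
    · refine hd.comp (by fun_prop) ?_
      rintro ζ ⟨hr, hi⟩
      simp only [mem_preimage, mem_Ioo] at hr hi
      rcases hcc with rfl | rfl | rfl | rfl <;>
      simp [abs_lt] <;> (refine ⟨⟨?_, ?_⟩, ?_, ?_⟩ <;> linarith)
    · rw [hUc]
      refine hc.comp (by fun_prop) ?_
      rintro ζ ⟨hr, hi⟩
      simp only [mem_preimage, mem_Icc] at hr hi
      rcases hcc with rfl | rfl | rfl | rfl <;>
      simp [abs_le] <;> (refine ⟨⟨?_, ?_⟩, ?_, ?_⟩ <;> linarith)
  -- This is the product of `F` over the four quarter turns of the square about `z₀`. One of the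
  -- turns carries any given side to the lower one, so the product vanishes on the frontier; the
  -- maximum principle then gives `F z₀ ^ 4 = 0`.
  have hG := (((cont 1 (by simp)).smul (cont I (by simp))).smul
    ((cont (-1) (by simp)).smul (cont (-I) (by simp))))
  have key := Complex.norm_le_of_forall_mem_frontier_norm_le hUb hG (C := 0) ?_
    (subset_closure (show (0 : ℂ) ∈ U by simp [hU, mem_reProdIm, hh]))
  · have h4 : ‖F z₀‖ ^ 4 ≤ 0 := by
      simp only [smul_eq_mul, mul_zero, add_zero, norm_mul] at key
      refine le_trans (le_of_eq ?_) key
      ring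
    have h5 : ‖F z₀‖ ^ 4 = 0 := le_antisymm h4 (by positivity)
    simpa using h5
  · intro ζ hζ
    rw [frontier, hUo.interior_eq, hUc] at hζ
    obtain ⟨⟨hr, hi⟩, hn⟩ := hζ
    simp only [mem_preimage, mem_Icc] at hr hi
    have hcase : ζ.im = -h ∨ ζ.re = -h ∨ ζ.im = h ∨ ζ.re = h := by
      by_contra hcon
      push Not at hcon
      obtain ⟨a, b, c, d⟩ := hcon
      exact hn ⟨⟨lt_of_le_of_ne hr.1 (Ne.symm b), lt_of_le_of_ne hr.2 d⟩,
        ⟨lt_of_le_of_ne hi.1 (Ne.symm a), lt_of_le_of_ne hi.2 c⟩⟩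
    have : F (z₀ + 1 * ζ) = 0 ∨ F (z₀ + I * ζ) = 0 ∨ F (z₀ + -1 * ζ) = 0 ∨
        F (z₀ + -I * ζ) = 0 := by
      rcases hcase with e | e | e | e
      · refine Or.inl (h0 _ ?_ ?_)
        · simpa [abs_le] using hr
        · simp [e, sub_eq_add_neg]
      · refine Or.inr (Or.inl (h0 _ ?_ ?_))
        · simp [abs_le]; constructor <;> linarith
        · simp [e, sub_eq_add_neg]
      · refine Or.inr (Or.inr (Or.inl (h0 _ ?_ ?_)))
        · simp [abs_le]; constructor <;> linarith
        · simp [e, sub_eq_add_neg]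
      · refine Or.inr (Or.inr (Or.inr (h0 _ ?_ ?_)))
        · simp [abs_le]; constructor <;> linarith
        · simp [e, sub_eq_add_neg]
    rcases this with e | e | e | e <;> simp only [smul_eq_mul, e, zero_mul, mul_zero, norm_zero,
      le_refl]

/-- A closed rectangle based on the real axis. -/
def rect (β : ℝ) : Set ℂ := Icc (-1) 1 ×ℂ Icc 0 β

/-- Squares resting on the real axis show that `F` vanishes near one interior point; the identity
theorem and continuity do the rest. It supplies uniqueness of continuations from the real axis. -/
theorem eqOn_zero_rect {F : ℂ → ℂ} {β : ℝ} (hβ : 0 < β) (hc : ContinuousOn F (rect β))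
    (hd : DifferentiableOn ℂ F (Ioo (-1) 1 ×ℂ Ioo 0 β))
    (h0 : ∀ t : ℝ, t ∈ Icc (-1) 1 → F t = 0) : EqOn F 0 (rect β) := by
  set V : Set ℂ := Ioo (-1) 1 ×ℂ Ioo 0 β with hV
  have hVo : IsOpen V := isOpen_Ioo.reProdIm isOpen_Ioo
  have hVcl : closure V = rect β := by
    rw [hV, closure_reProdIm, closure_Ioo (by norm_num), closure_Ioo hβ.ne, rect]
  have hVp : IsPreconnected V := by
    have : Convex ℝ V := by
      rw [hV, Complex.reProdIm]
      exact ((convex_Ioo (-1 : ℝ) 1).linear_preimage Complex.reLm).inter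
        ((convex_Ioo (0 : ℝ) β).linear_preimage Complex.imLm)
    exact this.isPreconnected
  -- With a quarter, a point `z` with `|Re z| < r` and `0 < Im z < 2 r` is the center of a square of
  -- half-side `Im z` that stays inside the rectangle.
  set r := min β 1 / 4 with hr
  have hr0 : 0 < r := by have := lt_min hβ one_pos; positivity
  have hrβ : 4 * r ≤ β := by have := min_le_left β 1; linarith
  have hr1 : 4 * r ≤ 1 := by have := min_le_right β 1; linarith
  have hmem : (r * I : ℂ) ∈ V := by
    simp [hV, mem_reProdIm, hr0]; linarith
  have hev : F =ᶠ[𝓝 (r * I : ℂ)] 0 := by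
    have hN : Ioo (-r) r ×ℂ Ioo 0 (2 * r) ∈ 𝓝 (r * I : ℂ) := by
      refine (isOpen_Ioo.reProdIm isOpen_Ioo).mem_nhds ?_
      simp [mem_reProdIm, hr0]
    filter_upwards [hN] with z hz
    obtain ⟨⟨a, b⟩, c, d⟩ := hz
    refine eq_zero_of_square (h := z.im) c (hc.mono ?_) (hd.mono ?_) ?_
    · rintro w ⟨h1, h2⟩
      rw [abs_le] at h1 h2
      exact ⟨⟨by linarith, by linarith⟩, by linarith, by linarith⟩
    · rintro w ⟨h1, h2⟩
      rw [abs_lt] at h1 h2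
      exact ⟨⟨by linarith, by linarith⟩, by linarith, by linarith⟩
    · intro w h1 h2
      rw [abs_le] at h1
      have : w = (w.re : ℂ) := by
        apply Complex.ext <;> simp [h2]
      rw [this]
      exact h0 _ ⟨by linarith, by linarith⟩
  have h1 : EqOn F 0 V :=
    (hd.analyticOnNhd hVo).eqOn_zero_of_preconnected_of_eventuallyEq_zero hVp hmem hev
  rw [← hVcl] at hc ⊢
  exact h1.of_subset_closure hc continuousOn_const subset_closure subset_rfl

/-- A bounded holomorphic function on a strip which is bounded by `C` on the boundary is bounded by
`C`. -/
theorem norm_le_of_strip {F : ℂ → ℂ} {β C : ℝ} (hβ : 0 < β)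
    (hc : ContinuousOn F {z | 0 ≤ z.im ∧ z.im ≤ β})
    (hd : DifferentiableOn ℂ F {z | 0 < z.im ∧ z.im < β})
    (hb : ∃ B, ∀ z : ℂ, 0 ≤ z.im → z.im ≤ β → ‖F z‖ ≤ B)
    (h0 : ∀ t : ℝ, ‖F t‖ ≤ C) (h1 : ∀ t : ℝ, ‖F (t + β * I)‖ ≤ C) {z : ℂ} (hz : 0 ≤ z.im)
    (hz' : z.im ≤ β) : ‖F z‖ ≤ C := by
  refine PhragmenLindelof.horizontal_strip (a := 0) (b := β) ⟨hd, ?_⟩ ?_ ?_ ?_ hz hz'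
  · rw [Complex.closure_preimage_im, closure_Ioo hβ.ne]
    exact hc
  -- A bounded function meets the Phragmén–Lindelöf growth condition with both exponential constants
  -- zero.
  · refine ⟨0, by have := Real.pi_pos; simp; positivity, 0, ?_⟩
    obtain ⟨B, hB⟩ := hb
    refine Asymptotics.IsBigO.of_bound B ?_
    refine Filter.Eventually.filter_mono inf_le_right ?_
    rw [eventually_principal]
    rintro w ⟨hw, hw'⟩
    simpa using hB w hw.le hw'.le
  · intro w hw
    have : w = (w.re : ℂ) := by apply Complex.ext <;> simp [hw]
    rw [this]; exact h0 _
  · intro w hw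
    have : w = (w.re : ℂ) + β * I := by apply Complex.ext <;> simp [hw]
    rw [this]; exact h1 _

/-- Let a bounded holomorphic function on a strip be bounded by one on the boundary and uniformly
differentiable along both boundary lines. If it takes the value one at zero, with derivative `i E`
along the real axis, then `E ≥ 0`. -/
theorem nonneg_of_strip {F : ℂ → ℂ} {β E : ℝ} {f' g' : ℝ → ℂ} (hβ : 0 < β)
    (hc : ContinuousOn F {z | 0 ≤ z.im ∧ z.im ≤ β})
    (hd : DifferentiableOn ℂ F {z | 0 < z.im ∧ z.im < β})
    (hb : ∃ B, ∀ z : ℂ, 0 ≤ z.im → z.im ≤ β → ‖F z‖ ≤ B)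
    (h0 : ∀ t : ℝ, ‖F t‖ ≤ 1) (h1 : ∀ t : ℝ, ‖F (t + β * I)‖ ≤ 1)
    (hf : ∀ ε > 0, ∃ δ > 0, ∀ h : ℝ, 0 < h → h < δ → ∀ t : ℝ,
      ‖(F ((t + h : ℝ)) - F t) / h - f' t‖ ≤ ε)
    (hg : ∀ ε > 0, ∃ δ > 0, ∀ h : ℝ, 0 < h → h < δ → ∀ t : ℝ,
      ‖(F ((t + h : ℝ) + β * I) - F (t + β * I)) / h - g' t‖ ≤ ε)
    (hF0 : F 0 = 1) (hE : f' 0 = I * E) : 0 ≤ E := by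
  have hle : ∀ z : ℂ, 0 ≤ z.im → z.im ≤ β → ‖F z‖ ≤ 1 := fun z hz hz' =>
    norm_le_of_strip hβ hc hd hb h0 h1 hz hz'
  have hSo : IsOpen {z : ℂ | 0 < z.im ∧ z.im < β} :=
    (isOpen_lt continuous_const continuous_im).inter (isOpen_lt continuous_im continuous_const)
  have hdiff : ∀ z : ℂ, 0 < z.im → z.im < β → DifferentiableAt ℂ F z := fun z hz hz' =>
    (hd z ⟨hz, hz'⟩).differentiableAt (hSo.mem_nhds ⟨hz, hz'⟩)
  -- Difference quotients in the real direction are again bounded and holomorphic on the strip.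
  -- Their uniform convergence on the two boundary lines therefore spreads to the whole strip, which
  -- controls `F'` near the boundary without assuming that it extends there.
  set K : ℝ → ℂ → ℂ := fun h z => (F (z + h) - F z) / h with hK
  have hKc : ∀ h, ContinuousOn (K h) {z | 0 ≤ z.im ∧ z.im ≤ β} := by
    intro h
    refine ((hc.comp (by fun_prop) ?_).sub hc).div_const _
    intro z hz
    simpa using hz
  have hKd : ∀ h, DifferentiableOn ℂ (K h) {z | 0 < z.im ∧ z.im < β} := by
    intro h
    refine ((hd.comp (by fun_prop) ?_).sub hd).div_const _
    intro z hz
    simpa using hz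
  have hKb : ∀ h : ℝ, 0 < h → ∀ z : ℂ, 0 ≤ z.im → z.im ≤ β → ‖K h z‖ ≤ 2 / h := by
    intro h hh z hz hz'
    rw [hK]
    simp only [norm_div, norm_real, Real.norm_of_nonneg hh.le]
    gcongr
    refine (norm_sub_le _ _).trans ?_
    have := hle (z + h) (by simpa using hz) (by simpa using hz')
    have := hle z hz hz'
    linarith
  -- the difference quotients are uniformly Cauchy
  have hcauchy : ∀ ε > 0, ∃ δ > 0, ∀ h : ℝ, 0 < h → h < δ → ∀ k : ℝ, 0 < k → k < δ →
      ∀ z : ℂ, 0 ≤ z.im → z.im ≤ β → ‖K h z - K k z‖ ≤ ε := by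
    intro ε hε
    obtain ⟨δ₁, hδ₁, H1⟩ := hf (ε / 2) (by positivity)
    obtain ⟨δ₂, hδ₂, H2⟩ := hg (ε / 2) (by positivity)
    refine ⟨min δ₁ δ₂, lt_min hδ₁ hδ₂, fun h hh hh' k hk hk' z hz hz' => ?_⟩
    refine norm_le_of_strip (F := fun z => K h z - K k z) hβ ((hKc h).sub (hKc k))
      ((hKd h).sub (hKd k)) ⟨2 / h + 2 / k, fun z hz hz' => ?_⟩ ?_ ?_ hz hz'
    · exact (norm_sub_le _ _).trans (add_le_add (hKb h hh z hz hz') (hKb k hk z hz hz'))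
    · intro t
      have e1 := H1 h hh (hh'.trans_le (min_le_left _ _)) t
      have e2 := H1 k hk (hk'.trans_le (min_le_left _ _)) t
      have : K h t - K k t = ((F ((t + h : ℝ)) - F t) / h - f' t) -
          ((F ((t + k : ℝ)) - F t) / k - f' t) := by
        simp [hK]
      rw [this]
      exact (norm_sub_le _ _).trans (by linarith)
    · intro t
      have e1 := H2 h hh (hh'.trans_le (min_le_right _ _)) t
      have e2 := H2 k hk (hk'.trans_le (min_le_right _ _)) t
      have e3 : ∀ u : ℝ, (t : ℂ) + β * I + u = ((t + u : ℝ) : ℂ) + β * I := by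
        intro u; push_cast; ring
      have : K h (t + β * I) - K k (t + β * I) =
          ((F ((t + h : ℝ) + β * I) - F (t + β * I)) / h - g' t) -
          ((F ((t + k : ℝ) + β * I) - F (t + β * I)) / k - g' t) := by
        simp only [hK, e3]; ring
      rw [this]
      exact (norm_sub_le _ _).trans (by linarith)
  have hlim : ∀ z : ℂ, 0 < z.im → z.im < β →
      Tendsto (fun k : ℝ => K k z) (𝓝[>] 0) (𝓝 (deriv F z)) := by
    intro z hz hz'
    have h2 : Tendsto (fun k : ℝ => (k : ℂ)) (𝓝[>] 0) (𝓝[≠] 0) := by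
      refine tendsto_nhdsWithin_iff.2 ⟨?_, ?_⟩
      · refine Tendsto.mono_left ?_ nhdsWithin_le_nhds
        simpa using Complex.continuous_ofReal.tendsto 0
      · filter_upwards [self_mem_nhdsWithin] with k hk
        simpa using (ne_of_gt hk : k ≠ 0)
    refine ((hdiff z hz hz').hasDerivAt.tendsto_slope_zero.comp h2).congr fun k => ?_
    simp [hK, div_eq_inv_mul]
  by_contra hneg
  push Not at hneg
  -- Three errors of `-E / 4` each (quotient against derivative, continuity of the quotient at zero,
  -- quotient against `i E`) keep `F'(i y)` within `-3 E / 4` of `i E`. So `Re F(i y)` has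
  -- derivative at least `-E / 4 > 0`, and would exceed `F 0 = 1`.
  obtain ⟨δ, hδ, H⟩ := hcauchy (-E / 4) (by linarith)
  obtain ⟨δ₁, hδ₁, H1⟩ := hf (-E / 4) (by linarith)
  set h := min δ δ₁ / 2 with hh
  have hh0 : 0 < h := by have := lt_min hδ hδ₁; positivity
  have hhδ : h < δ := by have := min_le_left δ δ₁; linarith
  have hhδ₁ : h < δ₁ := by have := min_le_right δ δ₁; linarith
  have hK0 : ‖K h 0 - I * E‖ ≤ -E / 4 := by
    have := H1 h hh0 hhδ₁ 0
    rw [hE] at this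
    simpa [hK] using this
  have hcont0 : ∃ η > 0, ∀ y : ℝ, 0 < y → y < η → ‖K h (y * I) - K h 0‖ < -E / 4 := by
    have h2 := hKc h 0 ⟨by simp, by simpa using hβ.le⟩
    rw [Metric.continuousWithinAt_iff] at h2
    obtain ⟨η, hη, H2⟩ := h2 (-E / 4) (by linarith)
    refine ⟨min η β, lt_min hη hβ, fun y hy hy' => ?_⟩
    rw [← dist_eq_norm]
    refine H2 ⟨by simpa using hy.le, by simpa using (hy'.trans_le (min_le_right _ _)).le⟩ ?_
    simpa [abs_of_pos hy] using hy'.trans_le (min_le_left _ _)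
  obtain ⟨η, hη, H2⟩ := hcont0
  have hder : ∀ y : ℝ, 0 < y → y < η → y < β → ‖deriv F (y * I) - I * E‖ ≤ 3 * (-E / 4) := by
    intro y hy hy' hyβ
    have e1 : ‖K h (y * I) - deriv F (y * I)‖ ≤ -E / 4 := by
      have h3 := (tendsto_const_nhds (x := K h (y * I))).sub
        (hlim (y * I) (by simpa using hy) (by simpa using hyβ))
      refine le_of_tendsto h3.norm ?_
      filter_upwards [Ioo_mem_nhdsGT hδ] with k hk
      exact H h hh0 hhδ k hk.1 hk.2 _ (by simpa using hy.le) (by simpa using hyβ.le)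
    have e2 := (H2 y hy hy').le
    have : deriv F (y * I) - I * E = -(K h (y * I) - deriv F (y * I)) +
        (K h (y * I) - K h 0) + (K h 0 - I * E) := by ring
    rw [this]
    refine (norm_add₃_le).trans ?_
    rw [norm_neg]
    linarith
  set c := min η β / 2 with hcdef
  have hc0 : 0 < c := by have := lt_min hη hβ; positivity
  have hcη : c < η := by have := min_le_left η β; have := lt_min hη hβ; linarith
  have hcβ : c < β := by have := min_le_right η β; have := lt_min hη hβ; linarith
  have hda : ∀ y : ℝ, 0 < y → y < c →
      HasDerivAt (fun y : ℝ => (F (y * I)).re) (deriv F (y * I) * I).re y := by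
    intro y hy hyc
    have d1 := (hdiff (y * I) (by simpa using hy) (by simpa using hyc.trans hcβ)).hasDerivAt
    have d2 : HasDerivAt (fun w : ℂ => w * I) I (y : ℂ) := by
      simpa using (hasDerivAt_id (y : ℂ)).mul_const I
    exact (d1.comp (y : ℂ) d2).real_of_complex
  have hmono : StrictMonoOn (fun y : ℝ => (F (y * I)).re) (Icc 0 c) := by
    refine strictMonoOn_of_deriv_pos (convex_Icc _ _) ?_ ?_
    · refine Complex.continuous_re.comp_continuousOn (hc.comp (by fun_prop) ?_)
      rintro y ⟨hy, hy'⟩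
      simp only [mem_ofPred_eq]
      simpa using ⟨hy, hy'.trans hcβ.le⟩
    · intro y hy
      rw [interior_Icc] at hy
      rw [(hda y hy.1 hy.2).deriv]
      have h4 := hder y hy.1 (hy.2.trans hcη) (hy.2.trans hcβ)
      have h5 : (deriv F (y * I) * I).re = ((deriv F (y * I) - I * E) * I).re - E := by
        simp
      have h6 := (abs_le.1 (Complex.abs_re_le_norm ((deriv F (y * I) - I * E) * I))).1
      rw [norm_mul, norm_I, mul_one] at h6
      rw [h5]
      linarith
  have h7 := hmono (left_mem_Icc.2 hc0.le) (right_mem_Icc.2 hc0.le) hc0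
  simp only [ofReal_zero, zero_mul, hF0, one_re] at h7
  have h8 := hle (c * I) (by simpa using hc0.le) (by simpa using hcβ.le)
  have h9 := Complex.re_le_norm (F (c * I))
  linarith

end Strip

/-! ### Boundedness in the KMS condition -/

section ClosedGraph

open Complex Set

/-- Suppose that every `B` in a Banach space on which `ℝ` acts by contractions has a holomorphic
function on the strip whose boundary values on the real axis depend linearly and continuously on
`B`, compatibly with the action. Then these functions are bounded, by the closed graph theorem. -/
theorem exists_bound_of_strip {X : Type*} [NormedAddCommGroup X] [NormedSpace ℂ X]
    [CompleteSpace X] {β : ℝ} (hβ : 0 < β) (f : ℝ → X →L[ℂ] ℂ) (σ : ℝ → X → X)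
    (hσ : ∀ t B, ‖σ t B‖ ≤ ‖B‖) (hf : ∀ t s B, f t (σ s B) = f (t + s) B) (F : X → ℂ → ℂ)
    (hc : ∀ B, ContinuousOn (F B) {z | 0 ≤ z.im ∧ z.im ≤ β})
    (hd : ∀ B, DifferentiableOn ℂ (F B) {z | 0 < z.im ∧ z.im < β})
    (hF : ∀ B (t : ℝ), F B t = f t B) (B : X) :
    ∃ C, ∀ z : ℂ, 0 ≤ z.im → z.im ≤ β → ‖F B z‖ ≤ C := by
  have hsub : rect β ⊆ {z | 0 ≤ z.im ∧ z.im ≤ β} := fun z hz => hz.2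
  have hsub' : Ioo (-1) 1 ×ℂ Ioo 0 β ⊆ {z | 0 < z.im ∧ z.im < β} := fun z hz => hz.2
  have huniq : ∀ G₁ G₂ : ℂ → ℂ, ContinuousOn G₁ (rect β) → ContinuousOn G₂ (rect β) →
      DifferentiableOn ℂ G₁ (Ioo (-1) 1 ×ℂ Ioo 0 β) →
      DifferentiableOn ℂ G₂ (Ioo (-1) 1 ×ℂ Ioo 0 β) →
      (∀ t : ℝ, t ∈ Icc (-1) 1 → G₁ t = G₂ t) → EqOn G₁ G₂ (rect β) := by
    intro G₁ G₂ c1 c2 d1 d2 h z hz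
    have := eqOn_zero_rect hβ (c1.sub c2) (d1.sub d2)
      (fun t ht => by simp [h t ht]) hz
    simpa [sub_eq_zero] using this
  have hcomp : CompactSpace (rect β) := by
    rw [← isCompact_iff_compactSpace]
    exact isCompact_Icc.reProdIm isCompact_Icc
  -- The functions `F B` come with no linearity in `B`; it is forced by uniqueness of the
  -- continuation from the real segment.
  let T : X →ₗ[ℂ] C(rect β, ℂ) :=
    { toFun := fun B => ⟨fun z => F B z, ((hc B).mono hsub).domRestrict⟩
      map_add' := by
        intro A B
        ext z
        exact huniq (F (A + B)) (F A + F B) ((hc _).mono hsub)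
          (((hc _).mono hsub).add ((hc _).mono hsub)) ((hd _).mono hsub')
          (((hd _).mono hsub').add ((hd _).mono hsub')) (fun t _ => by simp [hF]) z.2
      map_smul' := by
        intro c B
        ext z
        exact huniq (F (c • B)) (c • F B) ((hc _).mono hsub)
          (((hc _).mono hsub).const_smul c) ((hd _).mono hsub')
          (((hd _).mono hsub').const_smul c) (fun t _ => by simp [hF]) z.2 }
  have hT : ∀ B (z : rect β), T B z = F B z := fun _ _ => rfl
  have hcont : Continuous T := by
    refine T.continuous_of_seq_closed_graph fun u x y hu hy => ?_
    have hTy : TendstoUniformly (fun n z => T (u n) z) y atTop :=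
      ContinuousMap.tendsto_iff_tendstoUniformly.1 hy
    classical
    set G : ℂ → ℂ := fun z => if h : z ∈ rect β then y ⟨z, h⟩ else 0 with hG
    have hGy : ∀ z : rect β, G z = y z := fun z => by simp [hG]
    have hGu : TendstoUniformlyOn (fun n => F (u n)) G atTop (rect β) := by
      rw [Metric.tendstoUniformlyOn_iff]
      rw [Metric.tendstoUniformly_iff] at hTy
      intro ε hε
      filter_upwards [hTy ε hε] with n hn z hz
      have := hn ⟨z, hz⟩
      rwa [← hGy, hT] at this
    have hrs : Ioo (-1) 1 ×ℂ Ioo 0 β ⊆ rect β := fun z hz =>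
      ⟨Ioo_subset_Icc_self hz.1, Ioo_subset_Icc_self hz.2⟩
    -- The graph is closed: a uniform limit of the `F (u n)` is holomorphic inside, and on the real
    -- segment it has the values of `F x` because each `f t` is continuous.
    have key : EqOn G (F x) (rect β) := by
      refine huniq _ _ ?_ ((hc _).mono hsub) ?_ ((hd _).mono hsub') ?_
      · exact hGu.continuousOn (Eventually.of_forall fun n => (hc _).mono hsub).frequently
      · exact (hGu.mono hrs).tendstoLocallyUniformlyOn.differentiableOn
          (Eventually.of_forall fun n => (hd _).mono hsub') (isOpen_Ioo.reProdIm isOpen_Ioo)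
      · intro t ht
        have hm : (t : ℂ) ∈ rect β := ⟨by simpa using ht, by simpa using hβ.le⟩
        have h1 : Tendsto (fun n => F (u n) t) atTop (𝓝 (G t)) := hGu.tendsto_at hm
        have h2 : Tendsto (fun n => F (u n) t) atTop (𝓝 (F x t)) := by
          simp only [hF]
          exact ((f t).continuous.tendsto x).comp hu
        exact tendsto_nhds_unique h1 h2
    ext z
    rw [← hGy, key z.2, hT]
  let T' : X →L[ℂ] C(rect β, ℂ) := ⟨T, hcont⟩
  refine ⟨‖T'‖ * ‖B‖, fun z hz hz' => ?_⟩
  have hm : (z.im * I : ℂ) ∈ rect β := ⟨by simp, by simpa using ⟨hz, hz'⟩⟩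
  -- The closed graph theorem bounds `F B` only on the rectangle. A real translation of the argument
  -- amounts to letting `σ` act on `B`, which does not increase the norm, so every point of the
  -- strip reduces to one on the imaginary axis.
  have h1 : EqOn (fun w => F B (w + z.re)) (F (σ z.re B)) (rect β) := by
    refine huniq _ _ ((hc B).comp (by fun_prop) ?_) ((hc _).mono hsub)
      ((hd B).comp (by fun_prop) ?_) ((hd _).mono hsub') ?_
    · intro w hw
      simpa using hsub hw
    · intro w hw
      simpa using hsub' hw
    · intro t _
      have := hF B (t + z.re)
      push_cast at this
      rw [this, hF, hf]
  have h2 := h1 hm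
  have h3 : (z.im * I : ℂ) + z.re = z := by
    rw [add_comm]; exact Complex.re_add_im z
  simp only [h3] at h2
  rw [h2]
  calc ‖F (σ z.re B) (z.im * I)‖ = ‖T' (σ z.re B) ⟨_, hm⟩‖ := rfl
    _ ≤ ‖T' (σ z.re B)‖ := ContinuousMap.norm_coe_le_norm _ _
    _ ≤ ‖T'‖ * ‖σ z.re B‖ := T'.le_opNorm _
    _ ≤ ‖T'‖ * ‖B‖ := by gcongr; exact hσ _ _

end ClosedGraph

/-! ### Weak derivatives of unitary orbits -/

section Weak

variable {H : Type*} [NormedAddCommGroup H] [InnerProductSpace ℂ H] [CompleteSpace H]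

/-- If the orbit of a vector under a one-parameter unitary group has a weak derivative at zero, then
it is differentiable in norm. -/
theorem hasDerivAt_of_weak {V : ℝ → H →L[ℂ] H} (hadd : ∀ s t, V (s + t) = V s * V t)
    (h0 : V 0 = 1) (hcont : ∀ ψ, Continuous fun t => V t ψ) {ψ χ : H}
    (hw : ∀ φ, HasDerivAt (fun t => inner ℂ φ (V t ψ)) (inner ℂ φ χ) 0) :
    HasDerivAt (fun t => V t ψ) χ 0 := by
  -- The group law carries the weak derivative at zero to every time; its value `V t χ` is norm
  -- continuous in `t`.
  have hall : ∀ (t : ℝ) φ,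
      HasDerivAt (fun t => inner ℂ φ (V t ψ)) (inner ℂ φ (V t χ)) t := by
    intro t φ
    have h1 := hw (ContinuousLinearMap.adjoint (V t) φ)
    simp only [ContinuousLinearMap.adjoint_inner_left] at h1
    have h2 : HasDerivAt (fun s : ℝ => s - t) 1 t := (hasDerivAt_id t).sub_const t
    have h3 : HasDerivAt (fun s => inner ℂ φ (V t (V (s - t) ψ))) (inner ℂ φ (V t χ)) t := by
      have h4 := HasDerivAt.scomp (h := fun s : ℝ => s - t) (x := t) (h' := 1)
        (g₁ := fun s => inner ℂ φ (V t (V s ψ))) (g₁' := inner ℂ φ (V t χ))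
        (by simpa using h1) h2
      simpa [Function.comp_def] using h4
    have h5 : ∀ s, V t (V (s - t) ψ) = V s ψ := by
      intro s
      have := hadd t (s - t)
      rw [add_sub_cancel] at this
      rw [this]; rfl
    simpa only [h5] using h3
  rw [hasDerivAt_iff_isLittleO_nhds_zero, Asymptotics.isLittleO_iff]
  intro ε hε
  have hc0 := (hcont χ).tendsto 0
  rw [h0] at hc0
  obtain ⟨δ, hδ, hδ'⟩ := Metric.tendsto_nhds_nhds.1 hc0 ε hε
  filter_upwards [Metric.ball_mem_nhds 0 hδ] with r hr
  rw [h0, zero_add]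
  simp only [one_apply_eq_self]
  -- The remainder is tested against itself: the mean value inequality bounds `⟨x, x⟩` by `‖x‖ ε
  -- |r|`, uniformly in the direction of `x`.
  set x := V r ψ - ψ - r • χ with hx
  have h6 : ‖inner ℂ x (V r ψ) - r * inner ℂ x χ - (inner ℂ x (V 0 ψ) - (0 : ℝ) * inner ℂ x χ)‖
      ≤ ‖x‖ * ε * ‖r - 0‖ := by
    refine Convex.norm_image_sub_le_of_norm_hasDerivWithin_le
      (f := fun t : ℝ => inner ℂ x (V t ψ) - t * inner ℂ x χ)
      (f' := fun t => inner ℂ x (V t χ) - inner ℂ x χ) (s := Metric.ball 0 δ)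
      (fun t _ => ?_) (fun t ht => ?_) (convex_ball _ _) (Metric.mem_ball_self hδ) hr
    · refine HasDerivAt.hasDerivWithinAt ((hall t x).sub ?_)
      simpa using (Complex.ofRealCLM.hasDerivAt (x := t)).mul_const (inner ℂ x χ)
    · rw [← inner_sub_right]
      refine (norm_inner_le_norm _ _).trans ?_
      gcongr
      have := hδ' (Metric.mem_ball.1 ht)
      rw [dist_eq_norm] at this
      exact this.le
  have h7 : inner ℂ x (V r ψ) - r * inner ℂ x χ - (inner ℂ x (V 0 ψ) - (0 : ℝ) * inner ℂ x χ) =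
      inner ℂ x x := by
    rw [h0]
    conv_rhs => rw [hx, inner_sub_right, inner_sub_right, ← hx]
    simp [inner_smul_right_eq_smul]
    ring
  rw [h7, sub_zero, inner_self_eq_norm_sq_to_K] at h6
  simp only [norm_pow] at h6
  have h8 : ‖x‖ * ‖x‖ ≤ ‖x‖ * (ε * ‖r‖) := by
    have : ‖((‖x‖ : ℝ) : ℂ)‖ = ‖x‖ := by simp
    calc ‖x‖ * ‖x‖ = ‖((‖x‖ : ℝ) : ℂ)‖ ^ 2 := by rw [this]; ring
      _ ≤ _ := h6
      _ = _ := by ring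
  rcases (norm_nonneg x).eq_or_lt with h9 | h9
  · rw [← h9]; positivity
  · exact le_of_mul_le_mul_left h8 h9

end Weak

/-! ### Exponentials as limits of powers -/

section PowExp

variable {𝔸 : Type*} [NormedRing 𝔸]

/-- It keeps all powers up to the `n`-th of an element at distance `O(1/n)` from the identity under
uniform control. -/
theorem norm_pow_sub_one_le (a : 𝔸) (n : ℕ) : ‖a ^ n - 1‖ ≤ (1 + ‖a - 1‖) ^ n - 1 := by
  induction n with
  | zero => simp
  | succ n ih =>
    have h1 : a ^ (n + 1) - 1 = (a ^ n - 1) * (a - 1) + (a ^ n - 1) + (a - 1) := by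
      rw [pow_succ]; noncomm_ring
    rw [h1]
    refine (norm_add₃_le).trans ?_
    have h2 := norm_mul_le (a ^ n - 1) (a - 1)
    have h3 := mul_le_mul_of_nonneg_right ih (norm_nonneg (a - 1))
    rw [pow_succ]
    linarith

theorem norm_pow_sub_pow_le [NormOneClass 𝔸] {a b : 𝔸} {R : ℝ} (hR : 1 ≤ R) (ha : ‖a‖ ≤ R)
    (hb : ‖b‖ ≤ R) (n : ℕ) :
    ‖a ^ n - b ^ n‖ ≤ n * R ^ n * ‖a - b‖ := by
  induction n with
  | zero => simp
  | succ n ih =>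
    have h1 : a ^ (n + 1) - b ^ (n + 1) = a * (a ^ n - b ^ n) + (a - b) * b ^ n := by
      rw [pow_succ', pow_succ']; noncomm_ring
    have hR0 : 0 ≤ R := by linarith
    have h2 : ‖b ^ n‖ ≤ R ^ n := (norm_pow_le b n).trans (by gcongr)
    have h3 : R ^ n ≤ R ^ (n + 1) := pow_le_pow_right₀ hR n.le_succ
    calc ‖a ^ (n + 1) - b ^ (n + 1)‖ ≤ ‖a‖ * ‖a ^ n - b ^ n‖ + ‖a - b‖ * ‖b ^ n‖ := by
          rw [h1]
          exact (norm_add_le _ _).trans (add_le_add (norm_mul_le _ _) (norm_mul_le _ _))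
      _ ≤ R * (n * R ^ n * ‖a - b‖) + ‖a - b‖ * R ^ (n + 1) := by
          gcongr; exact h2.trans h3
      _ = ((n + 1 : ℕ) : ℝ) * R ^ (n + 1) * ‖a - b‖ := by push_cast; ring

theorem one_add_div_pow_le_exp {c : ℝ} (hc : 0 ≤ c) {n k : ℕ} (hk : k ≤ n) :
    (1 + c / n) ^ k ≤ Real.exp c := by
  have h0 : 0 ≤ c / n := by positivity
  calc (1 + c / n) ^ k ≤ (1 + c / n) ^ n := pow_le_pow_right₀ (by linarith) hk
    _ ≤ (Real.exp (c / n)) ^ n := by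
        gcongr; rw [add_comm]; exact Real.add_one_le_exp _
    _ ≤ Real.exp c := by
        rw [← Real.exp_nat_mul]
        apply Real.exp_le_exp.2
        rcases Nat.eq_zero_or_pos n with rfl | hn
        · simpa using hc
        · field_simp; rfl

/-- If `γ` is a curve through `1` with velocity `X`, then `γ (r / n) ^ n` converges to
`exp (r X)`. -/
theorem tendsto_pow_exp [NormOneClass 𝔸] [NormedAlgebra ℝ 𝔸] [CompleteSpace 𝔸] {γ : ℝ → 𝔸} {X : 𝔸}
    (h1 : γ 0 = 1) (hγ : HasDerivAt γ X 0) (r : ℝ) :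
    Tendsto (fun n : ℕ => γ (r / n) ^ n) atTop (𝓝 (NormedSpace.exp (r • X))) := by
  have hslope : ∀ γ : ℝ → 𝔸, γ 0 = 1 → HasDerivAt γ X 0 →
      Tendsto (fun n : ℕ => (n : ℝ) • (γ (r / n) - 1)) atTop (𝓝 (r • X)) := by
    intro γ h1 hγ
    rcases eq_or_ne r 0 with rfl | hr
    · simp [h1]
    · have h2 : Tendsto (fun n : ℕ => r / (n : ℝ)) atTop (𝓝[≠] 0) := by
        refine tendsto_nhdsWithin_iff.2 ⟨tendsto_const_div_atTop_nhds_zero_nat r, ?_⟩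
        filter_upwards [eventually_gt_atTop 0] with n hn
        have : (n : ℝ) ≠ 0 := by positivity
        exact div_ne_zero hr this
      have h3 := (hγ.tendsto_slope_zero.comp h2).const_smul r
      refine h3.congr' ?_
      filter_upwards [eventually_gt_atTop 0] with n hn
      have : (n : ℝ) ≠ 0 := by positivity
      simp only [Function.comp, zero_add, h1, smul_smul]
      congr 1
      field_simp
  -- The comparison curve satisfies `e (r / n) ^ n = exp (r X)` exactly. It agrees with `γ` to first
  -- order, so the bases differ by `o(1/n)` and their `n`-th powers by `o(1)`.
  set e : ℝ → 𝔸 := fun t => NormedSpace.exp (t • X) with he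
  have he0 : e 0 = 1 := by simp [he]
  have hed : HasDerivAt e X 0 := by simpa [he] using hasDerivAt_exp_smul_const X (0 : ℝ)
  have hen : ∀ n : ℕ, 0 < n → e (r / n) ^ n = NormedSpace.exp (r • X) := by
    intro n hn
    have : (n : ℝ) ≠ 0 := by positivity
    let _ : NormedAlgebra ℚ 𝔸 := NormedAlgebra.restrictScalars ℚ ℝ 𝔸
    rw [he]
    simp only
    rw [← NormedSpace.exp_nsmul, ← Nat.cast_smul_eq_nsmul ℝ, smul_smul]
    congr 2
    field_simp
  have hK : ∀ γ : ℝ → 𝔸, γ 0 = 1 → HasDerivAt γ X 0 →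
      ∀ᶠ n : ℕ in atTop, ‖γ (r / n)‖ ≤ 1 + (‖r • X‖ + 1) / n := by
    intro γ h1 hγ
    filter_upwards [(hslope γ h1 hγ).norm.eventually_le_const (lt_add_one _),
      eventually_gt_atTop 0] with n hn hn0
    have hn1 : (0 : ℝ) < n := by positivity
    rw [norm_smul, Real.norm_of_nonneg hn1.le] at hn
    have h2 : ‖γ (r / n) - 1‖ ≤ (‖r • X‖ + 1) / n := by
      rw [le_div_iff₀ hn1]; linarith
    calc ‖γ (r / n)‖ = ‖1 + (γ (r / n) - 1)‖ := by congr 1; abel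
      _ ≤ 1 + ‖γ (r / n) - 1‖ := by
          refine (norm_add_le _ _).trans ?_
          rw [norm_one]
      _ ≤ _ := by linarith
  have hdiff : Tendsto (fun n : ℕ => (n : ℝ) • (γ (r / n) - e (r / n))) atTop (𝓝 0) := by
    have := (hslope γ h1 hγ).sub (hslope e he0 hed)
    rw [sub_self] at this
    refine this.congr fun n => ?_
    rw [← smul_sub]
    congr 1
    abel
  have hsmall : Tendsto (fun n : ℕ => γ (r / n) ^ n - e (r / n) ^ n) atTop (𝓝 0) := by
    have h5 := hdiff.norm.const_mul (Real.exp (‖r • X‖ + 1))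
    rw [norm_zero, mul_zero] at h5
    refine squeeze_zero_norm' ?_ h5
    filter_upwards [hK γ h1 hγ, hK e he0 hed] with n hn hn'
    have hR : (1 : ℝ) ≤ 1 + (‖r • X‖ + 1) / n := by
      have : 0 ≤ (‖r • X‖ + 1) / (n : ℝ) := by positivity
      linarith
    refine (norm_pow_sub_pow_le hR hn hn' n).trans ?_
    have h6 := one_add_div_pow_le_exp (c := ‖r • X‖ + 1) (by positivity) (le_refl n)
    rw [norm_smul (n : ℝ) (γ (r / n) - e (r / n)), Real.norm_natCast]
    calc (n : ℝ) * (1 + (‖r • X‖ + 1) / n) ^ n * ‖γ (r / n) - e (r / n)‖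
        ≤ n * Real.exp (‖r • X‖ + 1) * ‖γ (r / n) - e (r / n)‖ := by gcongr
      _ = _ := by ring
  have h7 := hsmall.add_const (NormedSpace.exp (r • X))
  rw [zero_add] at h7
  refine h7.congr' ?_
  filter_upwards [eventually_gt_atTop 0] with n hn
  rw [hen n hn]
  abel

end PowExp

/-! ### One-parameter subgroups of the de Sitter group -/

section
attribute [local instance] Matrix.linftyOpNormedRing Matrix.linftyOpNormedAlgebra

theorem oneParam_zero (M : Matrix (Fin 5) (Fin 5) ℝ) (hM : IsSkew M) : oneParam M hM 0 = 1 := by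
  apply Subtype.ext
  apply Subtype.ext
  simp [oneParam]

theorem oneParam_add (M : Matrix (Fin 5) (Fin 5) ℝ) (hM : IsSkew M) (s t : ℝ) :
    oneParam M hM (s + t) = oneParam M hM s * oneParam M hM t := by
  apply Subtype.ext
  apply Subtype.ext
  simp only [oneParam, add_smul]
  rw [Matrix.exp_add_of_commute _ _ (((Commute.refl M).smul_left s).smul_right t)]
  rfl

theorem continuous_oneParam (M : Matrix (Fin 5) (Fin 5) ℝ) (hM : IsSkew M) :
    Continuous (oneParam M hM) := by
  have h : Continuous fun t : ℝ => NormedSpace.exp (t • M) :=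
    continuous_iff_continuousAt.2 fun t => (hasDerivAt_exp_smul_const M t).continuousAt
  exact Continuous.subtype_mk (Continuous.subtype_mk h _) _

/-- A neighbourhood of the identity of the de Sitter group contains all elements whose matrix is
close to the identity. -/
theorem exists_norm_sub_one_lt {p : SO0 → Prop} (hp : ∀ᶠ g in 𝓝 (1 : SO0), p g) :
    ∃ η > 0, ∀ g : SO0, ‖g.1.1 - 1‖ < η → p g := by
  have hind : Topology.IsInducing fun g : SO0 => g.1.1 :=
    Topology.IsInducing.subtypeVal.comp Topology.IsInducing.subtypeVal
  rw [hind.nhds_eq_comap, Filter.eventually_comap] at hp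
  obtain ⟨η, hη, h⟩ := Metric.eventually_nhds_iff.1 hp
  refine ⟨η, hη, fun g hg => h (y := g.1.1) ?_ g rfl⟩
  rw [dist_eq_norm]
  exact hg

variable {H : Type*} [NormedAddCommGroup H] [InnerProductSpace ℂ H] [CompleteSpace H]
  (T : DSTheory H)

/-- Weak differentiability of an orbit depends only on the velocity of the curve in the group. -/
theorem DSTheory.hasDerivAt_weak_oneParam {g : ℝ → SO0} (hg0 : g 0 = 1)
    {M : Matrix (Fin 5) (Fin 5) ℝ} (hM : IsSkew M)
    (hg : ∀ i j, HasDerivAt (fun r => (g r).1.1 i j) (M i j) 0) {ψ χ : H}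
    (hw : ∀ φ, HasDerivAt (fun t => inner ℂ φ ((T.U (g t) : H →L[ℂ] H) ψ)) (inner ℂ φ χ) 0)
    (φ : H) : HasDerivAt (fun t => inner ℂ φ ((T.U (oneParam M hM t) : H →L[ℂ] H) ψ))
      (inner ℂ φ χ) 0 := by
  have hU1 : (T.U 1 : H →L[ℂ] H) = 1 := by simp
  have hgm : HasDerivAt (fun r => (g r).1.1) M 0 :=
    hasDerivAt_pi.2 fun i => hasDerivAt_pi.2 fun j => hg i j
  have hgm0 : (g 0).1.1 = 1 := by rw [hg0]; rfl
  -- Lipschitz bound for the orbit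
  obtain ⟨C, hC0, hC⟩ : ∃ C : ℝ, 0 ≤ C ∧
      ∀ t, ‖(T.U (g t) : H →L[ℂ] H) ψ - ψ‖ ≤ C * |t| := by
    -- The weak derivative bounds the quotients for small `t` against each fixed `φ`, and `2 ‖ψ‖`
    -- bounds the numerator for the other `t`; uniform boundedness turns this into a norm bound.
    obtain ⟨C, hC⟩ := banach_steinhaus
      (g := fun t : ℝ => innerSL ℂ ((t⁻¹ : ℝ) • ((T.U (g t) : H →L[ℂ] H) ψ - ψ))) (by
      intro φ
      have h1 := (hw φ).tendsto_slope_zero.norm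
      obtain ⟨δ, hδ, h2⟩ := Metric.eventually_nhds_iff.1
        (eventually_nhdsWithin_iff.1 (h1.eventually_le_const (lt_add_one _)))
      refine ⟨max (‖inner ℂ φ χ‖ + 1) (δ⁻¹ * (2 * ‖ψ‖ * ‖φ‖)), fun t => ?_⟩
      rw [innerSL_apply_apply, ← norm_inner_symm]
      rcases eq_or_ne t 0 with rfl | ht
      · simp only [_root_.inv_zero, zero_smul, inner_zero_right, norm_zero]
        exact le_max_of_le_left (by positivity)
      rcases lt_or_ge |t| δ with h | h
      · refine le_max_of_le_left ?_
        have h3 := @h2 t (by simpa using h) ht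
        rw [zero_add, hg0, hU1, one_apply_eq_self, ← inner_sub_right] at h3
        rwa [inner_smul_right_eq_smul]
      · refine le_max_of_le_right ?_
        refine (norm_inner_le_norm _ _).trans ?_
        rw [norm_smul, norm_inv, Real.norm_eq_abs]
        have h4 : ‖(T.U (g t) : H →L[ℂ] H) ψ - ψ‖ ≤ 2 * ‖ψ‖ := by
          refine (norm_sub_le _ _).trans ?_
          rw [Unitary.norm_map]; linarith
        calc ‖φ‖ * (|t|⁻¹ * ‖(T.U (g t) : H →L[ℂ] H) ψ - ψ‖)
            ≤ ‖φ‖ * (δ⁻¹ * (2 * ‖ψ‖)) := by gcongr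
          _ = _ := by ring)
    refine ⟨C, (norm_nonneg _).trans (hC 0), fun t => ?_⟩
    rcases eq_or_ne t 0 with rfl | ht
    · simp [hg0]
    · have h3 := hC t
      rw [innerSL_apply_norm, norm_smul, norm_inv, Real.norm_eq_abs] at h3
      have h5 : 0 < |t| := abs_pos.2 ht
      rw [inv_mul_le_iff₀ h5] at h3
      linarith
  -- Lipschitz bound for the curve
  obtain ⟨L, hL0, δ, hδ, hL⟩ : ∃ L : ℝ, 0 ≤ L ∧ ∃ δ > 0, ∀ t, |t| < δ →
      ‖(g t).1.1 - 1‖ ≤ L * |t| := by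
    obtain ⟨L, hL0, hL⟩ := hgm.isBigO_sub.exists_nonneg
    obtain ⟨δ, hδ, h⟩ := Metric.eventually_nhds_iff.1 hL.bound
    refine ⟨L, hL0, δ, hδ, fun t ht => ?_⟩
    have := @h t (by simpa using ht)
    rw [hgm0] at this
    simpa using this
  have hexp : ∀ r : ℝ, Tendsto (fun n : ℕ => g (r / n) ^ n) atTop (𝓝 (oneParam M hM r)) := by
    intro r
    have hind : Topology.IsInducing fun g : SO0 => g.1.1 :=
      Topology.IsInducing.subtypeVal.comp Topology.IsInducing.subtypeVal
    rw [hind.tendsto_nhds_iff]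
    refine (tendsto_pow_exp hgm0 hgm r).congr fun n => ?_
    simp
  rw [hasDerivAt_iff_isLittleO_nhds_zero, Asymptotics.isLittleO_iff]
  intro ε hε
  -- This absorbs the Lipschitz constant of the orbit; the added one covers `C = 0`.
  set ε' := ε / (C + 1) with hε'
  have hε'0 : 0 < ε' := by positivity
  obtain ⟨η, hη, hη'⟩ := exists_norm_sub_one_lt
    (p := fun g => ‖(T.U g : H →L[ℂ] H) φ - φ‖ < ε') (by
      have h1 := (T.continuous_U φ).tendsto 1
      rw [hU1, one_apply_eq_self] at h1
      have h2 := Metric.tendsto_nhds.1 h1 ε' hε'0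
      simpa only [dist_eq_norm] using h2)
  have hsm : ∀ᶠ r : ℝ in 𝓝 0, Real.exp (L * |r|) - 1 < η := by
    have h1 : Tendsto (fun r : ℝ => Real.exp (L * |r|) - 1) (𝓝 0)
        (𝓝 (Real.exp (L * |(0 : ℝ)|) - 1)) :=
      Continuous.tendsto (by fun_prop) 0
    simp only [abs_zero, mul_zero, Real.exp_zero, sub_self] at h1
    exact h1.eventually_lt_const hη
  filter_upwards [hsm, Metric.ball_mem_nhds 0 hδ] with r hr hrδ
  rw [zero_add, oneParam_zero, hU1, one_apply_eq_self]
  -- the estimate for powers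
  have hpow : ∀ n : ℕ, 0 < n →
      ‖inner ℂ φ ((T.U (g (r / n) ^ n) : H →L[ℂ] H) ψ) - inner ℂ φ ψ -
        n * (inner ℂ φ ((T.U (g (r / n)) : H →L[ℂ] H) ψ) - inner ℂ φ ψ)‖ ≤ ε * |r| := by
    intro n hn
    have hn0 : (0 : ℝ) < n := by positivity
    set h := g (r / n) with hh
    have hhn : ‖h.1.1 - 1‖ ≤ L * |r| / n := by
      have hlt : |r / n| < δ := by
        rw [abs_div, Nat.abs_cast]
        have h3 : |r| / n ≤ |r| := div_le_self (abs_nonneg _) (by exact_mod_cast hn)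
        have h4 : |r| < δ := by simpa using hrδ
        linarith
      refine (hL _ hlt).trans (le_of_eq ?_)
      rw [abs_div, Nat.abs_cast]; ring
    have hk : ∀ k ≤ n, ‖(T.U (h ^ k) : H →L[ℂ] H) φ - φ‖ < ε' := by
      intro k hk
      apply hη'
      have h3 := norm_pow_sub_one_le h.1.1 k
      have h4 : (1 + ‖h.1.1 - 1‖) ^ k ≤ Real.exp (L * |r|) :=
        (by gcongr : (1 + ‖h.1.1 - 1‖) ^ k ≤ (1 + L * |r| / n) ^ k).trans
          (one_add_div_pow_le_exp (by positivity) hk)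
      have h5 : (h ^ k).1.1 = h.1.1 ^ k := by simp
      rw [h5]
      linarith
    -- Telescoping: replacing the increment at the `k`-th power by the increment at the identity
    -- costs `⟨φ - U(h^k) φ, U(h^k)(U(h) ψ - ψ)⟩`. The first factor is small by strong continuity,
    -- the second is `O(|r|/n)`, so the `n` errors add up to at most `ε |r|`.
    have hstep : ∀ k ≤ n,
        ‖inner ℂ φ ((T.U (h ^ k) : H →L[ℂ] H) ψ) - inner ℂ φ ψ -
          k * (inner ℂ φ ((T.U h : H →L[ℂ] H) ψ) - inner ℂ φ ψ)‖ ≤ k * (ε' * (C * (|r| / n))) := by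
      intro k
      induction k with
      | zero => simp
      | succ k ih =>
        intro hk1
        have ih := ih (by omega)
        have e1 : inner ℂ φ ((T.U (h ^ (k + 1)) : H →L[ℂ] H) ψ) =
            inner ℂ φ ((T.U (h ^ k) : H →L[ℂ] H) ((T.U h : H →L[ℂ] H) ψ)) := by
          rw [pow_succ, map_mul]; rfl
        have e2 : inner ℂ φ ((T.U (h ^ k) : H →L[ℂ] H) ((T.U h : H →L[ℂ] H) ψ)) -
            inner ℂ φ ((T.U (h ^ k) : H →L[ℂ] H) ψ) - (inner ℂ φ ((T.U h : H →L[ℂ] H) ψ) -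
              inner ℂ φ ψ) =
            inner ℂ (φ - (T.U (h ^ k) : H →L[ℂ] H) φ)
              ((T.U (h ^ k) : H →L[ℂ] H) ((T.U h : H →L[ℂ] H) ψ - ψ)) := by
          rw [inner_sub_left, Unitary.inner_map_map, map_sub, inner_sub_right, inner_sub_right]
        have e3 : ‖inner ℂ (φ - (T.U (h ^ k) : H →L[ℂ] H) φ)
            ((T.U (h ^ k) : H →L[ℂ] H) ((T.U h : H →L[ℂ] H) ψ - ψ))‖ ≤ ε' * (C * (|r| / n)) := by
          refine (norm_inner_le_norm _ _).trans ?_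
          rw [Unitary.norm_map, norm_sub_rev]
          have h6 := hC (r / n)
          rw [abs_div, Nat.abs_cast] at h6
          exact mul_le_mul (hk k (by omega)).le h6 (norm_nonneg _) hε'0.le
        have e4 : inner ℂ φ ((T.U (h ^ (k + 1)) : H →L[ℂ] H) ψ) - inner ℂ φ ψ -
            ((k + 1 : ℕ) : ℂ) * (inner ℂ φ ((T.U h : H →L[ℂ] H) ψ) - inner ℂ φ ψ) =
            (inner ℂ φ ((T.U (h ^ k) : H →L[ℂ] H) ψ) - inner ℂ φ ψ -
            k * (inner ℂ φ ((T.U h : H →L[ℂ] H) ψ) - inner ℂ φ ψ)) +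
            inner ℂ (φ - (T.U (h ^ k) : H →L[ℂ] H) φ)
              ((T.U (h ^ k) : H →L[ℂ] H) ((T.U h : H →L[ℂ] H) ψ - ψ)) := by
          rw [← e2, e1]; push_cast; ring
        rw [e4]
        refine (norm_add_le _ _).trans ?_
        push_cast
        linarith
    refine (hstep n le_rfl).trans ?_
    have : (n : ℝ) * (ε' * (C * (|r| / n))) = ε' * C * |r| := by field_simp
    rw [this]
    gcongr
    rw [hε', div_mul_eq_mul_div, div_le_iff₀ (by positivity)]
    nlinarith
  have hlim1 : Tendsto (fun n : ℕ => inner ℂ φ ((T.U (g (r / n) ^ n) : H →L[ℂ] H) ψ)) atTop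
      (𝓝 (inner ℂ φ ((T.U (oneParam M hM r) : H →L[ℂ] H) ψ))) :=
    tendsto_const_nhds.inner (((T.continuous_U ψ).tendsto _).comp (hexp r))
  have hlim2 : Tendsto (fun n : ℕ => (n : ℂ) * (inner ℂ φ ((T.U (g (r / n)) : H →L[ℂ] H) ψ) -
      inner ℂ φ ψ)) atTop (𝓝 (r • inner ℂ φ χ)) := by
    rcases eq_or_ne r 0 with rfl | hr0
    · simp [hg0]
    have h2 : Tendsto (fun n : ℕ => r / (n : ℝ)) atTop (𝓝[≠] 0) := by
      refine tendsto_nhdsWithin_iff.2 ⟨tendsto_const_div_atTop_nhds_zero_nat r, ?_⟩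
      filter_upwards [eventually_gt_atTop 0] with n hn
      have : (n : ℝ) ≠ 0 := by positivity
      exact div_ne_zero hr0 this
    refine (((hw φ).tendsto_slope_zero.comp h2).const_smul r).congr' ?_
    filter_upwards [eventually_gt_atTop 0] with n hn
    have : (n : ℝ) ≠ 0 := by positivity
    simp only [Function.comp, zero_add, hg0, hU1, one_apply_eq_self, smul_smul]
    have h3 : r * (r / n)⁻¹ = n := by field_simp
    rw [h3, Complex.real_smul]
    simp
  -- The bound does not depend on `n`; as `n → ∞` the powers become `exp (r M)` and `n` times the
  -- single increment becomes `r ⟨φ, χ⟩`.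
  refine le_of_tendsto ((hlim1.sub_const _).sub hlim2).norm ?_
  filter_upwards [eventually_gt_atTop 0] with n hn
  exact hpow n hn

end

/-! ### Quasi-passivity from the KMS condition -/

/-- The boundary value estimate for difference quotients along a unitary orbit. -/
theorem exists_norm_slope_le {H : Type*} [NormedAddCommGroup H] [InnerProductSpace ℂ H]
    {V : ℝ → H →L[ℂ] H} (h0 : V 0 = 1) {ψ χ : H}
    (hV : HasDerivAt (fun t => V t ψ) χ 0) {ε : ℝ} (hε : 0 < ε) :
    ∃ δ > 0, ∀ h : ℝ, 0 < h → h < δ → ‖(h : ℂ)⁻¹ • (V h ψ - ψ) - χ‖ ≤ ε := by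
  have h1 := hV.tendsto_slope_zero
  obtain ⟨δ, hδ, h2⟩ := Metric.eventually_nhds_iff.1
    (eventually_nhdsWithin_iff.1 (Metric.tendsto_nhds.1 h1 ε hε))
  refine ⟨δ, hδ, fun h hh hh' => ?_⟩
  have h3 := @h2 h (by simpa [abs_of_pos hh] using hh') hh.ne'
  rw [zero_add, h0, dist_eq_norm] at h3
  have e : ((h : ℂ)⁻¹ : ℂ) = ((h⁻¹ : ℝ) : ℂ) := by push_cast; rfl
  rw [e, Complex.coe_smul]
  exact h3.le

section Passive

variable {H : Type*} [NormedAddCommGroup H] [InnerProductSpace ℂ H] [CompleteSpace H]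

/-- Centralizers are norm closed. This makes the wedge algebra a Banach space, as the closed graph
argument requires. -/
theorem isClosed_vonNeumannAlgebra (S : VonNeumannAlgebra H) :
    IsClosed (S : Set (H →L[ℂ] H)) := by
  rw [← S.centralizer_centralizer]
  exact Set.isClosed_centralizer _

namespace DSTheory

variable (T : DSTheory H)

theorem star_U (g : SO0) : star (T.U g : H →L[ℂ] H) = T.U g⁻¹ := by
  rw [map_inv]; rfl

theorem Ad_apply_Ω (g : SO0) (A : H →L[ℂ] H) :
    T.Ad g A T.Ω = (T.U g : H →L[ℂ] H) (A T.Ω) := by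
  simp only [Ad, star_U, mul_apply_eq_comp, T.invariant]

theorem star_Ad (g : SO0) (A : H →L[ℂ] H) : star (T.Ad g A) = T.Ad g (star A) := by
  simp only [Ad, star_mul, star_star, mul_assoc]

theorem norm_Ad_le (g : SO0) (A : H →L[ℂ] H) : ‖T.Ad g A‖ ≤ ‖A‖ := by
  refine ContinuousLinearMap.opNorm_le_bound _ (norm_nonneg _) fun ψ => ?_
  simp only [Ad, star_U, mul_apply_eq_comp]
  rw [Unitary.norm_map]
  refine (A.le_opNorm _).trans ?_
  rw [Unitary.norm_map]

theorem Ad_mem {M : Matrix (Fin 5) (Fin 5) ℝ} {hM : IsSkew M} {W : DSWedge}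
    (hW : InducesFutureFlow M hM W) (t : ℝ) {A : H →L[ℂ] H} (hA : A ∈ T.R W) :
    T.Ad (oneParam M hM t) A ∈ T.R W := by
  have h := (T.covariant (oneParam M hM t) W A).1 hA
  have e : W.translate (oneParam M hM t) = W := Subtype.ext (hW.1 t)
  rwa [e] at h

/-- On the upper line of the KMS strip the orbit of `star A Ω` appears, so the adjoint must be
differentiable too. -/
theorem inDerivationDomain_star {g : ℝ → SO0} {s : ℝ} {A D : H →L[ℂ] H}
    (hD : ∀ φ ψ : H, HasDerivAt (fun r => inner ℂ φ (T.Ad (g r) A ψ)) (inner ℂ φ (D ψ)) s)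
    (φ ψ : H) :
    HasDerivAt (fun r => inner ℂ φ (T.Ad (g r) (star A) ψ)) (inner ℂ φ (star D ψ)) s := by
  have h1 := Complex.conjCLE.toContinuousLinearMap.hasFDerivAt.comp_hasDerivAt s (hD ψ φ)
  have h2 : ∀ B : H →L[ℂ] H, inner ℂ φ (star B ψ) = (starRingEnd ℂ) (inner ℂ ψ (B φ)) := by
    intro B
    rw [inner_conj_symm, ContinuousLinearMap.star_eq_adjoint,
      ContinuousLinearMap.adjoint_inner_right]
  simp only [← star_Ad, h2]
  exact h1

variable {T}

/-- Let `A` be differentiable with respect to `Ad U(g t)`, where the curve `g` has the velocity `M`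
at the identity. Then `A Ω` is in the domain of the generator of `U(exp (t M))`. -/
theorem hasDerivAt_oneParam_of_derivation {g : ℝ → SO0} (hg0 : g 0 = 1)
    {M : Matrix (Fin 5) (Fin 5) ℝ} (hM : IsSkew M)
    (hg : ∀ i j, HasDerivAt (fun r => (g r).1.1 i j) (M i j) 0) {A D : H →L[ℂ] H}
    (hD : ∀ φ ψ : H, HasDerivAt (fun r => inner ℂ φ (T.Ad (g r) A ψ)) (inner ℂ φ (D ψ)) 0) :
    HasDerivAt (fun t => (T.U (oneParam M hM t) : H →L[ℂ] H) (A T.Ω)) (D T.Ω) 0 := by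
  refine hasDerivAt_of_weak (V := fun t => (T.U (oneParam M hM t) : H →L[ℂ] H)) ?_ ?_ ?_ ?_
  · intro s t
    rw [oneParam_add, map_mul]; rfl
  · rw [oneParam_zero, map_one]; rfl
  · intro ψ
    exact (T.continuous_U ψ).comp (continuous_oneParam M hM)
  · refine T.hasDerivAt_weak_oneParam hg0 hM hg fun φ => ?_
    simpa only [Ad_apply_Ω] using hD φ T.Ω

/-- The KMS function of `star A` and `A` fits `nonneg_of_strip`: unitarity makes `A Ω` and `star A
Ω` unit vectors, hence the boundary bound 1, and norm differentiability of both orbits gives uniform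
difference quotients on both lines, since the group acts isometrically. -/
theorem quasiPassive (hKMS : T.GeodesicKMS) {W : DSWedge} {M : Matrix (Fin 5) (Fin 5) ℝ}
    {hM : IsSkew M} (hW : InducesFutureFlow M hM W) {g : ℝ → SO0} (hg0 : g 0 = 1)
    (hg : ∀ i j, HasDerivAt (fun r => (g r).1.1 i j) (M i j) 0) {A D : H →L[ℂ] H}
    (hA : A ∈ T.R W) (hu : A ∈ unitary (H →L[ℂ] H))
    (hD : ∀ φ ψ : H, HasDerivAt (fun r => inner ℂ φ (T.Ad (g r) A ψ)) (inner ℂ φ (D ψ)) 0) :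
    ∃ h : A T.Ω ∈ (T.hamiltonian M hM).domain,
      T.hamiltonian M hM ⟨A T.Ω, h⟩ = -Complex.I • D T.Ω ∧
      ∃ E : ℝ, 0 ≤ E ∧ inner ℂ T.Ω (star A (T.hamiltonian M hM ⟨A T.Ω, h⟩)) = E := by
  set V : ℝ → H →L[ℂ] H := fun t => (T.U (oneParam M hM t) : H →L[ℂ] H) with hV
  have hV0 : V 0 = 1 := by simp only [hV]; rw [oneParam_zero, map_one]; rfl
  have hVadd : ∀ s t ψ, V (s + t) ψ = V s (V t ψ) := by
    intro s t ψ
    simp only [hV]; rw [oneParam_add, map_mul]; rfl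
  have hVn : ∀ t ψ, ‖V t ψ‖ = ‖ψ‖ := fun t ψ => Unitary.norm_map _ _
  have d1 : HasDerivAt (fun t => V t (A T.Ω)) (D T.Ω) 0 :=
    hasDerivAt_oneParam_of_derivation hg0 hM hg hD
  have d2 : HasDerivAt (fun t => V t (star A T.Ω)) (star D T.Ω) 0 :=
    hasDerivAt_oneParam_of_derivation hg0 hM hg (T.inDerivationDomain_star hD)
  have hn1 : ‖A T.Ω‖ = 1 := by
    rw [ContinuousLinearMap.norm_map_of_mem_unitary hu, T.norm_Ω]
  have hn2 : ‖star A T.Ω‖ = 1 := by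
    rw [ContinuousLinearMap.norm_map_of_mem_unitary (Unitary.star_mem hu), T.norm_Ω]
  set ψ := A T.Ω with hψ
  set ψ' := star A T.Ω with hψ'
  set χ := D T.Ω with hχ
  set χ' := star D T.Ω with hχ'
  have hham : ∀ h : ψ ∈ (T.hamiltonian M hM).domain,
      T.hamiltonian M hM ⟨ψ, h⟩ = -Complex.I • χ := by
    intro h
    change -Complex.I • deriv (fun t => V t ψ) 0 = _
    rw [d1.deriv]
  have hdom : ψ ∈ (T.hamiltonian M hM).domain := d1.differentiableAt
  refine ⟨hdom, hham hdom, ?_⟩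
  rw [hham hdom]
  -- the expectation value of the generator is real
  obtain ⟨E, hE⟩ : ∃ E : ℝ, inner ℂ ψ χ = Complex.I * E := by
    have h1 := d1.inner ℂ d1
    have h2 : (fun t => inner ℂ (V t ψ) (V t ψ)) = fun _ => inner ℂ ψ ψ := by
      funext t
      exact Unitary.inner_map_map _ _ _
    rw [h2, hV0] at h1
    have h3 := h1.unique (hasDerivAt_const (0 : ℝ) (inner ℂ ψ ψ))
    simp only [one_apply_eq_self] at h3
    refine ⟨(inner ℂ ψ χ).im, ?_⟩
    rw [← inner_conj_symm χ ψ] at h3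
    have h4 := congrArg Complex.re h3
    simp only [Complex.add_re, Complex.conj_re, Complex.zero_re] at h4
    apply Complex.ext
    · simp; linarith
    · simp
  refine ⟨E, ?_, ?_⟩
  swap
  · rw [ContinuousLinearMap.star_eq_adjoint, ContinuousLinearMap.adjoint_inner_right, ← hψ,
      inner_smul_right, hE, ← mul_assoc, neg_mul, Complex.I_mul_I]
    simp
  obtain ⟨β, hβ, hF⟩ := hKMS W M hM hW
  have hAs : star A ∈ T.R W := star_mem hA
  let S : Submodule ℂ (H →L[ℂ] H) := (T.R W).toStarSubalgebra.toSubalgebra.toSubmodule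
  have hS : ∀ B : S, (B : H →L[ℂ] H) ∈ T.R W := fun B => B.2
  have : CompleteSpace S := (isClosed_vonNeumannAlgebra (T.R W)).completeSpace_coe
  choose F hFc hFd hFb using fun B : S => hF (star A) hAs B (hS B)
  have hbot : ∀ (B : S) (t : ℝ), F B t = inner ℂ ψ (V t ((B : H →L[ℂ] H) T.Ω)) := by
    intro B t
    rw [(hFb B t).1, mul_apply_eq_comp, Ad_apply_Ω,
      ContinuousLinearMap.star_eq_adjoint, ContinuousLinearMap.adjoint_inner_right]
  let f : ℝ → S →L[ℂ] ℂ := fun t =>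
    (innerSL ℂ (ContinuousLinearMap.adjoint (V t) ψ)).comp
      ((ContinuousLinearMap.apply ℂ H T.Ω).comp S.subtypeL)
  have hf : ∀ t (B : S), f t B = inner ℂ ψ (V t ((B : H →L[ℂ] H) T.Ω)) := by
    intro t B
    change inner ℂ (ContinuousLinearMap.adjoint (V t) ψ) ((B : H →L[ℂ] H) T.Ω) = _
    rw [ContinuousLinearMap.adjoint_inner_left]
  have hbdd := exists_bound_of_strip hβ f
    (fun t B => ⟨T.Ad (oneParam M hM t) B, T.Ad_mem hW t (hS B)⟩)
    (fun t B => T.norm_Ad_le _ _)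
    (fun t s B => by
      rw [hf, hf, hVadd]
      simp only [Ad_apply_Ω]; rfl) F hFc hFd (fun B t => by rw [hbot, hf]) ⟨A, hA⟩
  set G := F ⟨A, hA⟩ with hG
  have hGb : ∀ t : ℝ, G t = inner ℂ ψ (V t ψ) := fun t => hbot _ t
  have hGt : ∀ t : ℝ, G (t + β * Complex.I) = inner ℂ (V t ψ') ψ' := by
    intro t
    rw [hG, (hFb _ t).2, mul_apply_eq_comp, ← hψ']
    rw [← ContinuousLinearMap.adjoint_inner_left, ← ContinuousLinearMap.star_eq_adjoint, star_Ad,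
      Ad_apply_Ω]
  have hle : ∀ a b : H, ‖a‖ = 1 → ‖inner ℂ a b‖ ≤ ‖b‖ := by
    intro a b ha
    simpa [ha] using norm_inner_le_norm (𝕜 := ℂ) a b
  refine nonneg_of_strip (F := G) (f' := fun t => inner ℂ ψ (V t χ))
    (g' := fun t => inner ℂ (V t χ') ψ') hβ (hFc _) (hFd _) hbdd ?_ ?_ ?_ ?_ ?_ ?_
  · intro t
    rw [hGb]
    exact (hle _ _ hn1).trans (by rw [hVn, hn1])
  · intro t
    rw [hGt, norm_inner_symm]
    exact (hle _ _ hn2).trans (by rw [hVn, hn2])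
  · intro ε hε
    obtain ⟨δ, hδ, h1⟩ := exists_norm_slope_le hV0 d1 hε
    refine ⟨δ, hδ, fun h hh hh' t => ?_⟩
    have e : (G ((t + h : ℝ)) - G t) / h - inner ℂ ψ (V t χ) =
        inner ℂ ψ (V t ((h : ℂ)⁻¹ • (V h ψ - ψ) - χ)) := by
      rw [hGb, hGb, hVadd, map_sub, map_smul, map_sub, inner_sub_right, inner_smul_right,
        inner_sub_right]
      ring
    rw [e]
    exact (hle _ _ hn1).trans (by rw [hVn]; exact h1 h hh hh')
  · intro ε hε
    obtain ⟨δ, hδ, h1⟩ := exists_norm_slope_le hV0 d2 hε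
    refine ⟨δ, hδ, fun h hh hh' t => ?_⟩
    have e : (G ((t + h : ℝ) + β * Complex.I) - G (t + β * Complex.I)) / h -
        inner ℂ (V t χ') ψ' = inner ℂ (V t ((h : ℂ)⁻¹ • (V h ψ' - ψ') - χ')) ψ' := by
      rw [hGt, hGt, hVadd, map_sub, map_smul, map_sub, inner_sub_left, inner_smul_left,
        inner_sub_left, map_inv₀, Complex.conj_ofReal]
      ring
    rw [e, norm_inner_symm]
    exact (hle _ _ hn2).trans (by rw [hVn]; exact h1 h hh hh')
  · have := hGb 0
    rw [hV0, one_apply_eq_self, inner_self_eq_norm_sq_to_K, hn1] at this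
    simpa using this
  · rw [hV0, one_apply_eq_self, hE]

end DSTheory

end Passive

/-! ### The Minkowski form -/

section Lorentz

theorem gm_comm (x y : M5) : gm x y = gm y x := by rw [gm_apply, gm_apply]; ring

theorem gm_add_left (x y z : M5) : gm (x + y) z = gm x z + gm y z := by
  simp only [gm_apply, Pi.add_apply]; ring

theorem gm_smul_left (c : ℝ) (x z : M5) : gm (c • x) z = c * gm x z := by
  simp only [gm_apply, Pi.smul_apply, smul_eq_mul]; ring

theorem gm_add_right (x y z : M5) : gm z (x + y) = gm z x + gm z y := by
  simp only [gm_apply, Pi.add_apply]; ring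

theorem gm_smul_right (c : ℝ) (x z : M5) : gm z (c • x) = c * gm z x := by
  simp only [gm_apply, Pi.smul_apply, smul_eq_mul]; ring

theorem gm_sub_left (x y z : M5) : gm (x - y) z = gm x z - gm y z := by
  simp only [gm_apply, Pi.sub_apply]; ring

theorem gm_sub_right (x y z : M5) : gm z (x - y) = gm z x - gm z y := by
  simp only [gm_apply, Pi.sub_apply]; ring

theorem gm_neg_left (x z : M5) : gm (-x) z = -gm x z := by
  simp only [gm_apply, Pi.neg_apply]; ring

theorem gm_neg_right (x z : M5) : gm z (-x) = -gm z x := by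
  simp only [gm_apply, Pi.neg_apply]; ring

/-- The Euclidean inner product of the spatial parts. -/
def sp (x y : M5) : ℝ := x 1 * y 1 + x 2 * y 2 + x 3 * y 3 + x 4 * y 4

theorem gm_eq_sp (x y : M5) : gm x y = x 0 * y 0 - sp x y := by
  rw [gm_apply, sp]; ring

theorem sp_self_nonneg (x : M5) : 0 ≤ sp x x := by
  unfold sp
  linarith [mul_self_nonneg (x 1), mul_self_nonneg (x 2), mul_self_nonneg (x 3),
    mul_self_nonneg (x 4)]

theorem sp_sq_le (x y : M5) : sp x y ^ 2 ≤ sp x x * sp y y := by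
  unfold sp
  nlinarith [sq_nonneg (x 1 * y 2 - x 2 * y 1), sq_nonneg (x 1 * y 3 - x 3 * y 1),
    sq_nonneg (x 1 * y 4 - x 4 * y 1), sq_nonneg (x 2 * y 3 - x 3 * y 2),
    sq_nonneg (x 2 * y 4 - x 4 * y 2), sq_nonneg (x 3 * y 4 - x 4 * y 3)]

theorem eq_zero_of_sp_self {x : M5} (h0 : x 0 = 0) (h : sp x x = 0) : x = 0 := by
  unfold sp at h
  have key : ∀ a b c d : ℝ, a * a + b * b + c * c + d * d = 0 → a = 0 := by
    intro a b c d h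
    nlinarith [mul_self_nonneg a, mul_self_nonneg b, mul_self_nonneg c, mul_self_nonneg d]
  funext i
  fin_cases i
  · exact h0
  · exact key _ _ _ _ h
  · exact key (x 2) (x 1) (x 3) (x 4) (by linarith)
  · exact key (x 3) (x 1) (x 2) (x 4) (by linarith)
  · exact key (x 4) (x 1) (x 2) (x 3) (by linarith)

/-- The form is negative semidefinite on the orthogonal complement of a timelike vector. -/
theorem gm_self_nonpos_of_orthogonal {m z : M5} (hm : 0 < gm m m) (h : gm m z = 0) :
    gm z z ≤ 0 := by
  rw [gm_eq_sp] at hm h ⊢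
  have h1 := sp_sq_le m z
  have h2 := sp_self_nonneg m
  have h3 := sp_self_nonneg z
  have h4 : sp m z = m 0 * z 0 := by linarith
  rw [h4] at h1
  by_contra hcon
  push Not at hcon
  nlinarith [mul_lt_mul_of_pos_left hcon (show 0 < m 0 * m 0 by linarith)]

/-- The Cauchy-Schwarz inequality on the orthogonal complement of a timelike vector. -/
theorem gm_sq_le_of_orthogonal {m x y : M5} (hm : 0 < gm m m) (hx : gm m x = 0)
    (hy : gm m y = 0) (hxx : gm x x < 0) : gm x y ^ 2 ≤ gm x x * gm y y := by
  have h : gm m (gm x x • y - gm x y • x) = 0 := by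
    rw [gm_sub_right, gm_smul_right, gm_smul_right, hx, hy]; ring
  have h1 := gm_self_nonpos_of_orthogonal hm h
  have h2 : gm (gm x x • y - gm x y • x) (gm x x • y - gm x y • x) =
      gm x x * (gm x x * gm y y - gm x y ^ 2) := by
    simp only [gm_sub_left, gm_sub_right, gm_smul_left, gm_smul_right, gm_comm y x]; ring
  rw [h2] at h1
  nlinarith

theorem gm_pos_of_future {e z : M5} (he : FutureTimelike e) (hz : FutureTimelike z) :
    0 < gm e z := by
  obtain ⟨h1, h2⟩ := he
  obtain ⟨h3, h4⟩ := hz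
  rw [gm_eq_sp] at h1 h3 ⊢
  have h5 := sp_sq_le e z
  have h6 : sp e z ^ 2 < (e 0 * z 0) ^ 2 := by
    have := sp_self_nonneg e
    have := sp_self_nonneg z
    calc sp e z ^ 2 ≤ sp e e * sp z z := h5
      _ ≤ sp e e * (z 0 * z 0) := by gcongr; linarith
      _ < (e 0 * e 0) * (z 0 * z 0) := by
          have : 0 < z 0 * z 0 := by positivity
          nlinarith
      _ = _ := by ring
  have h7 := abs_lt_of_sq_lt_sq h6 (by positivity)
  linarith [le_abs_self (sp e z)]

/-- Time orientation can be tested against any future vector, not only the coordinate axis, which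
makes the test invariant under isometries. -/
theorem futureTimelike_iff {e z : M5} (he : FutureTimelike e) (hz : 0 < gm z z) :
    FutureTimelike z ↔ 0 < gm e z := by
  refine ⟨gm_pos_of_future he, fun h => ⟨hz, ?_⟩⟩
  rcases lt_trichotomy (z 0) 0 with h0 | h0 | h0
  · have h1 : FutureTimelike (-z) := ⟨by simpa [gm_neg_left, gm_neg_right] using hz, by simpa⟩
    have := gm_pos_of_future he h1
    rw [gm_neg_right] at this
    linarith
  · rw [gm_eq_sp, h0] at hz
    linarith [sp_self_nonneg z]
  · exact h0

/-! ### Reflections and the construction of group elements -/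

/-- The reflection along `v`. -/
def reflMat (v : M5) : Matrix (Fin 5) (Fin 5) ℝ :=
  1 - vecMulVec ((2 / gm v v) • v) (eta *ᵥ v)

theorem reflMat_mulVec (v y : M5) : reflMat v *ᵥ y = y - (2 * gm v y / gm v v) • v := by
  rw [reflMat, Matrix.sub_mulVec, Matrix.one_mulVec, Matrix.vecMulVec_mulVec, dotProduct_comm]
  change y - MulOpposite.op (gm y v) • (2 / gm v v) • v = _
  rw [op_smul_eq_smul, smul_smul, gm_comm y v]
  congr 2
  ring

theorem gm_reflMat {v : M5} (hv : gm v v ≠ 0) (x y : M5) :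
    gm (reflMat v *ᵥ x) (reflMat v *ᵥ y) = gm x y := by
  simp only [reflMat_mulVec, gm_sub_left, gm_sub_right, gm_smul_left, gm_smul_right, gm_comm x v]
  field_simp
  ring

theorem det_reflMat {v : M5} (hv : gm v v ≠ 0) : (reflMat v).det = -1 := by
  rw [reflMat, sub_eq_add_neg, ← Matrix.neg_vecMulVec, Matrix.vecMulVec_eq Unit,
    Matrix.det_one_add_replicateCol_mul_replicateRow, dotProduct_neg, dotProduct_smul,
    dotProduct_comm]
  change 1 + -(2 / gm v v * gm v v) = -1
  rw [div_mul_cancel₀ _ hv]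
  norm_num

theorem transpose_mul_eta_mul {A : Matrix (Fin 5) (Fin 5) ℝ}
    (h : ∀ x y, gm (A *ᵥ x) (A *ᵥ y) = gm x y) : Aᵀ * eta * A = eta := by
  ext i j
  have h1 := h (Pi.single i 1) (Pi.single j 1)
  unfold gm at h1
  rw [Matrix.mulVec_mulVec, ← Matrix.vecMul_transpose, ← Matrix.dotProduct_mulVec,
    Matrix.mulVec_mulVec, ← Matrix.mul_assoc] at h1
  simpa using h1

/-- A product of two reflections which maps some future timelike vector to a future timelike vector
belongs to the proper orthochronous group. -/
theorem exists_act_eq_reflMat {v w u : M5} (hv : gm v v ≠ 0) (hw : gm w w ≠ 0)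
    (hu : FutureTimelike u) (hu' : FutureTimelike (reflMat v *ᵥ reflMat w *ᵥ u)) :
    ∃ g : SO0, ∀ x, act g x = reflMat v *ᵥ reflMat w *ᵥ x := by
  have hp : ∀ x y, gm ((reflMat v * reflMat w) *ᵥ x) ((reflMat v * reflMat w) *ᵥ y) = gm x y := by
    intro x y
    rw [← Matrix.mulVec_mulVec, ← Matrix.mulVec_mulVec, gm_reflMat hv, gm_reflMat hw]
  refine ⟨⟨⟨reflMat v * reflMat w, ?_⟩, transpose_mul_eta_mul hp, fun z hz => ?_⟩, fun x => ?_⟩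
  · rw [Matrix.det_mul, det_reflMat hv, det_reflMat hw]; norm_num
  · rw [Matrix.mulVec_mulVec] at hu'
    rw [futureTimelike_iff hu' (by rw [hp]; exact hz.1), hp]
    exact gm_pos_of_future hu hz
  · simp [act, Matrix.mulVec_mulVec]

/-- The time axis. -/
def axis0 : M5 := Pi.single 0 1

/-- The first spatial axis. -/
def axis1 : M5 := Pi.single 1 1

theorem gm_axis0 (x : M5) : gm axis0 x = x 0 := by simp [gm_apply, axis0]

theorem gm_axis1 (x : M5) : gm axis1 x = -x 1 := by simp [gm_apply, axis1]

theorem futureTimelike_axis0 : FutureTimelike axis0 := by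
  refine ⟨?_, ?_⟩
  · rw [gm_axis0]; simp [axis0]
  · simp [axis0]

theorem gm_act (g : SO0) (x y : M5) : gm (act g x) (act g y) = gm x y := gm_mulVec _ g.2.1 x y

theorem act_act_inv (g : SO0) (x : M5) : act g (act g⁻¹ x) = x := by
  rw [← act_mul]; simp [act]

/-- A unit future timelike vector and a unit spacelike vector orthogonal to it. -/
structure IsFrame (e f : M5) : Prop where
  gm_e : gm e e = 1
  pos : 0 < e 0
  gm_f : gm f f = -1
  orth : gm e f = 0

theorem IsFrame.future {e f : M5} (h : IsFrame e f) : FutureTimelike e :=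
  ⟨by rw [h.gm_e]; exact one_pos, h.pos⟩

theorem isFrame_axis : IsFrame axis0 axis1 where
  gm_e := by rw [gm_axis0]; simp [axis0]
  pos := by simp [axis0]
  gm_f := by rw [gm_axis1]; simp [axis1]
  orth := by rw [gm_axis0]; simp [axis1]

theorem isFrame_act (g : SO0) : IsFrame (act g axis0) (act g axis1) where
  gm_e := by rw [gm_act, isFrame_axis.gm_e]
  pos := (g.2.2 _ futureTimelike_axis0).2
  gm_f := by rw [gm_act, isFrame_axis.gm_f]
  orth := by rw [gm_act, isFrame_axis.orth]

/-- The reflection along `u` sends `u` to `-u`, and the one along `u + w` sends `-u` to `w`. Two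
reflections are used so that the determinant is one. -/
theorem reflMat_add_mulVec_neg {u w : M5} (h : gm u u = gm w w) (hv : gm (u + w) (u + w) ≠ 0) :
    reflMat (u + w) *ᵥ reflMat u *ᵥ u = w ∨ gm u u = 0 := by
  by_cases h0 : gm u u = 0
  · exact Or.inr h0
  · left
    have h1 : reflMat u *ᵥ u = -u := by
      rw [reflMat_mulVec, mul_div_assoc, div_self h0, mul_one, two_smul]; abel
    have h2 : gm (u + w) (u + w) = 2 * gm (u + w) u := by
      simp only [gm_add_left, gm_add_right, gm_comm w u]; linarith
    have h3 : 2 * gm (u + w) (-u) / gm (u + w) (u + w) = -1 := by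
      rw [gm_neg_right, mul_neg, ← h2, neg_div, div_self hv]
    rw [h1, reflMat_mulVec, h3]
    simp

theorem exists_act_axis0 {e : M5} (he : gm e e = 1) (hpos : 0 < e 0) :
    ∃ g : SO0, act g axis0 = e := by
  have hv : gm (axis0 + e) (axis0 + e) ≠ 0 := by
    simp only [gm_add_left, gm_add_right, gm_comm e axis0, isFrame_axis.gm_e, he, gm_axis0]
    linarith
  have h1 : gm axis0 axis0 ≠ 0 := by rw [isFrame_axis.gm_e]; norm_num
  have h2 := (reflMat_add_mulVec_neg (by rw [he, isFrame_axis.gm_e]) hv).resolve_right h1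
  obtain ⟨g, hg⟩ := exists_act_eq_reflMat hv h1 futureTimelike_axis0
    (by rw [h2]; exact ⟨by rw [he]; exact one_pos, hpos⟩)
  exact ⟨g, by rw [hg, h2]⟩

theorem exists_act_axis1 {q : M5} (hq : gm q q = -1) (hq0 : q 0 = 0) :
    ∃ g : SO0, act g axis0 = axis0 ∧ act g axis1 = q := by
  have h1 : gm axis1 axis1 ≠ 0 := by rw [isFrame_axis.gm_f]; norm_num
  have hfix : ∀ v : M5, v 0 = 0 → reflMat v *ᵥ axis0 = axis0 := by
    intro v hv
    rw [reflMat_mulVec, gm_comm, gm_axis0, hv]; simp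
  -- Here `axis1 + q` is null exactly when `q = -axis1`. In that case the reflection along `axis1`
  -- is paired with one along another spatial axis to correct the determinant.
  by_cases hq1 : q 1 = -1
  · have hqe : q = -axis1 := by
      have h2 : (q + axis1) = 0 := by
        apply eq_zero_of_sp_self
        · simp [hq0, axis1]
        · rw [gm_eq_sp, hq0] at hq
          unfold sp at hq ⊢
          simp [axis1, hq1] at hq ⊢
          linarith
      exact eq_neg_of_add_eq_zero_left h2
    set w : M5 := Pi.single 2 1 with hw
    have h2 : gm w w ≠ 0 := by simp [gm_apply, hw]
    have h3 : reflMat axis1 *ᵥ reflMat w *ᵥ axis0 = axis0 := by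
      rw [hfix w (by simp [hw]), hfix axis1 (by simp [axis1])]
    obtain ⟨g, hg⟩ := exists_act_eq_reflMat h1 h2 futureTimelike_axis0
      (by rw [h3]; exact futureTimelike_axis0)
    refine ⟨g, by rw [hg, h3], ?_⟩
    have h4 : gm w axis1 = 0 := by simp [gm_apply, hw, axis1]
    rw [hg, reflMat_mulVec w, h4, reflMat_mulVec, hqe]
    simp [mul_div_assoc, div_self h1, two_smul]
  · have hv : gm (axis1 + q) (axis1 + q) ≠ 0 := by
      simp only [gm_add_left, gm_add_right, gm_comm q axis1, isFrame_axis.gm_f, hq, gm_axis1]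
      intro h
      exact hq1 (by linarith)
    have h2 := (reflMat_add_mulVec_neg (by rw [hq, isFrame_axis.gm_f]) hv).resolve_right h1
    have h3 : reflMat (axis1 + q) *ᵥ reflMat axis1 *ᵥ axis0 = axis0 := by
      rw [hfix axis1 (by simp [axis1]), hfix _ (by simp [axis1, hq0])]
    obtain ⟨g, hg⟩ := exists_act_eq_reflMat hv h1 futureTimelike_axis0
      (by rw [h3]; exact futureTimelike_axis0)
    exact ⟨g, by rw [hg, h3], by rw [hg, h2]⟩

/-- Since the group is transitive on frames, wedges can be handled through pairs of vectors without
mentioning group elements. -/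
theorem IsFrame.exists_act {e f : M5} (h : IsFrame e f) :
    ∃ g : SO0, act g axis0 = e ∧ act g axis1 = f := by
  obtain ⟨g, hg⟩ := exists_act_axis0 h.gm_e h.pos
  have h1 : gm (act g⁻¹ f) (act g⁻¹ f) = -1 := by rw [gm_act, h.gm_f]
  have h2 : act g⁻¹ f 0 = 0 := by
    rw [← gm_axis0 (act g⁻¹ f), ← gm_act g, hg, act_act_inv, h.orth]
  obtain ⟨r, hr0, hr1⟩ := exists_act_axis1 h1 h2
  exact ⟨g * r, by rw [act_mul, hr0, hg], by rw [act_mul, hr1, act_act_inv]⟩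

/-! ### Wedges and edges in terms of frames -/

theorem act_image_stdWedge (g : SO0) :
    act g '' stdWedge = {z | |gm (act g axis0) z| < -gm (act g axis1) z} := by
  ext z
  constructor
  · rintro ⟨y, hy, rfl⟩
    simpa [gm_act, gm_axis0, gm_axis1] using (show |y 0| < y 1 from hy)
  · intro hz
    refine ⟨act g⁻¹ z, ?_, act_act_inv g z⟩
    rw [← act_act_inv g z] at hz
    simpa [gm_act, gm_axis0, gm_axis1, stdWedge] using hz

theorem act_image_stdEdge (g : SO0) :
    act g '' stdEdge = {z | gm (act g axis0) z = 0 ∧ gm (act g axis1) z = 0} := by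
  ext z
  constructor
  · rintro ⟨y, hy, rfl⟩
    simpa [gm_act, gm_axis0, gm_axis1] using (show y 0 = 0 ∧ y 1 = 0 from hy)
  · intro hz
    refine ⟨act g⁻¹ z, ?_, act_act_inv g z⟩
    rw [← act_act_inv g z] at hz
    simpa [gm_act, gm_axis0, gm_axis1, stdEdge] using hz

/-- The wedge of a frame. -/
def IsFrame.wedge {e f : M5} (h : IsFrame e f) : DSWedge :=
  ⟨{z | |gm e z| < -gm f z} ∩ dS, by
    obtain ⟨g, rfl, rfl⟩ := h.exists_act
    exact ⟨g, by rw [act_image_stdWedge]⟩⟩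

theorem DSWedge.exists_frame (W : DSWedge) : ∃ e f, ∃ h : IsFrame e f, W = h.wedge := by
  obtain ⟨W, g, rfl⟩ := W
  exact ⟨_, _, isFrame_act g, Subtype.ext (congrArg (· ∩ dS) (act_image_stdWedge g))⟩

theorem DSWedge.mem_edge_iff (W : DSWedge) (y : M5) :
    y ∈ W.edge ↔ ∃ e f, ∃ h : IsFrame e f, W = h.wedge ∧ gm e y = 0 ∧ gm f y = 0 ∧ y ∈ dS := by
  constructor
  · rintro ⟨g, hW, hy, hd⟩
    rw [act_image_stdEdge] at hy
    exact ⟨_, _, isFrame_act g, Subtype.ext (by rw [hW, act_image_stdWedge]; rfl), hy.1, hy.2, hd⟩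
  · rintro ⟨e, f, h, rfl, h1, h2, hd⟩
    obtain ⟨g, hg, hg'⟩ := h.exists_act
    refine ⟨g, ?_, ?_, hd⟩
    · rw [act_image_stdWedge, hg, hg']; rfl
    · rw [act_image_stdEdge, hg, hg']; exact ⟨h1, h2⟩

end Lorentz

/-! ### Normal forms of wedges -/

section Normal

/-- The normal form of a wedge: a spatial unit vector `n`, and an orthogonal timelike vector `m`
with `m 0 = 1`. -/
structure IsNormal (n m : M5) : Prop where
  n_zero : n 0 = 0
  gm_n : gm n n = -1
  m_zero : m 0 = 1
  orth : gm n m = 0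
  pos : 0 < gm m m

/-- The open cone whose intersection with de Sitter space is the wedge. -/
def cone (n m : M5) : Set M5 := {z | 0 < -gm n z ∧ gm m z ^ 2 < gm n z ^ 2 * gm m m}

theorem smul_mem_cone {n m z : M5} (hz : z ∈ cone n m) {c : ℝ} (hc : 0 < c) :
    c • z ∈ cone n m := by
  obtain ⟨h1, h2⟩ := hz
  refine ⟨?_, ?_⟩
  · rw [gm_smul_right]; nlinarith
  · rw [gm_smul_right, gm_smul_right, mul_pow, mul_pow, mul_assoc]
    gcongr

/-- The normal vector `n` of a frame. -/
def frameN (e f : M5) : M5 := (Real.sqrt (e 0 ^ 2 - f 0 ^ 2))⁻¹ • (e 0 • f - f 0 • e)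

/-- The normal vector `m` of a frame. -/
def frameM (e f : M5) : M5 := (e 0 ^ 2 - f 0 ^ 2)⁻¹ • (e 0 • e - f 0 • f)

variable {e f : M5}

/-- The quantity is the square of the projection of `axis0` to the plane of `e` and `f`. The square
of `axis0` is one, and the remaining component is orthogonal to `e`, hence contributes
nonpositively. -/
theorem IsFrame.one_le (h : IsFrame e f) : 1 ≤ e 0 ^ 2 - f 0 ^ 2 := by
  have h1 : gm e (axis0 - e 0 • e + f 0 • f) = 0 := by
    rw [gm_add_right, gm_sub_right, gm_smul_right, gm_smul_right, h.gm_e, h.orth, gm_comm,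
      gm_axis0]
    ring
  have h2 := gm_self_nonpos_of_orthogonal (by rw [h.gm_e]; exact one_pos) h1
  rw [gm_add_left, gm_sub_left, gm_smul_left, h1, gm_smul_left, gm_add_right, gm_sub_right,
    gm_smul_right, gm_smul_right, gm_add_right, gm_sub_right, gm_smul_right, gm_smul_right,
    isFrame_axis.gm_e, gm_axis0, gm_axis0, gm_comm f axis0, gm_axis0, gm_comm f e, h.orth,
    h.gm_f] at h2
  linarith

theorem IsFrame.abs_zero_lt (h : IsFrame e f) : |f 0| < e 0 := by
  have := h.one_le
  exact abs_lt_of_sq_lt_sq (by linarith) h.pos.le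

theorem gm_frameN (z : M5) : gm (frameN e f) z =
    (Real.sqrt (e 0 ^ 2 - f 0 ^ 2))⁻¹ * (e 0 * gm f z - f 0 * gm e z) := by
  rw [frameN, gm_smul_left, gm_sub_left, gm_smul_left, gm_smul_left]

theorem gm_frameM (z : M5) : gm (frameM e f) z =
    (e 0 ^ 2 - f 0 ^ 2)⁻¹ * (e 0 * gm e z - f 0 * gm f z) := by
  rw [frameM, gm_smul_left, gm_sub_left, gm_smul_left, gm_smul_left]

theorem IsFrame.gm_frameM_self (h : IsFrame e f) :
    gm (frameM e f) (frameM e f) = (e 0 ^ 2 - f 0 ^ 2)⁻¹ := by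
  have h1 := h.one_le
  rw [gm_frameM, gm_comm e, gm_comm f, gm_frameM, gm_frameM, h.gm_e, h.gm_f, gm_comm f e, h.orth]
  field_simp
  ring

theorem IsFrame.isNormal (h : IsFrame e f) : IsNormal (frameN e f) (frameM e f) where
  n_zero := by simp [frameN]; right; ring
  gm_n := by
    have h1 := h.one_le
    have h2 : Real.sqrt (e 0 ^ 2 - f 0 ^ 2) ^ 2 = e 0 ^ 2 - f 0 ^ 2 := Real.sq_sqrt (by linarith)
    have h3 : Real.sqrt (e 0 ^ 2 - f 0 ^ 2) ≠ 0 := (Real.sqrt_pos.2 (by linarith)).ne'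
    rw [gm_frameN, gm_comm e, gm_comm f, gm_frameN, gm_frameN, h.gm_e, h.gm_f, gm_comm f e, h.orth]
    field_simp
    rw [h2]
    ring
  m_zero := by
    have h1 := h.one_le
    simp only [frameM, Pi.smul_apply, Pi.sub_apply, smul_eq_mul]
    field_simp
  orth := by
    rw [gm_frameN, gm_comm e, gm_comm f, gm_frameM, gm_frameM, h.gm_e, h.gm_f, gm_comm f e, h.orth]
    ring
  pos := by
    have h1 := h.one_le
    rw [h.gm_frameM_self]
    exact inv_pos.2 (by linarith)

/-- Up to the length of `m`, passing from `(e, f)` to `(m, n)` is a boost of their plane. It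
preserves the quadratic form `q ^ 2 - p ^ 2`, and by `|f 0| < e 0` also the choice between the two
opposite wedges. -/
theorem IsFrame.mem_cone_iff (h : IsFrame e f) (z : M5) :
    z ∈ cone (frameN e f) (frameM e f) ↔ |gm e z| < -gm f z := by
  have h1 := h.one_le
  have h2 := abs_lt.1 h.abs_zero_lt
  set N := e 0 ^ 2 - f 0 ^ 2 with hN
  have hN0 : 0 < N := by linarith
  have hs : 0 < Real.sqrt N := Real.sqrt_pos.2 hN0
  have hs2 : Real.sqrt N ^ 2 = N := Real.sq_sqrt hN0.le
  set p := gm e z with hp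
  set q := gm f z with hq
  have e1 : 0 < -gm (frameN e f) z ↔ 0 < f 0 * p - e 0 * q := by
    rw [gm_frameN, ← mul_neg, mul_pos_iff_of_pos_left (inv_pos.2 hs), neg_sub]
  have e2 : gm (frameM e f) z ^ 2 < gm (frameN e f) z ^ 2 * gm (frameM e f) (frameM e f) ↔
      p ^ 2 < q ^ 2 := by
    rw [h.gm_frameM_self, gm_frameN, gm_frameM, ← hN, ← hp, ← hq, mul_pow, mul_pow, inv_pow,
      inv_pow, hs2]
    have e3 : (N⁻¹ * (e 0 * q - f 0 * p) ^ 2 * N⁻¹) - (N ^ 2)⁻¹ * (e 0 * p - f 0 * q) ^ 2 =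
        N⁻¹ * (q ^ 2 - p ^ 2) := by
      field_simp
      rw [hN]
      ring
    have e4 : 0 < N⁻¹ := inv_pos.2 hN0
    rw [← sub_pos, e3, mul_pos_iff_of_pos_left e4, sub_pos]
  change 0 < -gm (frameN e f) z ∧ gm (frameM e f) z ^ 2 <
    gm (frameN e f) z ^ 2 * gm (frameM e f) (frameM e f) ↔ _
  rw [e1, e2]
  constructor
  · rintro ⟨h3, h4⟩
    have h5 : |p| < |q| := sq_lt_sq.1 h4
    rcases le_or_gt q 0 with h6 | h6
    · rwa [abs_of_nonpos h6] at h5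
    · exfalso
      rw [abs_of_pos h6] at h5
      have h7 := abs_lt.1 h5
      nlinarith
  · intro h3
    have h7 := abs_lt.1 h3
    refine ⟨by nlinarith, ?_⟩
    rw [sq_lt_sq]
    exact h3.trans_le (neg_le_abs q)

theorem IsFrame.gm_frame_eq_zero_iff (h : IsFrame e f) (z : M5) :
    (gm (frameN e f) z = 0 ∧ gm (frameM e f) z = 0) ↔ gm e z = 0 ∧ gm f z = 0 := by
  have h1 := h.one_le
  have hs : Real.sqrt (e 0 ^ 2 - f 0 ^ 2) ≠ 0 := (Real.sqrt_pos.2 (by linarith)).ne'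
  have hN : e 0 ^ 2 - f 0 ^ 2 ≠ 0 := by linarith
  rw [gm_frameN, gm_frameM]
  constructor
  · rintro ⟨h2, h3⟩
    have h2 := (mul_eq_zero.1 h2).resolve_left (inv_ne_zero hs)
    have h3 := (mul_eq_zero.1 h3).resolve_left (inv_ne_zero hN)
    constructor
    · refine (mul_eq_zero.1 (?_ : (e 0 ^ 2 - f 0 ^ 2) * gm e z = 0)).resolve_left hN
      linear_combination e 0 * h3 + f 0 * h2
    · refine (mul_eq_zero.1 (?_ : (e 0 ^ 2 - f 0 ^ 2) * gm f z = 0)).resolve_left hN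
      linear_combination e 0 * h2 + f 0 * h3
  · rintro ⟨h2, h3⟩
    rw [h2, h3]; simp

/-- The rescaling of a spacelike vector to de Sitter space. -/
def normalize (z : M5) : M5 := (Real.sqrt (-gm z z))⁻¹ • z

theorem normalize_mem_dS {z : M5} (hz : gm z z < 0) : normalize z ∈ dS := by
  have h1 : Real.sqrt (-gm z z) ^ 2 = -gm z z := Real.sq_sqrt (by linarith)
  have h2 : Real.sqrt (-gm z z) ≠ 0 := (Real.sqrt_pos.2 (by linarith)).ne'
  change gm _ _ = -1
  rw [normalize, gm_smul_left, gm_smul_right]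
  field_simp
  rw [h1]
  field_simp

theorem IsFrame.mem_wedge_iff (h : IsFrame e f) (z : M5) :
    z ∈ h.wedge.1 ↔ z ∈ cone (frameN e f) (frameM e f) ∧ z ∈ dS := by
  rw [h.mem_cone_iff]; rfl

/-- The part of the ambient space over a Robertson-Walker space-time: `c` is the sine of the
embedding parameter. -/
def slab (c : ℝ) : Set M5 := {z | z 0 ^ 2 < c ^ 2 * sp z z}

theorem gm_neg_of_mem_slab {c : ℝ} (hc : c ^ 2 ≤ 1) {z : M5} (hz : z ∈ slab c) : gm z z < 0 := by
  have h1 : z 0 ^ 2 < c ^ 2 * sp z z := hz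
  have h2 := sp_self_nonneg z
  rw [gm_eq_sp]
  nlinarith

theorem le_zero_of_forall_pos {F : ℝ → ℝ} (hF : Continuous F) (h : ∀ ε > 0, F ε ≤ 0) : F 0 ≤ 0 :=
  le_of_tendsto ((hF.tendsto 0).mono_left (nhdsWithin_le_nhds (s := Set.Ioi 0)))
    (by filter_upwards [self_mem_nhdsWithin] with ε hε using h ε hε)

/-- A wedge, restricted to a slab which contains its edge, determines its normal form, and is
maximal. -/
theorem IsNormal.eq_of_subset {n₁ m₁ n₂ m₂ : M5} (h₁ : IsNormal n₁ m₁) (h₂ : IsNormal n₂ m₂)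
    {c : ℝ} (hc : 0 < c) (hm : 1 - gm m₁ m₁ ≤ c ^ 2)
    (hsub : cone n₁ m₁ ∩ slab c ⊆ cone n₂ m₂) : n₁ = n₂ ∧ m₁ = m₂ := by
  -- The test point is a vector orthogonal to `n₁` and `m₁` pushed by `ε n₁` into the first cone;
  -- `hm` puts it in the slab. As `ε → 0`, membership in the second cone forces `n₂` and `m₂ - m₁`
  -- to vanish on `ω`.
  have htest : ∀ ω : M5, ω 0 = 0 → gm n₁ ω = 0 → ∀ ε > 0,
      0 < -(gm n₂ ω + ε * gm n₂ n₁) ∧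
      (gm m₂ ω - gm m₁ ω + ε * gm m₂ n₁) ^ 2 < (gm n₂ ω + ε * gm n₂ n₁) ^ 2 * gm m₂ m₂ := by
    intro ω hω0 hω ε hε
    set z := ω + (-gm m₁ ω) • axis0 + ε • n₁ with hz
    have z0 : z 0 = -gm m₁ ω := by simp [hz, hω0, axis0, h₁.n_zero]
    have hax : ∀ v : M5, gm v axis0 = v 0 := fun v => by rw [gm_comm, gm_axis0]
    have e1 : gm n₁ z = -ε := by
      rw [hz, gm_add_right, gm_add_right, gm_smul_right, gm_smul_right, hax, h₁.n_zero, hω, h₁.gm_n]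
      ring
    have e2 : gm m₁ z = 0 := by
      rw [hz, gm_add_right, gm_add_right, gm_smul_right, gm_smul_right, hax, h₁.m_zero,
        gm_comm m₁ n₁, h₁.orth]
      ring
    have e3 : gm n₂ z = gm n₂ ω + ε * gm n₂ n₁ := by
      rw [hz, gm_add_right, gm_add_right, gm_smul_right, gm_smul_right, hax, h₂.n_zero]
      ring
    have e4 : gm m₂ z = gm m₂ ω - gm m₁ ω + ε * gm m₂ n₁ := by
      rw [hz, gm_add_right, gm_add_right, gm_smul_right, gm_smul_right, hax, h₂.m_zero]
      ring
    have hzc : z ∈ cone n₁ m₁ := by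
      refine ⟨by rw [e1]; linarith, ?_⟩
      rw [e1, e2]
      have := h₁.pos
      have : 0 < (-ε) ^ 2 * gm m₁ m₁ := by have : (-ε) ^ 2 = ε ^ 2 := by ring
                                           rw [this]; positivity
      simpa using this
    have hzs : z ∈ slab c := by
      have s1 : gm z z = gm ω z - gm m₁ ω * z 0 + ε * gm n₁ z := by
        conv_lhs => rw [hz]
        rw [gm_add_left, gm_add_left, gm_smul_left, gm_smul_left, ← hz, gm_axis0]
        ring
      have s2 : gm ω z = gm ω ω := by
        rw [hz, gm_add_right, gm_add_right, gm_smul_right, gm_smul_right, hax, hω0,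
          gm_comm ω n₁, hω]
        ring
      have s3 : sp z z = sp ω ω + ε ^ 2 := by
        have := gm_eq_sp z z
        rw [s1, s2, gm_eq_sp ω ω, hω0, e1, z0] at this
        linarith
      have s4 : gm m₁ ω = -sp m₁ ω := by rw [gm_eq_sp, hω0]; ring
      have s5 : sp m₁ m₁ = 1 - gm m₁ m₁ := by rw [gm_eq_sp, h₁.m_zero]; ring
      have s6 := sp_sq_le m₁ ω
      have s7 := sp_self_nonneg ω
      change z 0 ^ 2 < c ^ 2 * sp z z
      rw [z0, s3, s4]
      have s8 : sp m₁ m₁ * sp ω ω ≤ c ^ 2 * sp ω ω := by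
        rw [s5]; gcongr
      have s9 : 0 < c ^ 2 * ε ^ 2 := by positivity
      nlinarith
    have := hsub ⟨hzc, hzs⟩
    obtain ⟨t1, t2⟩ := this
    rw [e3] at t1
    rw [e3, e4] at t2
    exact ⟨t1, t2⟩
  have hn : ∀ ω : M5, ω 0 = 0 → gm n₁ ω = 0 → gm n₂ ω ≤ 0 := by
    intro ω hω0 hω
    have := le_zero_of_forall_pos (F := fun ε => gm n₂ ω + ε * gm n₂ n₁) (by fun_prop)
      (fun ε hε => by have := (htest ω hω0 hω ε hε).1; linarith)
    simpa using this
  have hn0 : ∀ ω : M5, ω 0 = 0 → gm n₁ ω = 0 → gm n₂ ω = 0 := by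
    intro ω hω0 hω
    have h1 := hn ω hω0 hω
    have h2 := hn (-ω) (by simp [hω0]) (by rw [gm_neg_right, hω, neg_zero])
    rw [gm_neg_right] at h2
    linarith
  have hm0 : ∀ ω : M5, ω 0 = 0 → gm n₁ ω = 0 → gm (m₂ - m₁) ω = 0 := by
    intro ω hω0 hω
    have := le_zero_of_forall_pos
      (F := fun ε => (gm m₂ ω - gm m₁ ω + ε * gm m₂ n₁) ^ 2 -
        (gm n₂ ω + ε * gm n₂ n₁) ^ 2 * gm m₂ m₂) (by fun_prop)
      (fun ε hε => by have := (htest ω hω0 hω ε hε).2; linarith)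
    simp only [zero_mul, add_zero, hn0 ω hω0 hω] at this
    rw [gm_sub_left]
    nlinarith
  -- The choice `ω = 0`, `ε = 1` excludes the opposite normal `n₂ = -n₁`.
  have hsign : gm n₁ n₂ < 0 := by
    have := (htest 0 rfl (by simp [gm_apply]) 1 one_pos).1
    have e0 : gm n₂ 0 = 0 := by simp [gm_apply]
    rw [e0] at this
    rw [gm_comm]
    linarith
  have hnn : n₁ = n₂ := by
    have h1 : gm n₁ (n₂ + gm n₁ n₂ • n₁) = 0 := by
      rw [gm_add_right, gm_smul_right, h₁.gm_n]; ring
    have h0 : (n₂ + gm n₁ n₂ • n₁) 0 = 0 := by simp [h₁.n_zero, h₂.n_zero]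
    have h2 := hn0 _ h0 h1
    have h3 : n₂ + gm n₁ n₂ • n₁ = 0 := by
      apply eq_zero_of_sp_self h0
      have h4 := gm_eq_sp (n₂ + gm n₁ n₂ • n₁) (n₂ + gm n₁ n₂ • n₁)
      rw [gm_add_left, gm_smul_left, h1, h2, h0] at h4
      linarith
    rw [gm_add_right, gm_smul_right, h₂.gm_n, gm_comm n₂ n₁] at h2
    have h5 : gm n₁ n₂ = -1 := by nlinarith
    rw [h5, neg_one_smul, ← sub_eq_add_neg, sub_eq_zero] at h3
    exact h3.symm
  refine ⟨hnn, ?_⟩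
  have h0 : (m₂ - m₁) 0 = 0 := by simp [h₁.m_zero, h₂.m_zero]
  have h1 : gm n₁ (m₂ - m₁) = 0 := by
    rw [gm_sub_right, h₁.orth, hnn, h₂.orth, sub_zero]
  have h2 := hm0 _ h0 h1
  have h3 : m₂ - m₁ = 0 := by
    apply eq_zero_of_sp_self h0
    rw [gm_eq_sp, h0] at h2
    linarith
  exact (sub_eq_zero.1 h3).symm

/-- The slab with `c = 1` consists of all spacelike vectors, and each of them rescales to a point of
de Sitter space. -/
theorem IsFrame.normal_eq_of_subset {e' f' : M5} (h : IsFrame e f) (h' : IsFrame e' f')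
    (hsub : h.wedge.1 ⊆ h'.wedge.1) : frameN e f = frameN e' f' ∧ frameM e f = frameM e' f' := by
  refine h.isNormal.eq_of_subset h'.isNormal one_pos (by linarith [h.isNormal.pos]) ?_
  rintro z ⟨hz, hs⟩
  have h1 := gm_neg_of_mem_slab (by norm_num) hs
  have h2 : 0 < Real.sqrt (-gm z z) := Real.sqrt_pos.2 (by linarith)
  have h3 := hsub ((h.mem_wedge_iff _).2
    ⟨smul_mem_cone hz (inv_pos.2 h2), normalize_mem_dS h1⟩)
  have h4 := smul_mem_cone ((h'.mem_wedge_iff _).1 h3).1 h2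
  rwa [smul_smul, mul_inv_cancel₀ h2.ne', one_smul] at h4

theorem IsFrame.wedge_eq_of_subset {e' f' : M5} (h : IsFrame e f) (h' : IsFrame e' f')
    (hsub : h.wedge.1 ⊆ h'.wedge.1) : h.wedge = h'.wedge := by
  obtain ⟨h1, h2⟩ := h.normal_eq_of_subset h' hsub
  refine Subtype.ext (Set.ext fun z => ?_)
  rw [h.mem_wedge_iff, h'.mem_wedge_iff, h1, h2]

/-- The edge was defined through any group element that represents the wedge; all of them share one
normal form, so all give the same edge. -/
theorem IsFrame.mem_edge_iff (h : IsFrame e f) (y : M5) :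
    y ∈ h.wedge.edge ↔ gm (frameN e f) y = 0 ∧ gm (frameM e f) y = 0 ∧ y ∈ dS := by
  rw [DSWedge.mem_edge_iff]
  constructor
  · rintro ⟨e', f', h', hW, h1, h2, hd⟩
    obtain ⟨h3, h4⟩ := h.normal_eq_of_subset h' (by rw [hW])
    obtain ⟨h5, h6⟩ := (h'.gm_frame_eq_zero_iff y).2 ⟨h1, h2⟩
    rw [h3, h4]
    exact ⟨h5, h6, hd⟩
  · rintro ⟨h1, h2, hd⟩
    obtain ⟨h3, h4⟩ := (h.gm_frame_eq_zero_iff y).1 ⟨h1, h2⟩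
    exact ⟨e, f, h, rfl, h3, h4, hd⟩

end Normal

/-! ### The boosts of a wedge -/

section Flow

variable {u a : M5}

theorem isFrame_of_boost (hu : FutureTimelike u) (hua : gm u a = 0) (ha : gm a a < 0) :
    IsFrame ((Real.sqrt (gm u u))⁻¹ • u) ((Real.sqrt (-gm a a))⁻¹ • a) where
  gm_e := by
    have h1 := Real.sqrt_pos.2 hu.1
    have h2 := Real.sq_sqrt hu.1.le
    rw [gm_smul_left, gm_smul_right]
    nth_rw 3 [← h2]
    field_simp
  pos := mul_pos (inv_pos.2 (Real.sqrt_pos.2 hu.1)) hu.2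
  gm_f := normalize_mem_dS ha
  orth := by rw [gm_smul_left, gm_smul_right, hua]; ring

/-- With `p`, `q` the pairings of `y` with the unit vectors, the square of `M y` is a positive
multiple of `q ^ 2 - p ^ 2`, and its pairing with `u` is a positive multiple of `-q`. -/
theorem futureTimelike_boostMat_iff (hu : FutureTimelike u) (hua : gm u a = 0) (ha : gm a a < 0)
    (y : M5) : FutureTimelike (boostMat u a *ᵥ y) ↔
      |gm ((Real.sqrt (gm u u))⁻¹ • u) y| < -gm ((Real.sqrt (-gm a a))⁻¹ • a) y := by
  have hU := Real.sqrt_pos.2 hu.1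
  have hU2 := Real.sq_sqrt hu.1.le
  have hA := Real.sqrt_pos.2 (show 0 < -gm a a by linarith)
  have hA2 := Real.sq_sqrt (show 0 ≤ -gm a a by linarith)
  set U := Real.sqrt (gm u u)
  set A := Real.sqrt (-gm a a)
  set p := gm (U⁻¹ • u) y with hp
  set q := gm (A⁻¹ • a) y with hq
  have hp' : gm u y = U * p := by rw [hp, gm_smul_left]; field_simp
  have hq' : gm a y = A * q := by rw [hq, gm_smul_left]; field_simp
  have e1 : gm (boostMat u a *ᵥ y) (boostMat u a *ᵥ y) = (U * A) ^ 2 * (q ^ 2 - p ^ 2) := by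
    rw [boostMat_mulVec]
    simp only [gm_sub_left, gm_sub_right, gm_smul_left, gm_smul_right, gm_comm a u, hua, hp', hq']
    linear_combination (-(A * q) ^ 2) * hU2 + (U * p) ^ 2 * hA2
  have e2 : gm u (boostMat u a *ᵥ y) = -q * (A * gm u u) := by
    rw [boostMat_mulVec, gm_sub_right, gm_smul_right, gm_smul_right, hua, hq']
    ring
  have e3 : 0 < gm (boostMat u a *ᵥ y) (boostMat u a *ᵥ y) ↔ p ^ 2 < q ^ 2 := by
    rw [e1, mul_pos_iff_of_pos_left (by positivity), sub_pos]
  have e4 : 0 < gm u (boostMat u a *ᵥ y) ↔ 0 < -q := by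
    rw [e2, mul_pos_iff_of_pos_right (mul_pos hA hu.1)]
  constructor
  · intro h
    have h1 := e3.1 h.1
    have h2 := e4.1 (gm_pos_of_future hu h)
    rw [sq_lt_sq] at h1
    rwa [abs_of_neg (show q < 0 by linarith)] at h1
  · intro h
    have h1 : 0 < -q := (abs_nonneg p).trans_lt h
    have h2 : p ^ 2 < q ^ 2 := by
      rw [sq_lt_sq]
      exact h.trans_le (neg_le_abs q)
    exact (futureTimelike_iff hu (e3.2 h2)).2 (e4.2 h1)

/-- The wedge is the set of `y` in de Sitter space with `M y` future timelike. It is invariant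
because `exp (t M)` commutes with `M` and preserves future timelike vectors. -/
theorem inducesFutureFlow_boost (hu : FutureTimelike u) (hua : gm u a = 0) (ha : gm a a < 0) :
    InducesFutureFlow (boostMat u a) (boostMat_skew u a) (isFrame_of_boost hu hua ha).wedge := by
  have hmem : ∀ y, y ∈ (isFrame_of_boost hu hua ha).wedge.1 ↔
      FutureTimelike (boostMat u a *ᵥ y) ∧ y ∈ dS := by
    intro y
    rw [futureTimelike_boostMat_iff hu hua ha]
    rfl
  set M := boostMat u a
  have hsub : ∀ t y, y ∈ (isFrame_of_boost hu hua ha).wedge.1 →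
      act (oneParam M (boostMat_skew u a) t) y ∈ (isFrame_of_boost hu hua ha).wedge.1 := by
    intro t y hy
    rw [hmem] at hy ⊢
    refine ⟨?_, (act_mem_dS _ _).2 hy.2⟩
    have hcomm : M * NormedSpace.exp (t • M) = NormedSpace.exp (t • M) * M :=
      (((Commute.refl M).smul_right t).exp_right).eq
    have e1 : M *ᵥ act (oneParam M (boostMat_skew u a) t) y =
        act (oneParam M (boostMat_skew u a) t) (M *ᵥ y) := by
      simp only [act, oneParam, Matrix.mulVec_mulVec, hcomm]
    rw [e1]
    exact (oneParam M (boostMat_skew u a) t).2.2 _ hy.1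
  refine ⟨fun t => Set.Subset.antisymm ?_ fun y hy => ?_, fun y hy => ((hmem y).1 hy).1⟩
  · rintro _ ⟨y, hy, rfl⟩
    exact hsub t y hy
  · refine ⟨act (oneParam M (boostMat_skew u a) (-t)) y, hsub (-t) y hy, ?_⟩
    rw [← act_mul, ← oneParam_add, add_neg_cancel, oneParam_zero]
    simp [act]

/-- A wedge with future timelike flow lies inside the set where `M y` is future timelike, which is
itself a wedge; wedges are maximal. -/
theorem eq_wedge_of_inducesFutureFlow (hu : FutureTimelike u) (hua : gm u a = 0) (ha : gm a a < 0)
    {W : DSWedge} (hW : InducesFutureFlow (boostMat u a) (boostMat_skew u a) W) :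
    W = (isFrame_of_boost hu hua ha).wedge := by
  obtain ⟨e, f, h, rfl⟩ := W.exists_frame
  refine h.wedge_eq_of_subset _ fun y hy => ⟨?_, hy.2⟩
  exact (futureTimelike_boostMat_iff hu hua ha y).1 (hW.2 y hy)

end Flow

/-! ### Robertson-Walker wedges -/

section RobertsonWalker

variable {α : ℝ} {n m : M5}

theorem sin_pos_of_param (h0 : 0 < α) (hα : α ≤ Real.pi / 2) : 0 < Real.sin α :=
  Real.sin_pos_of_pos_of_lt_pi h0 (by linarith [Real.pi_pos])

theorem sp_self_of_mem_dS {x : M5} (hx : x ∈ dS) : sp x x = 1 + x 0 ^ 2 := by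
  have h : gm x x = -1 := hx
  rw [gm_eq_sp] at h
  linarith

/-- On de Sitter space `sin τ` is `x 0` divided by the spatial length, so `|τ| < α` becomes a
homogeneous condition that can be tested before normalization. -/
theorem mem_RW_iff (h0 : 0 < α) (hα : α ≤ Real.pi / 2) (x : M5) :
    x ∈ RW α ↔ x ∈ dS ∧ x ∈ slab (Real.sin α) := by
  refine and_congr_right fun hx => ?_
  have hs := sin_pos_of_param h0 hα
  have h1 : |tau x| < α ↔ |Real.sin (tau x)| < Real.sin α := by
    have h2 := Real.arctan_lt_pi_div_two (x 0)
    have h3 := Real.neg_pi_div_two_lt_arctan (x 0)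
    have e1 : ∀ {a b : ℝ}, -(Real.pi / 2) ≤ a → a ≤ Real.pi / 2 → -(Real.pi / 2) ≤ b →
        b ≤ Real.pi / 2 → (Real.sin a < Real.sin b ↔ a < b) := fun p q r s =>
      Real.strictMonoOn_sin.lt_iff_lt ⟨p, q⟩ ⟨r, s⟩
    change |Real.arctan (x 0)| < α ↔ |Real.sin (Real.arctan (x 0))| < Real.sin α
    rw [abs_lt, abs_lt, ← Real.sin_neg, e1 (by linarith) (by linarith) h3.le h2.le,
      e1 h3.le h2.le (by linarith) hα]
  have h2 : (0 : ℝ) < 1 + x 0 ^ 2 := by positivity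
  have h3 := Real.sq_sqrt h2.le
  rw [h1, ← abs_of_pos hs, ← sq_lt_sq, abs_of_pos hs, tau, Real.sin_arctan, div_pow, h3,
    div_lt_iff₀ h2, ← sp_self_of_mem_dS hx]
  rfl

theorem smul_mem_slab {c k : ℝ} (hk : k ≠ 0) {z : M5} (hz : z ∈ slab c) : k • z ∈ slab c := by
  have h1 : z 0 ^ 2 < c ^ 2 * sp z z := hz
  have h2 : sp (k • z) (k • z) = k ^ 2 * sp z z := by
    simp only [sp, Pi.smul_apply, smul_eq_mul]; ring
  change (k • z) 0 ^ 2 < _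
  rw [h2, Pi.smul_apply, smul_eq_mul]
  have : 0 < k ^ 2 := by positivity
  nlinarith

theorem normalize_smul {k : ℝ} (hk : 0 < k) (z : M5) : normalize (k • z) = normalize z := by
  have h1 : -gm (k • z) (k • z) = k ^ 2 * -gm z z := by
    rw [gm_smul_left, gm_smul_right]; ring
  rw [normalize, normalize, h1, Real.sqrt_mul (by positivity), Real.sqrt_sq hk.le, mul_inv,
    smul_smul]
  congr 1
  field_simp

theorem normalize_of_mem_dS {z : M5} (hz : z ∈ dS) : normalize z = z := by
  have h : gm z z = -1 := hz
  rw [normalize, h]; simp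

theorem normalize_mem_RW (h0 : 0 < α) (hα : α ≤ Real.pi / 2) {z : M5}
    (hz : z ∈ slab (Real.sin α)) : normalize z ∈ RW α := by
  have h1 := gm_neg_of_mem_slab (Real.sin_sq_le_one α) hz
  rw [mem_RW_iff h0 hα]
  exact ⟨normalize_mem_dS h1,
    smul_mem_slab (inv_ne_zero (Real.sqrt_pos.2 (by linarith)).ne') hz⟩

theorem normalize_mem_cone {z : M5} (h1 : gm z z < 0) (hz : z ∈ cone n m) :
    normalize z ∈ cone n m :=
  smul_mem_cone hz (inv_pos.2 (Real.sqrt_pos.2 (by linarith)))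

theorem mem_cone_of_normalize {z : M5} (h1 : gm z z < 0) (hz : normalize z ∈ cone n m) :
    z ∈ cone n m := by
  have h2 : 0 < Real.sqrt (-gm z z) := Real.sqrt_pos.2 (by linarith)
  have h4 := smul_mem_cone hz h2
  rwa [normalize, smul_smul, mul_inv_cancel₀ h2.ne', one_smul] at h4

/-- Replace the time component. -/
def withTime (t : ℝ) (x : M5) : M5 := fun i => if i = 0 then t else x i

theorem gm_withTime (t : ℝ) (x y : M5) : gm y (withTime t x) = y 0 * t - sp y x := by
  simp [gm_eq_sp, sp, withTime]

theorem sp_withTime (t : ℝ) (x y : M5) : sp y (withTime t x) = sp y x := by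
  simp [sp, withTime]

/-- `Φ` multiplies `sin τ`, the ratio of time to spatial length, by `sin α` and keeps the direction.
Up to scale this is the linear map that multiplies the time coordinate by `sin α`. -/
theorem Phi_eq_normalize {y : M5} (hy : y ∈ dS) :
    Phi α y = normalize (withTime (Real.sin α * y 0) y) := by
  have hr : (0 : ℝ) < 1 + y 0 ^ 2 := by positivity
  have hr1 := Real.sqrt_pos.2 hr
  have hr2 := Real.sq_sqrt hr.le
  set r := Real.sqrt (1 + y 0 ^ 2) with hrdef
  set s := Real.sin α with hs
  have hs1 : s ^ 2 ≤ 1 := Real.sin_sq_le_one α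
  have hsin : Real.sin (tau y) = y 0 / r := Real.sin_arctan _
  have hcos : Real.cos (tau y) = 1 / r := Real.cos_arctan _
  have hlt : (s * (y 0 / r)) ^ 2 < 1 := by
    rw [mul_pow, div_pow, hr2, ← mul_div_assoc, div_lt_one hr]
    nlinarith [sq_nonneg (y 0)]
  have habs := (sq_lt_one_iff_abs_lt_one _).1 hlt
  rw [abs_lt] at habs
  have hfs : Real.sin (fTime α (tau y)) = s * (y 0 / r) := by
    rw [fTime, hsin, ← hs, Real.sin_arcsin habs.1.le habs.2.le]
  have hfc : Real.cos (fTime α (tau y)) = Real.sqrt (1 - (s * (y 0 / r)) ^ 2) := by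
    rw [fTime, hsin, ← hs, Real.cos_arcsin]
  set D := Real.sqrt (1 - (s * (y 0 / r)) ^ 2) with hD
  have hD0 : 0 < D := Real.sqrt_pos.2 (by linarith)
  have hnorm : Real.sqrt (-gm (withTime (s * y 0) y) (withTime (s * y 0) y)) = D * r := by
    rw [hD, hrdef, ← Real.sqrt_mul (by linarith), ← hrdef]
    congr 1
    rw [gm_withTime]
    have e1 : sp (withTime (s * y 0) y) y = 1 + y 0 ^ 2 := by
      rw [← sp_self_of_mem_dS hy]; simp [sp, withTime]
    have e2 : withTime (s * y 0) y 0 = s * y 0 := by simp [withTime]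
    rw [e1, e2, ← hr2]
    field_simp
    ring
  funext i
  rw [normalize, hnorm]
  by_cases hi : i = 0
  · simp only [Phi, hi, if_true, Pi.smul_apply, withTime, smul_eq_mul]
    rw [Real.tan_eq_sin_div_cos, hfs, hfc]
    field_simp
  · simp only [Phi, hi, if_false, Pi.smul_apply, withTime, smul_eq_mul]
    rw [hcos, hfc]
    field_simp

/-- The normal vector `m` of a wedge with the velocity rescaled by `c`. -/
def scaleVel (c : ℝ) (m : M5) : M5 := fun i => if i = 0 then m 0 else c * m i

theorem gm_scaleVel (c : ℝ) (m y : M5) : gm (scaleVel c m) y = m 0 * y 0 - c * sp m y := by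
  simp [gm_eq_sp, sp, scaleVel]; ring

theorem sp_scaleVel (c : ℝ) (m y : M5) : sp y (scaleVel c m) = c * sp m y := by
  simp [sp, scaleVel]; ring

theorem IsNormal.sp_m (h : IsNormal n m) : sp m m = 1 - gm m m := by
  rw [gm_eq_sp, h.m_zero]; ring

theorem IsNormal.gm_scaleVel_self (h : IsNormal n m) (c : ℝ) :
    gm (scaleVel c m) (scaleVel c m) = 1 - c ^ 2 * (1 - gm m m) := by
  rw [gm_scaleVel, sp_scaleVel, h.sp_m]
  simp [scaleVel, h.m_zero]
  ring

theorem IsNormal.scaleVel (h : IsNormal n m) {c : ℝ} (hc : c ^ 2 ≤ 1) :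
    IsNormal n (scaleVel c m) where
  n_zero := h.n_zero
  gm_n := h.gm_n
  m_zero := by simp [DSRW.scaleVel, h.m_zero]
  orth := by
    have h1 := h.orth
    rw [gm_eq_sp, h.n_zero] at h1
    rw [gm_comm, gm_scaleVel, h.n_zero]
    have : sp m n = sp n m := by unfold sp; ring
    rw [this]
    have h2 : sp n m = 0 := by linarith
    rw [h2]; ring
  pos := by
    rw [h.gm_scaleVel_self]
    have h1 := h.sp_m
    have h2 := sp_self_nonneg m
    have h3 := h.pos
    nlinarith

theorem scaleVel_injective {c : ℝ} (hc : c ≠ 0) {m m' : M5} (h : scaleVel c m = scaleVel c m') :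
    m = m' := by
  funext i
  have h1 := congrFun h i
  by_cases hi : i = 0
  · simpa [scaleVel, hi] using h1
  · simpa [scaleVel, hi, hc] using h1

theorem scaleVel_one (m : M5) : scaleVel 1 m = m := by
  funext i
  by_cases hi : i = 0 <;> simp [scaleVel, hi]

/-- The edge of a wedge in normal form. -/
def edgeSet (n m : M5) : Set M5 := {y | gm n y = 0 ∧ gm m y = 0 ∧ y ∈ dS}

/-- The image of the edge of a wedge under `Φ` is the edge of the wedge with rescaled velocity. -/
theorem IsNormal.Phi_image_edge (h : IsNormal n m) (h0 : 0 < α) (hα : α ≤ Real.pi / 2) :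
    Phi α '' edgeSet n m = edgeSet n (DSRW.scaleVel (Real.sin α) m) := by
  set s := Real.sin α with hs
  have hs1 : s ^ 2 ≤ 1 := Real.sin_sq_le_one α
  have hs0 : 0 < s := sin_pos_of_param h0 hα
  ext x
  constructor
  · rintro ⟨y, ⟨h1, h2, hd⟩, rfl⟩
    rw [Phi_eq_normalize hd]
    rw [gm_eq_sp, h.n_zero] at h1
    rw [gm_eq_sp, h.m_zero] at h2
    have e1 : gm (withTime (s * y 0) y) (withTime (s * y 0) y) < 0 := by
      have e2 : sp (withTime (s * y 0) y) y = 1 + y 0 ^ 2 := by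
        rw [← sp_self_of_mem_dS hd]; simp [sp, withTime]
      have e3 : withTime (s * y 0) y 0 = s * y 0 := by simp [withTime]
      rw [gm_withTime, e2, e3]
      nlinarith [sq_nonneg (y 0)]
    refine ⟨?_, ?_, normalize_mem_dS e1⟩
    · rw [normalize, gm_smul_right, gm_withTime _ _ n, h.n_zero]
      have : sp n y = 0 := by linarith
      rw [this]; ring
    · rw [normalize, gm_smul_right, gm_scaleVel, sp_withTime, h.m_zero]
      have : sp m y = y 0 := by linarith
      rw [this, ← hs]; simp [withTime]
  · rintro ⟨h1, h2, hd⟩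
    rw [gm_scaleVel, h.m_zero] at h2
    rw [gm_eq_sp, h.n_zero] at h1
    -- The preimage has time coordinate `x 0 / s`, which the edge equation rewrites as `sp m x`; in
    -- this form it is spacelike because `sp m m < 1`.
    set z := withTime (sp m x) x with hz
    have hz0 : z 0 = sp m x := by simp [hz, withTime]
    have hzz : gm z z < 0 := by
      have e1 : sp z x = sp x x := by simp [sp, hz, withTime]
      have e2 := sp_sq_le m x
      have e3 := h.sp_m
      have e4 := h.pos
      have e5 := sp_self_of_mem_dS hd
      conv_lhs => rw [hz]
      rw [gm_withTime, ← hz, hz0, e1]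
      nlinarith [sq_nonneg (x 0)]
    have hk : 0 < (Real.sqrt (-gm z z))⁻¹ := inv_pos.2 (Real.sqrt_pos.2 (by linarith))
    refine ⟨normalize z, ⟨?_, ?_, normalize_mem_dS hzz⟩, ?_⟩
    · rw [normalize, gm_smul_right]
      conv_lhs => rw [hz, gm_withTime _ _ n, h.n_zero]
      have : sp n x = 0 := by linarith
      rw [this]; ring
    · have : gm m z = 0 := by rw [hz, gm_withTime, h.m_zero]; ring
      rw [normalize, gm_smul_right, this, mul_zero]
    · rw [Phi_eq_normalize (normalize_mem_dS hzz)]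
      have e1 : withTime (Real.sin α * normalize z 0) (normalize z) =
          (Real.sqrt (-gm z z))⁻¹ • x := by
        funext i
        by_cases hi : i = 0
        · simp only [withTime, normalize, hi, if_true, Pi.smul_apply, smul_eq_mul, hz0]
          rw [← hs]
          have : x 0 = s * sp m x := by linarith
          rw [this]; ring
        · simp [withTime, normalize, hi, hz]
      rw [e1, normalize_smul hk, normalize_of_mem_dS hd]

/-- The causal complement of the edge of a wedge consists of the wedge and the opposite wedge. -/
theorem IsNormal.spacelike_edge_iff (h : IsNormal n m) {y : M5} (hy : y ∈ dS) :
    (∀ x ∈ edgeSet n m, gm (y - x) (y - x) < 0) ↔ gm m y ^ 2 < gm n y ^ 2 * gm m m := by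
  have hyy : gm y y = -1 := hy
  have hm := h.pos
  -- This is the projection of `y` to the subspace that contains the edge. For `x` in the edge, `y -
  -- x` is spacelike exactly when `gm x y' > -1`, so everything depends on whether `gm y' y'`
  -- exceeds `-1`.
  set y' := y + gm n y • n - (gm m y / gm m m) • m with hy'
  have o1 : gm n y' = 0 := by
    rw [hy', gm_sub_right, gm_add_right, gm_smul_right, gm_smul_right, h.gm_n, h.orth]; ring
  have o2 : gm m y' = 0 := by
    rw [hy', gm_sub_right, gm_add_right, gm_smul_right, gm_smul_right, gm_comm m n, h.orth]
    field_simp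
    ring
  have o3 : gm y' y' = -1 + (gm n y ^ 2 * gm m m - gm m y ^ 2) / gm m m := by
    have e1 : gm y' y' = gm y y' := by
      conv_lhs => rw [hy']
      rw [gm_sub_left, gm_add_left, gm_smul_left, gm_smul_left, ← hy', o1, o2]; ring
    rw [e1, hy', gm_sub_right, gm_add_right, gm_smul_right, gm_smul_right, hyy, gm_comm y n,
      gm_comm y m]
    field_simp
    ring
  have o4 : ∀ x ∈ edgeSet n m, gm x y = gm x y' := by
    rintro x ⟨h1, h2, -⟩
    rw [hy', gm_sub_right, gm_add_right, gm_smul_right, gm_smul_right, gm_comm x n, gm_comm x m,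
      h1, h2]
    ring
  have o5 : ∀ x ∈ edgeSet n m, (gm (y - x) (y - x) < 0 ↔ -1 < gm x y) := by
    rintro x ⟨-, -, h3⟩
    have h3 : gm x x = -1 := h3
    rw [gm_sub_left, gm_sub_right, gm_sub_right, hyy, h3, gm_comm y x]
    constructor <;> intro h4 <;> linarith
  constructor
  · intro hall
    by_contra hcon
    push Not at hcon
    have h1 : (gm n y ^ 2 * gm m m - gm m y ^ 2) / gm m m ≤ 0 :=
      div_nonpos_of_nonpos_of_nonneg (by linarith) hm.le
    have h2 : gm y' y' ≤ -1 := by linarith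
    have h3 : gm y' y' < 0 := by linarith
    -- This edge point violates the inequality: its pairing with `y'` is `-√(-gm y' y') ≤ -1`.
    have hx : normalize y' ∈ edgeSet n m := by
      refine ⟨?_, ?_, normalize_mem_dS h3⟩
      · rw [normalize, gm_smul_right, o1, mul_zero]
      · rw [normalize, gm_smul_right, o2, mul_zero]
    have h4 := (o5 _ hx).1 (hall _ hx)
    rw [o4 _ hx, normalize, gm_smul_left] at h4
    have h5 : 1 ≤ Real.sqrt (-gm y' y') := Real.one_le_sqrt.2 (by linarith)
    have h6 := Real.sq_sqrt (show 0 ≤ -gm y' y' by linarith)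
    have h7 : (Real.sqrt (-gm y' y'))⁻¹ * gm y' y' = -Real.sqrt (-gm y' y') := by
      have : Real.sqrt (-gm y' y') ≠ 0 := by linarith
      field_simp
      linarith
    rw [h7] at h4
    linarith
  · intro hlt x hx
    rw [o5 x hx, o4 x hx]
    obtain ⟨h1, h2, h3⟩ := hx
    have h3 : gm x x = -1 := h3
    have h4 := gm_sq_le_of_orthogonal hm h2 o2 (by rw [h3]; norm_num)
    have h5 : 0 < (gm n y ^ 2 * gm m m - gm m y ^ 2) / gm m m := div_pos (by linarith) hm
    have h6 : gm x y' ^ 2 < 1 := by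
      rw [h3, o3] at h4
      linarith
    exact (abs_lt.1 ((sq_lt_one_iff_abs_lt_one _).1 h6)).1

theorem IsNormal.mem_cone_RW (h : IsNormal n m) (h0 : 0 < α) (hα : α ≤ Real.pi / 2) :
    n ∈ cone n m ∩ RW α := by
  have hs0 : 0 < Real.sin α := sin_pos_of_param h0 hα
  refine ⟨⟨by rw [h.gm_n]; norm_num, ?_⟩, (mem_RW_iff h0 hα n).2 ⟨h.gm_n, ?_⟩⟩
  · rw [gm_comm m n, h.orth, h.gm_n]
    have := h.pos
    linarith
  · change n 0 ^ 2 < _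
    have := sp_self_of_mem_dS (show n ∈ dS from h.gm_n)
    rw [this, h.n_zero]
    have : 0 < Real.sin α ^ 2 := by positivity
    linarith

theorem continuous_gm {X : Type*} [TopologicalSpace X] {f g : X → M5} (hf : Continuous f)
    (hg : Continuous g) : Continuous fun x => gm (f x) (g x) := by
  simp only [gm_apply]
  fun_prop

theorem continuousOn_normalize : ContinuousOn normalize {z | gm z z < 0} := by
  unfold normalize
  refine ContinuousOn.smul (f := fun z : M5 => (Real.sqrt (-gm z z))⁻¹)
    (ContinuousOn.inv₀ ?_ ?_) continuousOn_id
  · exact (Real.continuous_sqrt.comp (continuous_gm continuous_id continuous_id).neg).continuousOn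
  · intro z hz
    exact (Real.sqrt_pos.2 (by have : gm z z < 0 := hz; linarith)).ne'

/-- Cone and slab are invariant under positive scaling, so the straight segment from `y` to `n` can
be checked in the ambient space and then normalized to a path in de Sitter space. -/
theorem IsNormal.isPreconnected_cone_RW (h : IsNormal n m) (h0 : 0 < α) (hα : α ≤ Real.pi / 2) :
    IsPreconnected (cone n m ∩ RW α) := by
  have hs0 : 0 < Real.sin α := sin_pos_of_param h0 hα
  refine isPreconnected_of_forall n fun y hy => ?_
  obtain ⟨hyc, hyR⟩ := hy
  obtain ⟨hyd, hys⟩ := (mem_RW_iff h0 hα y).1 hyR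
  have hseg : ∀ z ∈ segment ℝ y n, z ∈ cone n m ∧ z ∈ slab (Real.sin α) := by
    rintro z ⟨a, b, ha, hb, hab, rfl⟩
    have h1 : 0 < -gm n y := hyc.1
    have h2 : gm m y ^ 2 < gm n y ^ 2 * gm m m := hyc.2
    have h3 : y 0 ^ 2 < Real.sin α ^ 2 * sp y y := hys
    have hm := h.pos
    have e1 : gm n (a • y + b • n) = a * gm n y - b := by
      rw [gm_add_right, gm_smul_right, gm_smul_right, h.gm_n]; ring
    have e2 : gm m (a • y + b • n) = a * gm m y := by
      rw [gm_add_right, gm_smul_right, gm_smul_right, gm_comm m n, h.orth]; ring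
    have e3 : sp (a • y + b • n) (a • y + b • n) =
        a ^ 2 * sp y y + 2 * a * b * (-gm n y) + b ^ 2 := by
      have e4 : sp n n = 1 := by rw [sp_self_of_mem_dS h.gm_n, h.n_zero]; ring
      have e5 : -gm n y = sp n y := by rw [gm_eq_sp, h.n_zero]; ring
      have e6 : b ^ 2 = b ^ 2 * sp n n := by rw [e4, mul_one]
      rw [e5, e6]
      simp only [sp, Pi.add_apply, Pi.smul_apply, smul_eq_mul]
      ring
    have e4 : (a • y + b • n) 0 = a * y 0 := by simp [h.n_zero]
    have hab' : 0 ≤ a * b * (-gm n y) := mul_nonneg (mul_nonneg ha hb) h1.le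
    have hs2 : 0 < Real.sin α ^ 2 := by positivity
    -- For `a > 0` strictness comes from `a ^ 2` times the inequalities at `y`; at `a = 0` only the
    -- endpoint `n` is left.
    rcases ha.eq_or_lt with ha0 | ha0
    · have hb1 : b = 1 := by linarith
      subst hb1
      refine ⟨⟨by rw [e1, ← ha0]; norm_num, ?_⟩, ?_⟩
      · rw [e1, e2, ← ha0]; linarith
      · change (a • y + (1 : ℝ) • n) 0 ^ 2 <
          Real.sin α ^ 2 * sp (a • y + (1 : ℝ) • n) (a • y + (1 : ℝ) • n)
        rw [e3, e4, ← ha0]; linarith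
    · have ha2 : 0 < a ^ 2 := by positivity
      refine ⟨⟨by rw [e1]; nlinarith, ?_⟩, ?_⟩
      · rw [e1, e2]
        have e5 : (a * gm n y) ^ 2 ≤ (a * gm n y - b) ^ 2 := by nlinarith
        calc (a * gm m y) ^ 2 = a ^ 2 * gm m y ^ 2 := by ring
          _ < a ^ 2 * (gm n y ^ 2 * gm m m) := by gcongr
          _ = (a * gm n y) ^ 2 * gm m m := by ring
          _ ≤ (a * gm n y - b) ^ 2 * gm m m := by gcongr
      · change (a • y + b • n) 0 ^ 2 < Real.sin α ^ 2 * sp (a • y + b • n) (a • y + b • n)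
        rw [e3, e4]
        calc (a * y 0) ^ 2 = a ^ 2 * y 0 ^ 2 := by ring
          _ < a ^ 2 * (Real.sin α ^ 2 * sp y y) := by gcongr
          _ = Real.sin α ^ 2 * (a ^ 2 * sp y y) := by ring
          _ ≤ Real.sin α ^ 2 * (a ^ 2 * sp y y + 2 * a * b * (-gm n y) + b ^ 2) := by
              gcongr
              nlinarith [sq_nonneg b]
  have hneg : ∀ z ∈ segment ℝ y n, gm z z < 0 := fun z hz =>
    gm_neg_of_mem_slab (Real.sin_sq_le_one α) (hseg z hz).2
  refine ⟨normalize '' segment ℝ y n, ?_, ⟨n, right_mem_segment ℝ y n, normalize_of_mem_dS h.gm_n⟩,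
    ⟨y, left_mem_segment ℝ y n, normalize_of_mem_dS hyd⟩, ?_⟩
  · rintro _ ⟨z, hz, rfl⟩
    exact ⟨normalize_mem_cone (hneg z hz) (hseg z hz).1, normalize_mem_RW h0 hα (hseg z hz).2⟩
  · exact (convex_segment y n).isPreconnected.image _ (continuousOn_normalize.mono hneg)

/-- A Robertson-Walker wedge is the intersection of the Robertson-Walker space-time with a de Sitter
wedge with rescaled velocity. -/
theorem IsFrame.Xi_wedge {e f : M5} (h : IsFrame e f) (h0 : 0 < α) (hα : α ≤ Real.pi / 2) :
    Xi α h.wedge = cone (frameN e f) (scaleVel (Real.sin α) (frameM e f)) ∩ RW α := by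
  have hN := h.isNormal
  have hN' := hN.scaleVel (Real.sin_sq_le_one α)
  have hedge : h.wedge.edge = edgeSet (frameN e f) (frameM e f) := Set.ext h.mem_edge_iff
  have hC : ∀ y, y ∈ causalCompl α (Phi α '' h.wedge.edge) ↔ y ∈ RW α ∧
      gm (scaleVel (Real.sin α) (frameM e f)) y ^ 2 < gm (frameN e f) y ^ 2 *
        gm (scaleVel (Real.sin α) (frameM e f)) (scaleVel (Real.sin α) (frameM e f)) := by
    intro y
    rw [hedge, hN.Phi_image_edge h0 hα]
    exact and_congr_right fun hy => hN'.spacelike_edge_iff hy.1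
  have hsub : cone (frameN e f) (scaleVel (Real.sin α) (frameM e f)) ∩ RW α ⊆
      causalCompl α (Phi α '' h.wedge.edge) := fun y hy => (hC y).2 ⟨hy.2, hy.1.2⟩
  ext y
  constructor
  · rintro ⟨z, ⟨hzW, hzC⟩, hy⟩
    have hyC := (hC y).1 (connectedComponentIn_subset _ _ hy)
    refine ⟨⟨?_, hyC.2⟩, hyC.1⟩
    -- A component reaching the opposite wedge would meet `gm n w = 0`, where the strict inequality
    -- of the causal complement makes a square negative.
    by_contra hcon
    have hz1 : 0 < -gm (frameN e f) z := ((h.mem_wedge_iff z).1 hzW).1.1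
    have hpre := (isPreconnected_connectedComponentIn (x := z)
      (F := causalCompl α (Phi α '' h.wedge.edge))).image (fun y => gm (frameN e f) y)
      (continuous_gm continuous_const continuous_id).continuousOn
    have hord := hpre.ordConnected
    obtain ⟨w, hw, hw0⟩ := hord.out ⟨z, mem_connectedComponentIn hzC, rfl⟩ ⟨y, hy, rfl⟩
      (show (0 : ℝ) ∈ Set.Icc (gm (frameN e f) z) (gm (frameN e f) y) from
        ⟨by linarith, by linarith⟩)
    have hwC := ((hC w).1 (connectedComponentIn_subset _ _ hw)).2
    simp only at hw0
    rw [hw0] at hwC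
    nlinarith [sq_nonneg (gm (scaleVel (Real.sin α) (frameM e f)) w)]
  · intro hy
    have hn := hN'.mem_cone_RW h0 hα
    have hn' := hN.mem_cone_RW h0 hα
    exact ⟨frameN e f, ⟨(h.mem_wedge_iff _).2 ⟨hn'.1, hn'.2.1⟩, hsub hn⟩,
      (hN'.isPreconnected_cone_RW h0 hα).subset_connectedComponentIn hn hsub hy⟩

/-- After rescaling the spatial part of `m` has length at most `sin α`, so the new edge still fits
in the slab and `IsNormal.eq_of_subset` applies; the rescaling is invertible as `sin α ≠ 0`. -/
theorem Xi_injective (h0 : 0 < α) (hα : α ≤ Real.pi / 2) : Function.Injective (Xi α) := by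
  intro W W' hWW
  obtain ⟨e, f, h, rfl⟩ := W.exists_frame
  obtain ⟨e', f', h', rfl⟩ := W'.exists_frame
  have hs0 : 0 < Real.sin α := sin_pos_of_param h0 hα
  have hs1 := Real.sin_sq_le_one α
  rw [h.Xi_wedge h0 hα, h'.Xi_wedge h0 hα] at hWW
  obtain ⟨h1, h2⟩ := (h.isNormal.scaleVel hs1).eq_of_subset (h'.isNormal.scaleVel hs1) hs0 (by
    rw [h.isNormal.gm_scaleVel_self]
    nlinarith [h.isNormal.pos, sq_nonneg (Real.sin α)]) (by
    rintro z ⟨hz, hzs⟩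
    have h3 := gm_neg_of_mem_slab hs1 hzs
    refine mem_cone_of_normalize h3 ?_
    have h4 : normalize z ∈ cone (frameN e f) (scaleVel (Real.sin α) (frameM e f)) ∩ RW α :=
      ⟨normalize_mem_cone h3 hz, normalize_mem_RW h0 hα hzs⟩
    rw [hWW] at h4
    exact h4.1)
  have h3 := scaleVel_injective hs0.ne' h2
  refine Subtype.ext (Set.ext fun z => ?_)
  rw [h.mem_wedge_iff, h'.mem_wedge_iff, h1, h3]

/-- `rwNet` picks some preimage under `Ξ`; injectivity shows that it is `W`. -/
theorem DSTheory.rwNet_Xi {H : Type*} [NormedAddCommGroup H] [InnerProductSpace ℂ H]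
    [CompleteSpace H] (T : DSTheory H) (h0 : 0 < α) (hα : α ≤ Real.pi / 2) (W : DSWedge) :
    T.rwNet α ⟨Xi α W, W, rfl⟩ = T.R W := by
  refine congrArg T.R ?_
  exact Xi_injective h0 hα (Set.apply_rangeSplitting (Xi α) ⟨Xi α W, W, rfl⟩)

end RobertsonWalker

/-! ### Kinematics of worldlines -/

section Worldline

theorem HasDerivAt.gm {f g : ℝ → M5} {f' g' : M5} {t : ℝ} (hf : HasDerivAt f f' t)
    (hg : HasDerivAt g g' t) :
    HasDerivAt (fun s => gm (f s) (g s)) (gm f' (g t) + gm (f t) g') t := by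
  have hf := hasDerivAt_pi.1 hf
  have hg := hasDerivAt_pi.1 hg
  simp only [gm_apply]
  have h : ∀ i, HasDerivAt (fun s => f s i * g s i) (f' i * g t i + f t i * g' i) t :=
    fun i => (hf i).mul (hg i)
  exact (((((h 0).sub (h 1)).sub (h 2)).sub (h 3)).sub (h 4)).congr_deriv (by ring)

theorem ContDiff.gm {k : WithTop ℕ∞} {f g : ℝ → M5} (hf : ContDiff ℝ k f) (hg : ContDiff ℝ k g) :
    ContDiff ℝ k fun s => gm (f s) (g s) := by
  have hf := contDiff_pi.1 hf
  have hg := contDiff_pi.1 hg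
  simp only [gm_apply]
  have h : ∀ i, ContDiff ℝ k fun s => f s i * g s i := fun i => (hf i).mul (hg i)
  exact ((((h 0).sub (h 1)).sub (h 2)).sub (h 3)).sub (h 4)

variable {α : ℝ} {x : ℝ → M5}

namespace IsWorldline

theorem hasDerivAt (hx : IsWorldline α x) (t : ℝ) : HasDerivAt x (deriv x t) t :=
  (hx.contDiff.differentiable (by norm_num) t).hasDerivAt

theorem contDiff_deriv (hx : IsWorldline α x) : ContDiff ℝ 1 (deriv x) := by
  have h : ContDiff ℝ (1 + 1) x := by
    rw [one_add_one_eq_two]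
    exact hx.contDiff
  exact (contDiff_succ_iff_deriv.1 h).2.2

theorem gm_self (hx : IsWorldline α x) (t : ℝ) : gm (x t) (x t) = -1 := (hx.mem t).1

theorem gm_deriv_self (hx : IsWorldline α x) (t : ℝ) : gm (deriv x t) (x t) = 0 := by
  have h1 := HasDerivAt.gm (hx.hasDerivAt t) (hx.hasDerivAt t)
  simp only [hx.gm_self] at h1
  have h2 := h1.unique (hasDerivAt_const t (-1 : ℝ))
  rw [gm_comm (x t)] at h2
  linarith

theorem contDiff_properDeriv (hx : IsWorldline α x) : ContDiff ℝ 1 (properDeriv x x) := by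
  have h1 : ContDiff ℝ 1 fun t => Real.sqrt (gm (deriv x t) (deriv x t)) :=
    (ContDiff.gm hx.contDiff_deriv hx.contDiff_deriv).sqrt fun t => (hx.future t).1.ne'
  exact (h1.inv fun t => (Real.sqrt_pos.2 (hx.future t).1).ne').smul hx.contDiff_deriv

theorem hasDerivAt_properDeriv (hx : IsWorldline α x) (t : ℝ) :
    HasDerivAt (properDeriv x x) (deriv (properDeriv x x) t) t :=
  (hx.contDiff_properDeriv.differentiable (by norm_num) t).hasDerivAt

theorem continuous_accel (hx : IsWorldline α x) : Continuous (accel x) := by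
  have h1 : Continuous fun t => Real.sqrt (gm (deriv x t) (deriv x t)) :=
    Real.continuous_sqrt.comp
      (continuous_gm hx.contDiff_deriv.continuous hx.contDiff_deriv.continuous)
  exact (h1.inv₀ fun t => (Real.sqrt_pos.2 (hx.future t).1).ne').smul
    (hx.contDiff_properDeriv.continuous_deriv le_rfl)

theorem gm_deriv_accel (hx : IsWorldline α x) (t : ℝ) : gm (deriv x t) (accel x t) = 0 := by
  have hone : ∀ s, gm (properDeriv x x s) (properDeriv x x s) = 1 := by
    intro s
    have h1 := (hx.future s).1
    have h2 := Real.sq_sqrt h1.le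
    have h3 := Real.sqrt_pos.2 h1
    rw [properDeriv, gm_smul_left, gm_smul_right]
    nth_rw 3 [← h2]
    field_simp
  have h1 := HasDerivAt.gm (hx.hasDerivAt_properDeriv t) (hx.hasDerivAt_properDeriv t)
  simp only [hone] at h1
  have h2 := h1.unique (hasDerivAt_const t (1 : ℝ))
  rw [gm_comm (properDeriv x x t)] at h2
  have h3 : gm (deriv (properDeriv x x) t) (properDeriv x x t) = 0 := by linarith
  have h4 := (Real.sqrt_pos.2 (hx.future t).1).ne'
  rw [properDeriv, gm_smul_right] at h3
  have h5 := (mul_eq_zero.1 h3).resolve_left (inv_ne_zero h4)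
  rw [accel, properDeriv, gm_smul_right, gm_comm (deriv x t) (deriv (properDeriv x x) t),
    h5, mul_zero]

theorem gm_accel_self (hx : IsWorldline α x) (t : ℝ) : gm (accel x t) (x t) = -1 := by
  have hzero : ∀ s, gm (properDeriv x x s) (x s) = 0 := by
    intro s
    rw [properDeriv, gm_smul_left, hx.gm_deriv_self, mul_zero]
  have h1 := HasDerivAt.gm (hx.hasDerivAt_properDeriv t) (hx.hasDerivAt t)
  simp only [hzero] at h1
  have h2 := h1.unique (hasDerivAt_const t (0 : ℝ))
  have h5 := (hx.future t).1
  have h6 := Real.sq_sqrt h5.le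
  have h7 := (Real.sqrt_pos.2 h5).ne'
  have h3 : gm (deriv (properDeriv x x) t) (x t) = -Real.sqrt (gm (deriv x t) (deriv x t)) := by
    have h4 : gm (properDeriv x x t) (deriv x t) = Real.sqrt (gm (deriv x t) (deriv x t)) := by
      rw [properDeriv, gm_smul_left]
      nth_rw 2 [← h6]
      field_simp
    linarith
  rw [accel, properDeriv, gm_smul_left, h3]
  field_simp

/-- `accel x t - x t` is the intrinsic acceleration, orthogonal to the velocity and hence of
nonpositive square. So the ambient acceleration has square at most `-1`, even on geodesics, and
always defines a wedge. -/
theorem gm_accel_neg (hx : IsWorldline α x) (t : ℝ) : gm (accel x t) (accel x t) < 0 := by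
  have h1 : gm (deriv x t) (accel x t - x t) = 0 := by
    rw [gm_sub_right, hx.gm_deriv_accel, hx.gm_deriv_self, sub_zero]
  have h2 := gm_self_nonpos_of_orthogonal (hx.future t).1 h1
  rw [gm_sub_left, gm_sub_right, gm_sub_right, gm_comm (x t) (accel x t), hx.gm_accel_self,
    hx.gm_self] at h2
  linarith

/-- The timelike vector of the frame of a worldline. -/
def frameE (x : ℝ → M5) (s : ℝ) : M5 :=
  (Real.sqrt (gm (deriv x s) (deriv x s)))⁻¹ • deriv x s

/-- The spacelike vector of the frame of a worldline. -/
def frameF (x : ℝ → M5) (s : ℝ) : M5 :=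
  (Real.sqrt (-gm (accel x s) (accel x s)))⁻¹ • accel x s

theorem isFrame (hx : IsWorldline α x) (s : ℝ) : IsFrame (frameE x s) (frameF x s) :=
  isFrame_of_boost (hx.future s) (hx.gm_deriv_accel s) (hx.gm_accel_neg s)

theorem continuous_frameE (hx : IsWorldline α x) : Continuous (frameE x) :=
  hx.contDiff_properDeriv.continuous

theorem continuous_frameF (hx : IsWorldline α x) : Continuous (frameF x) := by
  have h1 : Continuous fun t => Real.sqrt (-gm (accel x t) (accel x t)) :=
    Real.continuous_sqrt.comp (continuous_gm hx.continuous_accel hx.continuous_accel).neg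
  exact (h1.inv₀ fun t => (Real.sqrt_pos.2 (by linarith [hx.gm_accel_neg t])).ne').smul
    hx.continuous_accel

theorem mem_wedge (hx : IsWorldline α x) (s : ℝ) : x s ∈ (hx.isFrame s).wedge.1 := by
  refine ⟨?_, (hx.mem s).1⟩
  change |gm (frameE x s) (x s)| < -gm (frameF x s) (x s)
  have h2 : 0 < Real.sqrt (-gm (accel x s) (accel x s)) :=
    Real.sqrt_pos.2 (by linarith [hx.gm_accel_neg s])
  rw [frameE, frameF, gm_smul_left, gm_smul_left, hx.gm_deriv_self, hx.gm_accel_self, mul_zero,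
    abs_zero]
  have := inv_pos.2 h2
  linarith

end IsWorldline

/-- The time component of a future timelike velocity dominates every other component, so all `x 0 ±
x i` are monotone. Positive time bounds them below, and the resulting past limit stays in the
space-time, between times zero and `x 0 0`. -/
theorem exists_tendsto_atBot {x : ℝ → M5} (hmem : ∀ t, x t ∈ RW α) (hd : Differentiable ℝ x)
    (hf : ∀ t, FutureTimelike (deriv x t)) (hpos : ∀ t, 0 < x t 0) :
    ∃ p ∈ RW α, Tendsto x atBot (𝓝 p) := by
  have hdi : ∀ i t, HasDerivAt (fun t => x t i) (deriv x t i) t := fun i t =>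
    hasDerivAt_pi.1 (hd t).hasDerivAt i
  have hle : ∀ i t, |deriv x t i| ≤ deriv x t 0 := by
    intro i t
    obtain ⟨h1, h2⟩ := hf t
    refine abs_le_of_sq_le_sq ?_ h2.le
    rw [gm_apply] at h1
    fin_cases i
    · exact le_rfl
    all_goals
      simp only [Fin.mk_one, Fin.reduceFinMk]
      nlinarith [mul_self_nonneg (deriv x t 1), mul_self_nonneg (deriv x t 2),
        mul_self_nonneg (deriv x t 3), mul_self_nonneg (deriv x t 4)]
  have hmono : ∀ c : ℝ, |c| ≤ 1 → ∀ i, Monotone fun t => x t 0 + c * x t i := by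
    intro c hc i
    refine monotone_of_hasDerivAt_nonneg (f' := fun t => deriv x t 0 + c * deriv x t i)
      (fun t => (hdi 0 t).add ((hdi i t).const_mul c)) fun t => ?_
    have h1 := hle i t
    have h2 : |c * deriv x t i| ≤ deriv x t 0 := by
      rw [abs_mul]
      calc |c| * |deriv x t i| ≤ 1 * |deriv x t i| := by gcongr
        _ ≤ _ := by rwa [one_mul]
    have := (abs_le.1 h2).1
    simp only [Pi.zero_apply]
    linarith
  have hbdd : ∀ c : ℝ, |c| ≤ 1 → ∀ i, BddBelow (Set.range fun t => x t 0 + c * x t i) := by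
    intro c hc i
    -- For `t ≤ 0` the bound comes from monotonicity with `-c` in place of `c`, together with
    -- positivity of the time coordinate.
    refine ⟨c * x 0 i - x 0 0, ?_⟩
    rintro _ ⟨t, rfl⟩
    simp only
    rcases le_total t 0 with ht | ht
    · have h1 := hmono (-c) (by rwa [abs_neg]) i ht
      have h2 := hpos t
      simp only at h1
      linarith
    · have h1 := hmono c hc i ht
      have h2 := hpos 0
      simp only at h1
      linarith
  have hlim : ∀ c : ℝ, |c| ≤ 1 → ∀ i, ∃ l, Tendsto (fun t => x t 0 + c * x t i) atBot (𝓝 l) :=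
    fun c hc i => ⟨_, tendsto_atBot_ciInf (hmono c hc i) (hbdd c hc i)⟩
  have hlim' : ∀ i, ∃ l, Tendsto (fun t => x t i) atBot (𝓝 l) := by
    intro i
    obtain ⟨l₁, h1⟩ := hlim 1 (by norm_num) i
    obtain ⟨l₂, h2⟩ := hlim (-1) (by norm_num) i
    refine ⟨(l₁ - l₂) / 2, ((h1.sub h2).div_const 2).congr fun t => ?_⟩
    ring
  choose p hp using hlim'
  have htend : Tendsto x atBot (𝓝 p) := tendsto_pi_nhds.2 hp
  refine ⟨p, ⟨?_, ?_⟩, htend⟩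
  · have hcont : Continuous fun y : M5 => gm y y := continuous_gm continuous_id continuous_id
    have h1 := (hcont.tendsto p).comp htend
    refine tendsto_nhds_unique h1 ?_
    refine tendsto_const_nhds.congr fun t => ?_
    exact (hmem t).1.symm
  · have h1 : 0 ≤ p 0 := ge_of_tendsto' (hp 0) fun t => (hpos t).le
    have h2 : p 0 ≤ x 0 0 := by
      refine le_of_tendsto (hp 0) ?_
      filter_upwards [eventually_le_atBot 0] with t ht
      have := hmono 0 (by norm_num) 0 ht
      simpa using this
    have h3 := (hmem 0).2
    unfold tau at h3 ⊢
    rw [abs_of_nonneg (Real.arctan_nonneg.2 h1)]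
    exact (Real.arctan_mono h2).trans_lt ((le_abs_self _).trans_lt h3)

theorem neg_mem_RW {y : M5} (hy : y ∈ RW α) : -y ∈ RW α := by
  obtain ⟨h1, h2⟩ := hy
  refine ⟨?_, ?_⟩
  · change gm (-y) (-y) = -1
    rw [gm_neg_left, gm_neg_right, neg_neg]
    exact h1
  · unfold tau at h2 ⊢
    rwa [Pi.neg_apply, Real.arctan_neg, abs_neg]

theorem tau_eq_zero_iff (y : M5) : tau y = 0 ↔ y 0 = 0 := by
  unfold tau
  rw [Real.arctan_eq_zero_iff]

namespace IsWorldline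

/-- An inextendible worldline meets the time zero hypersurface exactly once. -/
theorem exists_unique_time (hx : IsWorldline α x) : ∃ t₀, ∀ t, tau (x t) = 0 ↔ t = t₀ := by
  have hd0 : ∀ t, HasDerivAt (fun t => x t 0) (deriv x t 0) t := fun t =>
    hasDerivAt_pi.1 (hx.hasDerivAt t) 0
  have hmono : StrictMono fun t => x t 0 :=
    strictMono_of_hasDerivAt_pos hd0 fun t => (hx.future t).2
  have hcont : Continuous fun t => x t 0 := (continuous_apply 0).comp hx.contDiff.continuous
  have hd : Differentiable ℝ x := fun t => (hx.hasDerivAt t).differentiableAt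
  obtain ⟨t₀, ht₀⟩ : ∃ t₀, x t₀ 0 = 0 := by
    by_cases hneg : ∃ a, x a 0 ≤ 0
    · by_cases hpos : ∃ b, 0 ≤ x b 0
      · obtain ⟨a, ha⟩ := hneg
        obtain ⟨b, hb⟩ := hpos
        exact mem_range_of_exists_le_of_exists_ge hcont ⟨a, ha⟩ ⟨b, hb⟩
      · exfalso
        push Not at hpos
        -- Reversing the parameter and reflecting through the origin again gives a future directed
        -- curve, now at positive times; its past limit is the forbidden future limit.
        have hder : ∀ t, HasDerivAt (fun t => -x (-t)) (deriv x (-t)) t := by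
          intro t
          have h1 := (HasDerivAt.scomp t (hx.hasDerivAt (-t)) (hasDerivAt_neg t)).neg
          exact h1.congr_deriv (by simp)
        obtain ⟨p, hp, hlim⟩ := exists_tendsto_atBot (x := fun t => -x (-t))
          (fun t => neg_mem_RW (hx.mem (-t))) (fun t => (hder t).differentiableAt)
          (fun t => by rw [(hder t).deriv]; exact hx.future (-t))
          (fun t => by simpa using hpos (-t))
        refine hx.no_future_end (-p) (neg_mem_RW hp) ?_
        have h2 := (hlim.comp tendsto_neg_atTop_atBot).neg
        simpa [Function.comp_def] using h2
    · exfalso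
      push Not at hneg
      obtain ⟨p, hp, hlim⟩ := exists_tendsto_atBot hx.mem hd hx.future hneg
      exact hx.no_past_end p hp hlim
  refine ⟨t₀, fun t => ?_⟩
  rw [tau_eq_zero_iff]
  constructor
  · intro h
    exact hmono.injective (h.trans ht₀.symm)
  · rintro rfl
    exact ht₀

/-- At time zero, rescaling multiplies `gm m x` by `sin α ≤ 1` and does not decrease `gm m m`, so
membership in `W` implies the rescaled condition. That condition is open in `s`, because the
acceleration of a `C²` curve is continuous. -/
theorem exists_Ioo_mem_Xi (hx : IsWorldline α x) (h0 : 0 < α) (hα : α ≤ Real.pi / 2) {t₀ : ℝ}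
    (ht₀ : x t₀ 0 = 0) :
    ∃ a b, t₀ ∈ Set.Ioo a b ∧ ∀ s ∈ Set.Ioo a b, x s ∈ Xi α (hx.isFrame s).wedge := by
  set c := Real.sin α with hc
  have hc1 : c ^ 2 ≤ 1 := Real.sin_sq_le_one α
  have hxc := hx.contDiff.continuous
  have he := hx.continuous_frameE
  have hf := hx.continuous_frameF
  have he0 : Continuous fun s => frameE x s 0 := (continuous_apply 0).comp he
  have hf0 : Continuous fun s => frameF x s 0 := (continuous_apply 0).comp hf
  have hN := fun s => (hx.isFrame s).one_le
  have hcn : Continuous fun s => frameN (frameE x s) (frameF x s) := by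
    have h1 : Continuous fun s => Real.sqrt (frameE x s 0 ^ 2 - frameF x s 0 ^ 2) := by fun_prop
    exact (h1.inv₀ fun s => (Real.sqrt_pos.2 (by linarith [hN s])).ne').smul
      ((he0.smul hf).sub (hf0.smul he))
  have hcm : Continuous fun s => frameM (frameE x s) (frameF x s) := by
    have h1 : Continuous fun s => frameE x s 0 ^ 2 - frameF x s 0 ^ 2 := by fun_prop
    exact (h1.inv₀ fun s => by linarith [hN s]).smul ((he0.smul he).sub (hf0.smul hf))
  have hcm' : Continuous fun s => scaleVel c (frameM (frameE x s) (frameF x s)) := by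
    refine continuous_pi fun i => ?_
    have := (continuous_apply i).comp hcm
    by_cases hi : i = 0
    · subst hi
      simpa [scaleVel, Function.comp_def] using this
    · simpa [scaleVel, hi, Function.comp_def] using this.const_mul c
  set n := fun s => frameN (frameE x s) (frameF x s) with hn
  set m := fun s => frameM (frameE x s) (frameF x s) with hm
  have hopen : IsOpen {s | x s ∈ cone (n s) (scaleVel c (m s))} := by
    refine (isOpen_lt continuous_const (continuous_gm hcn hxc).neg).inter
      (isOpen_lt ((continuous_gm hcm' hxc).pow 2) (((continuous_gm hcn hxc).pow 2).mul
        (continuous_gm hcm' hcm')))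
  have hmem : x t₀ ∈ cone (n t₀) (scaleVel c (m t₀)) := by
    obtain ⟨h1, h2⟩ := (((hx.isFrame t₀).mem_wedge_iff _).1 (hx.mem_wedge t₀)).1
    have hnorm := (hx.isFrame t₀).isNormal
    refine ⟨h1, ?_⟩
    have h3 : gm (m t₀) (x t₀) = -sp (m t₀) (x t₀) := by rw [gm_eq_sp, ht₀]; ring
    have h4 : gm (scaleVel c (m t₀)) (x t₀) = c * gm (m t₀) (x t₀) := by
      rw [gm_scaleVel, ht₀, h3]; ring
    have h5 : gm (m t₀) (m t₀) ≤ gm (scaleVel c (m t₀)) (scaleVel c (m t₀)) := by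
      rw [hnorm.gm_scaleVel_self]
      have h6 := hnorm.sp_m
      have h7 := sp_self_nonneg (m t₀)
      change gm (m t₀) (m t₀) ≤ 1 - c ^ 2 * (1 - gm (m t₀) (m t₀))
      have h8 : sp (m t₀) (m t₀) = 1 - gm (m t₀) (m t₀) := h6
      nlinarith
    rw [h4]
    calc (c * gm (m t₀) (x t₀)) ^ 2 = c ^ 2 * gm (m t₀) (x t₀) ^ 2 := by ring
      _ ≤ gm (m t₀) (x t₀) ^ 2 := mul_le_of_le_one_left (sq_nonneg _) hc1
      _ < gm (n t₀) (x t₀) ^ 2 * gm (m t₀) (m t₀) := h2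
      _ ≤ _ := by gcongr
  obtain ⟨a, b, hab, hsub⟩ := mem_nhds_iff_exists_Ioo_subset.1 (hopen.mem_nhds hmem)
  refine ⟨a, b, hab, fun s hs => ?_⟩
  rw [(hx.isFrame s).Xi_wedge h0 hα]
  exact ⟨hsub hs, hx.mem s⟩

end IsWorldline

/-- The velocity of the curve `t ↦ lam (s + t) (lam s)⁻¹` in the de Sitter group. -/
theorem IsTimeOrderedExp.hasDerivAt_propagator {M : ℝ → Matrix (Fin 5) (Fin 5) ℝ} {lam : ℝ → SO0}
    (h : IsTimeOrderedExp M lam) (s : ℝ) (i j : Fin 5) :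
    HasDerivAt (fun r => (lam (s + r) * (lam s)⁻¹).1.1 i j) (M s i j) 0 := by
  have h1 : ∀ k, HasDerivAt (fun r => (lam (s + r)).1.1 i k) ((M s * (lam s).1.1) i k) 0 := by
    intro k
    have := h.2 s i k
    rw [← add_zero s] at this
    simpa using HasDerivAt.comp_const_add s 0 this
  have h2 : (lam s).1.1 * ((lam s)⁻¹).1.1 = 1 := by
    have : (lam s * (lam s)⁻¹).1.1 = (1 : SO0).1.1 := by rw [mul_inv_cancel]
    exact this
  have h3 : M s i j = ∑ k, (M s * (lam s).1.1) i k * ((lam s)⁻¹).1.1 k j := by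
    rw [← Matrix.mul_apply, Matrix.mul_assoc, h2, Matrix.mul_one]
  have h4 : (fun r => (lam (s + r) * (lam s)⁻¹).1.1 i j) =
      fun r => ∑ k, (lam (s + r)).1.1 i k * ((lam s)⁻¹).1.1 k j := by
    funext r
    exact Matrix.mul_apply
  rw [h3, h4]
  exact HasDerivAt.fun_sum fun k _ => (h1 k).mul_const _

theorem hasDerivAt_oneParam_entry {M : Matrix (Fin 5) (Fin 5) ℝ} (hM : IsSkew M) (i j : Fin 5) :
    HasDerivAt (fun r => (oneParam M hM r).1.1 i j) (M i j) 0 := by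
  let _ : NormedRing (Matrix (Fin 5) (Fin 5) ℝ) := Matrix.linftyOpNormedRing
  let _ : NormedAlgebra ℝ (Matrix (Fin 5) (Fin 5) ℝ) := Matrix.linftyOpNormedAlgebra
  have h1 := hasDerivAt_exp_smul_const M (0 : ℝ)
  rw [zero_smul, NormedSpace.exp_zero, one_mul] at h1
  exact hasDerivAt_pi.1 (hasDerivAt_pi.1 h1 i) j

end Worldline

end DSRW

end

/-! ### The theorem on quasi-passivity and localization -/

theorem theorem4p4 {H : Type*} [NormedAddCommGroup H] [InnerProductSpace ℂ H] [CompleteSpace H]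
    (T : DSRW.DSTheory H) (hKMS : T.GeodesicKMS)
    (α : ℝ) (hα0 : 0 < α) (hα : α ≤ Real.pi / 2)
    (x : ℝ → DSRW.M5) (hx : DSRW.IsWorldline α x)
    (lam : ℝ → DSRW.SO0) (hlam : DSRW.IsTimeOrderedExp (DSRW.gen x) lam) :
    -- `W s` is the unique wedge on which the boosts generated by `M_s` are future directed
    ∃ W : ℝ → DSRW.DSWedge,
      (∀ s, DSRW.InducesFutureFlow (DSRW.gen x s) (DSRW.gen_skew x s) (W s) ∧
        ∀ W', DSRW.InducesFutureFlow (DSRW.gen x s) (DSRW.gen_skew x s) W' → W' = W s) ∧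
      -- quasi-passivity on the algebra of `Ξ (W s)`
      (∀ s, ∀ U ∈ T.rwNet α ⟨DSRW.Xi α (W s), W s, rfl⟩, U ∈ unitary (H →L[ℂ] H) →
        -- for the derivative of the propagator `α_{t,s}` at `t = s`
        (DSRW.InDerivationDomain (fun t => T.propagator lam t s) s U →
          ∃ h : U T.Ω ∈ (T.hamiltonian (DSRW.gen x s) (DSRW.gen_skew x s)).domain,
            HasDerivAt
              (fun t => -Complex.I * inner ℂ T.Ω ((star U * T.propagator lam t s U) T.Ω))
              (inner ℂ T.Ω
                (star U (T.hamiltonian (DSRW.gen x s) (DSRW.gen_skew x s) ⟨U T.Ω, h⟩))) s ∧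
            ∃ E : ℝ, 0 ≤ E ∧ inner ℂ T.Ω
              (star U (T.hamiltonian (DSRW.gen x s) (DSRW.gen_skew x s) ⟨U T.Ω, h⟩)) = E) ∧
        -- for the derivation that generates `Ad U(exp (t M_s))`
        (DSRW.InDerivationDomain
            (fun t => T.Ad (DSRW.oneParam (DSRW.gen x s) (DSRW.gen_skew x s) t)) 0 U →
          ∃ h : U T.Ω ∈ (T.hamiltonian (DSRW.gen x s) (DSRW.gen_skew x s)).domain,
            ∃ E : ℝ, 0 ≤ E ∧ inner ℂ T.Ω
              (star U (T.hamiltonian (DSRW.gen x s) (DSRW.gen_skew x s) ⟨U T.Ω, h⟩)) = E)) ∧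
      -- localization
      (∀ s, x s ∈ (W s).1) ∧
      (∃ t₀, (∀ t, DSRW.tau (x t) = 0 ↔ t = t₀) ∧
        ∃ a b, t₀ ∈ Set.Ioo a b ∧ ∀ s ∈ Set.Ioo a b, x s ∈ DSRW.Xi α (W s)) ∧
      (α = Real.pi / 2 → ∀ s, x s ∈ DSRW.Xi α (W s)) := by
  have hflow : ∀ s, DSRW.InducesFutureFlow (DSRW.gen x s) (DSRW.gen_skew x s)
      (hx.isFrame s).wedge := fun s =>
    DSRW.inducesFutureFlow_boost (hx.future s) (hx.gm_deriv_accel s) (hx.gm_accel_neg s)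
  refine ⟨fun s => (hx.isFrame s).wedge, fun s => ⟨hflow s, fun W' hW' =>
    DSRW.eq_wedge_of_inducesFutureFlow (hx.future s) (hx.gm_deriv_accel s) (hx.gm_accel_neg s)
      hW'⟩, fun s U hU hu => ⟨?_, ?_⟩, hx.mem_wedge, ?_, ?_⟩
  · rintro ⟨D, hD⟩
    rw [T.rwNet_Xi hα0 hα] at hU
    obtain ⟨h, h1, h2⟩ := DSRW.DSTheory.quasiPassive hKMS (hflow s)
      (g := fun r => lam (s + r) * (lam s)⁻¹) (by simp) (hlam.hasDerivAt_propagator s) hU hu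
      (D := D) (fun φ ψ => by
        have := hD φ ψ
        rw [← add_zero s] at this
        simpa [DSRW.DSTheory.propagator] using HasDerivAt.comp_const_add s 0 this)
    refine ⟨h, ?_, h2⟩
    rw [h1]
    have h3 : ∀ B : H, inner ℂ T.Ω (star U B) = inner ℂ (U T.Ω) B := fun B => by
      rw [ContinuousLinearMap.star_eq_adjoint, ContinuousLinearMap.adjoint_inner_right]
    simp only [mul_apply_eq_comp, h3, inner_smul_right]
    exact (hD (U T.Ω) T.Ω).const_mul _
  · rintro ⟨D, hD⟩
    rw [T.rwNet_Xi hα0 hα] at hU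
    obtain ⟨h, -, h2⟩ := DSRW.DSTheory.quasiPassive hKMS (hflow s)
      (g := DSRW.oneParam (DSRW.gen x s) (DSRW.gen_skew x s)) (DSRW.oneParam_zero _ _)
      (DSRW.hasDerivAt_oneParam_entry _) hU hu hD
    exact ⟨h, h2⟩
  · obtain ⟨t₀, ht₀⟩ := hx.exists_unique_time
    exact ⟨t₀, ht₀, hx.exists_Ioo_mem_Xi hα0 hα
      ((DSRW.tau_eq_zero_iff _).1 ((ht₀ t₀).2 rfl))⟩
  · intro hpi s
    rw [(hx.isFrame s).Xi_wedge hα0 hα]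
    -- For `sin α = 1` the rescaling is trivial, so `Ξ W` is the part of `W` in the space-time.
    rw [hpi, Real.sin_pi_div_two, DSRW.scaleVel_one, ← hpi]
    exact ⟨(((hx.isFrame s).mem_wedge_iff _).1 (hx.mem_wedge s)).1, hx.mem s⟩
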